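/- Let $K$ be an algebraically closed field of characteristic zero and let $\mathcal F_d$ be the space of forms of degree $d$ in $x_0,x_1,x_2,x_3$ over $K$. Let $\mathbb G(k,E)$ denote the Grassmannian of $k$-dimensional subspaces of a vector space $E$. Let $\mathbb X\subset\mathbb G(3,\mathcal F_2)$ be the variety of determinantal nets of quadrics, i.e. of the 3-dimensional subspaces of $\mathcal F_2$ spanned by the $2\times 2$ minors of a $3\times 2$ matrix of linear forms, and let $\mathbb G\subset\mathbb X$ be the image of the Grassmannian of lines $\mathbb G(2,\mathcal F_1)$ under $L\mapsto L^2$ (thus $\langle l,l'\rangle\mapsto\langle l^2,ll',l'^2\rangle$). For $\pi\in\mathbb X$ let $\mu_\pi:S_2(\pi)\to\mathcal F_4$ be the multiplication map; its image is the span $\pi^2$ of the products $qq'$ with $q,q'\in\pi$. Let $\widehat{\mathbb X}\to\mathbb X$ be the blow-up of $\mathbb X$ along $\mathbb G$ (the reduced subvariety). Then $\mathbb X\setminus\mathbb G$ is dense in $\mathbb X$, $\pi^2$ has dimension $6$ for every $\pi\in\mathbb X\setminus\mathbb G$, and $\pi\mapsto\pi^2$ is a morphism $\mathbb X\setminus\mathbb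 G\to\mathbb G(6,\mathcal F_4)$, i.e. a rational map $\mathbb X\dashrightarrow\mathbb G(6,\mathcal F_4)$. This rational map extends to a morphism $\Phi:\widehat{\mathbb X}\to\mathbb G(6,\mathcal F_4)$: over $\mathbb X\setminus\mathbb G$, $\Phi$ is the composite of the blow-up morphism with $\pi\mapsto\pi^2$. The blow-up morphism and $\Phi$ together define a closed embedding $\widehat{\mathbb X}\hookrightarrow\mathbb X\times\mathbb G(6,\mathcal F_4)$ over $\mathbb X$. The pullback to $\widehat{\mathbb X}$ of the tautological rank-$6$ subbundle of $\mathcal F_4$ contains the image of the pullback of $\mu$: for every $p\in\widehat{\mathbb X}$ over $\pi\in\mathbb X$ one has $\pi^2\subseteq\Phi(p)$. -/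

import Mathlib

namespace DetNets

noncomputable section

/-! ## Classical varieties over an algebraically closed field

Varieties are subsets of Grassmannians and of products of two of them.  A point of a Grassmannian
is described by its frames (the spanning tuples), in the same way as a point of projective space
is described by its homogeneous coordinate vectors. -/

section Varieties

variable (K : Type*) [Field K]

/-- Polynomial functions on a (finite-dimensional) `K`-vector space: the algebra of functions
generated by the linear forms. -/
def IsPoly {A : Type*} [AddCommGroup A] [Module K A] (f : A → K) : Prop :=
  f ∈ Algebra.adjoin K (Set.range fun φ : Module.Dual K A => (φ : A → K))

/-- Polynomial maps between (finite-dimensional) `K`-vector spaces. -/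
def IsPolyMap {A B : Type*} [AddCommGroup A] [Module K A] [AddCommGroup B] [Module K B]
    (g : A → B) : Prop :=
  ∀ φ : Module.Dual K B, IsPoly K fun a => φ (g a)

/-- The set of points of `G(k, E)`: the `k`-dimensional subspaces of `E`. -/
abbrev Gr (E : Type*) [AddCommGroup E] [Module K E] (k : ℕ) : Type _ :=
  {W : Submodule K E // Module.finrank K W = k}

/-- A set `M` whose points are described by generalized homogeneous coordinates, the frames, which
are vectors of `A`.  The two instances are Grassmannians and products. -/
class Framed (M : Type*) (A : outParam (Type*)) where
  /-- `IsFrame a p`: the vector `a` is a coordinate vector of the point `p`. -/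
  IsFrame : A → M → Prop
  exists_frame : ∀ p : M, ∃ a : A, IsFrame a p
  eq_of_isFrame : ∀ (a : A) (p q : M), IsFrame a p → IsFrame a q → p = q

/-- A frame of a `k`-dimensional subspace is a `k`-tuple that spans it (hence a basis). -/
instance Gr.instFramed (E : Type*) [AddCommGroup E] [Module K E] [FiniteDimensional K E] (k : ℕ) :
    Framed (Gr K E k) (Fin k → E) where
  IsFrame v W := Submodule.span K (Set.range v) = W.1
  exists_frame W := by
    obtain ⟨W, hW⟩ := W
    refine ⟨fun i => ((Module.finBasisOfFinrankEq K W hW i : W) : E), ?_⟩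
    have h := (Module.finBasisOfFinrankEq K W hW).span_eq
    have h2 := congrArg (Submodule.map W.subtype) h
    rw [Submodule.map_span, Submodule.map_top, Submodule.range_subtype, ← Set.range_comp] at h2
    exact h2
  eq_of_isFrame _ _ _ h h' := Subtype.ext (h.symm.trans h')

instance Prod.instFramed {M N A B : Type*} [Framed M A] [Framed N B] :
    Framed (M × N) (A × B) where
  IsFrame a p := Framed.IsFrame a.1 p.1 ∧ Framed.IsFrame a.2 p.2
  exists_frame p := by
    obtain ⟨a, ha⟩ := Framed.exists_frame p.1
    obtain ⟨b, hb⟩ := Framed.exists_frame p.2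
    exact ⟨(a, b), ha, hb⟩
  eq_of_isFrame a p q h h' :=
    Prod.ext (Framed.eq_of_isFrame a.1 _ _ h.1 h'.1) (Framed.eq_of_isFrame a.2 _ _ h.2 h'.2)

variable {M N A B : Type*} [AddCommGroup A] [Module K A] [AddCommGroup B] [Module K B]
  [Framed M A] [Framed N B]

/-- Zariski closed subsets: those cut out by polynomial equations on the frames. -/
def IsZariskiClosed (Z : Set M) : Prop :=
  ∃ I : Set (A → K), (∀ f ∈ I, IsPoly K f) ∧
    ∀ (p : M) (a : A), Framed.IsFrame a p → (p ∈ Z ↔ ∀ f ∈ I, f a = 0)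

/-- The Zariski closure of a subset. -/
def zariskiClosure (S : Set M) : Set M :=
  ⋂₀ {Z : Set M | IsZariskiClosed K Z ∧ S ⊆ Z}

/-- Morphisms from a (locally closed) subset `T` of `M` to `N`: maps that, near every frame `a` of
every point of `T`, are given by a polynomial map on the frames.  (The condition that `g b` is a
frame is an open condition on `b`, and it holds at `b = a`.) -/
def IsMorphism {T : Set M} (f : T → N) : Prop :=
  ∀ (p : T) (a : A), Framed.IsFrame a (p : M) →
    ∃ g : A → B, IsPolyMap K g ∧ Framed.IsFrame (g a) (f p) ∧
      ∀ (p' : T) (b : A), Framed.IsFrame b (p' : M) →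
        ∀ q : N, Framed.IsFrame (g b) q → q = f p'

/-- `f` is an embedding (a closed immersion) of the variety `T` into the variety `T'`: a morphism
whose image is a closed subset of `T'` and which is an isomorphism onto its image. -/
def IsClosedEmbedding {T : Set M} (f : T → N) (T' : Set N) : Prop :=
  IsMorphism K f ∧
  (∃ C : Set N, IsZariskiClosed K C ∧ Set.range f = T' ∩ C) ∧
  ∃ g : Set.range f → M, IsMorphism K g ∧ ∀ p : T, g ⟨f p, p, rfl⟩ = p

end Varieties

/-! ## Blow-ups of subvarieties of Grassmannians -/

section BlowUp

variable (K : Type*) [Field K] {E : Type*} [AddCommGroup E] [Module K E] [FiniteDimensional K E]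
  {k r : ℕ}

/-- Sections of `𝒪(d)` on `G(k, E)`: polynomial functions `F` on the `k`-tuples of vectors such that
`F (g • v) = det(g) ^ d * F v` (for `k = 1`: homogeneous forms of degree `d` on `E`). -/
def IsSection (d : ℕ) (F : (Fin k → E) → K) : Prop :=
  IsPoly K F ∧ ∀ (g : Matrix (Fin k) (Fin k) K) (v : Fin k → E),
    F (fun i => ∑ j, g i j • v j) = g.det ^ d * F v

/-- The polynomial function `f` vanishes on all frames of points of `Y`. -/
def VanishesOn (Y : Set (Gr K E k)) (f : (Fin k → E) → K) : Prop :=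
  ∀ W ∈ Y, ∀ b : Fin k → E, Framed.IsFrame b W → f b = 0

/-- The sections `F 0, …, F (r - 1)` of `𝒪(d)` generate the ideal sheaf of `Y` in `X`: they vanish
on `Y`, and at every frame `a` over `X` every polynomial function `f` vanishing on `Y` belongs to
the ideal they generate in the local ring at `a` of the variety of frames over `X`. -/
def GenerateIdealSheaf (X Y : Set (Gr K E k)) (d : ℕ) (F : Fin r → (Fin k → E) → K) : Prop :=
  (∀ i, IsSection K d (F i)) ∧ (∀ i, VanishesOn K Y (F i)) ∧
  ∀ V ∈ X, ∀ a : Fin k → E, Framed.IsFrame a V →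
    ∀ f : (Fin k → E) → K, IsPoly K f → VanishesOn K Y f →
      ∃ (u : (Fin k → E) → K) (c : Fin r → (Fin k → E) → K),
        IsPoly K u ∧ (∀ i, IsPoly K (c i)) ∧ u a ≠ 0 ∧
        VanishesOn K X fun b => u b * f b - ∑ i, c i b * F i b

/-- The graph of `X ∖ Y → ℙ^(r-1)`, `V ↦ [F 0 : … : F (r - 1)]`, where `ℙ^(r-1) = G(1, K^r)`. -/
def blowUpGraph (X Y : Set (Gr K E k)) (F : Fin r → (Fin k → E) → K) :
    Set (Gr K E k × Gr K (Fin r → K) 1) :=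
  {p | p.1 ∈ X \ Y ∧ ∀ a : Fin k → E, Framed.IsFrame a p.1 →
    p.2.1 = Submodule.span K {fun i => F i a}}

/-- The blow-up of `X` along `Y`: for sections `F` of `𝒪(d)` which generate the ideal sheaf of `Y`
in `X`, the closure in `X × ℙ^(r-1)` of the graph of `[F 0 : … : F (r - 1)]` over `X ∖ Y`.
The blow-up morphism to `X` is the first projection. -/
def blowUp (X Y : Set (Gr K E k)) (F : Fin r → (Fin k → E) → K) :
    Set (Gr K E k × Gr K (Fin r → K) 1) :=
  (X ×ˢ Set.univ) ∩ zariskiClosure K (blowUpGraph K X Y F)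

end BlowUp

/-! ## Determinantal nets of quadrics -/

section Nets

variable (K : Type*) [Field K]

/-- `ℱ_d`: the forms of degree `d` in `x₀, x₁, x₂, x₃`. -/
abbrev Form (d : ℕ) : Type _ := MvPolynomial.homogeneousSubmodule (Fin 4) K d

instance Form.instFiniteDimensional (d : ℕ) : FiniteDimensional K (Form K d) :=
  Module.Finite.iff_fg.mpr (MvPolynomial.homogeneousSubmodule_fg (σ := Fin 4) (R := K) d)

variable {K}

/-- `V²`, the span of the products `q * q'` with `q, q' ∈ V`: the image of the multiplication map
`S₂(V) → ℱ_{2d}`. -/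
def square {d : ℕ} (V : Submodule K (Form K d)) : Submodule K (Form K (2 * d)) :=
  Submodule.span K {f | ∃ q ∈ V, ∃ q' ∈ V, (f : MvPolynomial (Fin 4) K) = q * q'}

/-- The span of the `2 × 2` minors of a `3 × 2` matrix of linear forms. -/
def minorSpan (m : Matrix (Fin 3) (Fin 2) (Form K 1)) : Submodule K (Form K 2) :=
  Submodule.span K {f | ∃ i j : Fin 3, i < j ∧
    (f : MvPolynomial (Fin 4) K) = m i 0 * m j 1 - m i 1 * m j 0}

variable (K)

/-- `𝕏 ⊆ G(3, ℱ₂)`: the determinantal nets of quadrics. -/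
def detNets : Set (Gr K (Form K 2) 3) :=
  {V | ∃ m : Matrix (Fin 3) (Fin 2) (Form K 1), V.1 = minorSpan m}

/-- `𝔾 ⊆ G(3, ℱ₂)`: the squares `L²` of the points `L` of `G(2, ℱ₁)`, that is, of the lines. -/
def doubleLines : Set (Gr K (Form K 2) 3) :=
  {V | ∃ L : Gr K (Form K 1) 2, V.1 = square L.1}

end Nets

end

end DetNets

open DetNets

/-! The variety of determinantal nets has an explicit chart at a double line.  Let `z₀, …, z₃` be
coordinates in which the line is `z₀ = z₁ = 0`.  A net near `⟨z₀², z₀z₁, z₁²⟩` has a unique frame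
`N = (N₀, N₁, N₂)` which restricts to `(z₀², z₀z₁, z₁²)` on the line `z₂ = z₃ = 0`, and as a
determinantal net it consists of the minors of a matrix with rows
`(p, w₄), (q + w₂, p + w₃), (w₁, q)`, where `p - z₀`, `q - z₁` and the `wᵢ` are forms in `z₂, z₃`
(`exists_eq_normalNet`).  The twelve coefficients of these forms are linear in `N`, and the double
lines are the nets with `w = 0`.  The quartic `N₀N₂ - N₁²` vanishes for `w = 0`, and the
coefficients of `wᵢ` are, up to sign, among its coefficients (`normalCoeff_conic_normalNet`).  Since
a net differs from its projection `(p², pq, q²)` to the double lines by terms in the ideal of the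
`wᵢ`, the coefficients of this quartic generate the ideal of the double lines
(`exists_eq_apply_deltaForm`).  This is the only information on the ideal sheaf that is needed.

The six products of the quadrics of a net other than a double line are independent.  A relation
between them is a quadratic form in the quadrics, which is diagonalized.  If it has rank 1 or 2, it
is a product of two nonzero quadrics, so it does not vanish; if it has rank 3, it is brought to the
form `xy = z²`, and by unique factorization the net is `⟨p², pq, q²⟩`
(`linearIndependent_products`).  So `V ↦ V²` is a morphism outside the double lines.

Both `V ↦ V²` and the map `V ↦ [F₀ : … : F_{r-1}]` given by generators of the ideal sheaf define
graphs, and it suffices to extend each of the maps locally, by polynomials in the frames, to the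
closure of the graph of the other (`IsExtension.isClosedEmbedding`): the extensions are then
mutually inverse isomorphisms of the closures.  Near a double line, `V²` has the frame
`N₀², N₀N₁, N₀N₂, N₁N₂, N₂²` and `N₀N₂ - N₁²`.  On the line `z₂ = z₃ = 0` the first five restrict to
the five monomials of degree 4, and the last one to zero.  The last one may be scaled, and a point
`y` of the blow-up prescribes a nonzero multiple of it, as the generators `F` and its coefficients
generate the same ideal (`locallyExtends_squareMap`).  Conversely a limit `Y` of the spaces `V²`
contains a quartic `e ≠ 0` which vanishes on that line, and the minors of `Y` which contain the five
coefficients of the restriction are the coefficients of `e`; so they determine `y`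
(`locallyExtends_generatorMap`).

The minors of the six products of a frame are, by the same triangular shape, generators of the ideal
sheaf (`generateIdealSheaf_productMinor`).  The double lines are limits of other determinantal nets
because the minors of the matrix with rows `(z₀, 0), (z₁, z₀), (t z₂, z₁)` span a net of the latter
kind for `t ≠ 0` (`deformation_notMem_doubleLines`). -/

namespace DetNets

/-! ### Polynomial functions and polynomial maps -/

section Poly

variable {K : Type*} [Field K] {A B C H : Type*} [AddCommGroup A] [Module K A] [AddCommGroup B]
  [Module K B] [AddCommGroup C] [Module K C] [AddCommGroup H] [Module K H]

theorem IsPoly.const (c : K) : IsPoly K (fun _ : A => c) :=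
  Subalgebra.algebraMap_mem (Algebra.adjoin K _) c

theorem IsPoly.linear (φ : Module.Dual K A) : IsPoly K (fun a => φ a) :=
  Algebra.subset_adjoin ⟨φ, rfl⟩

theorem IsPoly.add {f g : A → K} (hf : IsPoly K f) (hg : IsPoly K g) :
    IsPoly K (fun a => f a + g a) :=
  Subalgebra.add_mem _ hf hg

theorem IsPoly.mul {f g : A → K} (hf : IsPoly K f) (hg : IsPoly K g) :
    IsPoly K (fun a => f a * g a) :=
  Subalgebra.mul_mem _ hf hg

theorem IsPoly.sub {f g : A → K} (hf : IsPoly K f) (hg : IsPoly K g) :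
    IsPoly K (fun a => f a - g a) :=
  Subalgebra.sub_mem _ hf hg

theorem IsPoly.pow {f : A → K} (hf : IsPoly K f) (n : ℕ) : IsPoly K (fun a => f a ^ n) :=
  Subalgebra.pow_mem _ hf n

theorem IsPoly.sum {ι : Type*} (s : Finset ι) {f : ι → A → K} (hf : ∀ i ∈ s, IsPoly K (f i)) :
    IsPoly K (fun a => ∑ i ∈ s, f i a) := by
  have h := Subalgebra.sum_mem (Algebra.adjoin K _) hf
  have e : (fun a => ∑ i ∈ s, f i a) = ∑ i ∈ s, f i := by ext a; simp
  rw [e]; exact h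

theorem IsPoly.prod {ι : Type*} (s : Finset ι) {f : ι → A → K} (hf : ∀ i ∈ s, IsPoly K (f i)) :
    IsPoly K (fun a => ∏ i ∈ s, f i a) := by
  have h := Subalgebra.prod_mem (Algebra.adjoin K _) hf
  have e : (fun a => ∏ i ∈ s, f i a) = ∏ i ∈ s, f i := by ext a; simp
  rw [e]; exact h

/-- Induction principle for polynomial functions. -/
theorem IsPoly.induction {p : (A → K) → Prop} (hlin : ∀ φ : Module.Dual K A, p fun a => φ a)
    (hconst : ∀ c : K, p fun _ => c)
    (hadd : ∀ f g, IsPoly K f → IsPoly K g → p f → p g → p fun a => f a + g a)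
    (hmul : ∀ f g, IsPoly K f → IsPoly K g → p f → p g → p fun a => f a * g a)
    {f : A → K} (hf : IsPoly K f) : p f := by
  refine Algebra.adjoin_induction (p := fun f _ => p f) ?_ ?_ ?_ ?_ hf
  · rintro _ ⟨φ, rfl⟩; exact hlin φ
  · intro c; exact hconst c
  · intro f g hf hg; exact hadd f g hf hg
  · intro f g hf hg; exact hmul f g hf hg

theorem IsPoly.comp {f : B → K} {g : A → B} (hf : IsPoly K f) (hg : IsPolyMap K g) :
    IsPoly K (fun a => f (g a)) :=
  IsPoly.induction (p := fun f => IsPoly K fun a => f (g a)) hg (fun c => .const c)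
    (fun _ _ _ _ h h' => h.add h') (fun _ _ _ _ h h' => h.mul h') hf

theorem IsPoly.det {n : Type*} [Fintype n] [DecidableEq n] {M : A → Matrix n n K}
    (h : ∀ i j, IsPoly K fun a => M a i j) : IsPoly K fun a => (M a).det := by
  simp only [Matrix.det_apply']
  exact .sum _ fun σ _ => (IsPoly.const _).mul (.prod _ fun i _ => h _ _)

theorem IsPolyMap.of_linear (g : A →ₗ[K] B) : IsPolyMap K g :=
  fun φ => .linear (φ ∘ₗ g)

theorem IsPolyMap.id : IsPolyMap K fun a : A => a := .of_linear LinearMap.id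

theorem IsPolyMap.const (b : B) : IsPolyMap K fun _ : A => b :=
  fun φ => .const (φ b)

theorem IsPolyMap.comp {g : B → C} {f : A → B} (hg : IsPolyMap K g) (hf : IsPolyMap K f) :
    IsPolyMap K fun a => g (f a) :=
  fun φ => (hg φ).comp hf

theorem IsPolyMap.linear_comp {f : A → B} (g : B →ₗ[K] C) (hf : IsPolyMap K f) :
    IsPolyMap K fun a => g (f a) :=
  fun φ => hf (φ ∘ₗ g)

theorem IsPolyMap.add {f g : A → B} (hf : IsPolyMap K f) (hg : IsPolyMap K g) :
    IsPolyMap K fun a => f a + g a := fun φ => by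
  simpa only [map_add] using (hf φ).add (hg φ)

theorem IsPolyMap.sub {f g : A → B} (hf : IsPolyMap K f) (hg : IsPolyMap K g) :
    IsPolyMap K fun a => f a - g a := fun φ => by
  simpa only [map_sub] using (hf φ).sub (hg φ)

theorem IsPolyMap.sum {ι : Type*} (s : Finset ι) {f : ι → A → B}
    (hf : ∀ i ∈ s, IsPolyMap K (f i)) : IsPolyMap K fun a => ∑ i ∈ s, f i a := fun φ => by
  simpa only [map_sum] using IsPoly.sum s fun i hi => hf i hi φ

theorem IsPolyMap.smul {f : A → K} {g : A → B} (hf : IsPoly K f) (hg : IsPolyMap K g) :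
    IsPolyMap K fun a => f a • g a := fun φ => by
  simpa only [map_smul, smul_eq_mul] using hf.mul (hg φ)

theorem IsPolyMap.pi {ι : Type*} [Finite ι] {g : A → ι → B}
    (hg : ∀ i, IsPolyMap K fun a => g a i) : IsPolyMap K g := by
  classical
  have := Fintype.ofFinite ι
  intro φ
  have e : (fun a => φ (g a)) =
      fun a => ∑ i, (φ ∘ₗ LinearMap.single K (fun _ : ι => B) i) (g a i) := by
    ext a
    conv_lhs => rw [← Finset.univ_sum_single (g a), map_sum]
    rfl
  rw [e]
  exact .sum _ fun i _ => hg i _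

theorem IsPoly.isPolyMap {f : A → K} (hf : IsPoly K f) : IsPolyMap K f := fun φ => by
  have e : (fun a => φ (f a)) = fun a => f a * φ 1 := by
    ext a
    rw [← smul_eq_mul, ← map_smul, smul_eq_mul, mul_one]
  rw [e]; exact hf.mul (.const _)

theorem IsPolyMap.prodMk {f : A → B} {g : A → C} (hf : IsPolyMap K f) (hg : IsPolyMap K g) :
    IsPolyMap K fun a => (f a, g a) := fun φ => by
  have e : (fun a => φ (f a, g a)) =
      fun a => (φ ∘ₗ LinearMap.inl K B C) (f a) + (φ ∘ₗ LinearMap.inr K B C) (g a) := by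
    ext a
    simp [← map_add]
  rw [e]; exact (hf _).add (hg _)

theorem IsPolyMap.fst : IsPolyMap K fun a : A × B => a.1 := .of_linear (LinearMap.fst K A B)

theorem IsPolyMap.snd : IsPolyMap K fun a : A × B => a.2 := .of_linear (LinearMap.snd K A B)

theorem IsPolyMap.apply {ι : Type*} {g : A → ι → B} (hg : IsPolyMap K g) (i : ι) :
    IsPolyMap K fun a => g a i :=
  hg.linear_comp (LinearMap.proj (R := K) (φ := fun _ : ι => B) i)

theorem IsPolyMap.isPoly {f : A → K} (hf : IsPolyMap K f) : IsPoly K f := hf LinearMap.id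

theorem bilin_expand [FiniteDimensional K B] [FiniteDimensional K C] (β : B →ₗ[K] C →ₗ[K] H)
    (b : B) (c : C) : β b c = ∑ i, ∑ j,
      ((Module.finBasis K B).coord i b * (Module.finBasis K C).coord j c) •
        β (Module.finBasis K B i) (Module.finBasis K C j) := by
  conv_lhs => rw [← (Module.finBasis K B).sum_repr b, ← (Module.finBasis K C).sum_repr c]
  simp only [map_sum, LinearMap.sum_apply, map_smul, LinearMap.smul_apply,
    Module.Basis.coord_apply, mul_smul, Finset.smul_sum]
  rw [Finset.sum_comm]
  refine Finset.sum_congr rfl fun i _ => Finset.sum_congr rfl fun j _ => ?_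
  rw [smul_comm]

theorem IsPolyMap.bilin [FiniteDimensional K B] [FiniteDimensional K C] (β : B →ₗ[K] C →ₗ[K] H)
    {f : A → B} {g : A → C} (hf : IsPolyMap K f) (hg : IsPolyMap K g) :
    IsPolyMap K fun a => β (f a) (g a) := by
  rw [funext fun a => bilin_expand β (f a) (g a)]
  exact .sum _ fun i _ => .sum _ fun j _ => .smul ((hf _).mul (hg _)) (.const _)

end Poly

/-! ### Frames of Grassmannians and closed conditions on them -/

section Grassmannian

variable {K : Type*} [Field K] {E E₁ A : Type*} [AddCommGroup E] [Module K E]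
  [AddCommGroup E₁] [Module K E₁] [AddCommGroup A] [Module K A] {k k₁ : ℕ}

/-- The action of a `k × k` matrix on `k`-tuples of vectors. -/
def act (g : Matrix (Fin k) (Fin k) K) : (Fin k → E) →ₗ[K] (Fin k → E) :=
  LinearMap.pi fun i => ∑ j, g i j • LinearMap.proj j

@[simp] theorem act_apply (g : Matrix (Fin k) (Fin k) K) (v : Fin k → E) (i : Fin k) :
    act g v i = ∑ j, g i j • v j := by
  simp [act]

theorem act_mul (g h : Matrix (Fin k) (Fin k) K) (v : Fin k → E) :
    act (g * h) v = act g (act h v) := by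
  ext i
  simp only [act_apply, Matrix.mul_apply, Finset.sum_smul, Finset.smul_sum, mul_smul]
  exact Finset.sum_comm

theorem act_one (v : Fin k → E) : act (1 : Matrix (Fin k) (Fin k) K) v = v := by
  ext i
  simp [Matrix.one_apply]

theorem span_act_le (g : Matrix (Fin k) (Fin k) K) (v : Fin k → E) :
    Submodule.span K (Set.range (act g v)) ≤ Submodule.span K (Set.range v) := by
  rw [Submodule.span_le]
  rintro _ ⟨i, rfl⟩
  rw [act_apply]
  exact Submodule.sum_mem _ fun j _ => Submodule.smul_mem _ _ (Submodule.subset_span ⟨j, rfl⟩)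

theorem span_act {g : Matrix (Fin k) (Fin k) K} (hg : IsUnit g.det) (v : Fin k → E) :
    Submodule.span K (Set.range (act g v)) = Submodule.span K (Set.range v) := by
  refine le_antisymm (span_act_le g v) ?_
  have h := span_act_le g⁻¹ (act g v)
  rwa [← act_mul, Matrix.nonsing_inv_mul g hg, act_one] at h

/-- Any two linearly independent tuples with the same span differ by an invertible matrix. -/
theorem exists_act_eq {v w : Fin k → E} (hw : LinearIndependent K w)
    (h : ∀ i, w i ∈ Submodule.span K (Set.range v)) :
    ∃ g : Matrix (Fin k) (Fin k) K, IsUnit g.det ∧ act g v = w := by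
  choose c hc using fun i => (Submodule.mem_span_range_iff_exists_fun K).1 (h i)
  have hcw : act (Matrix.of c) v = w := by
    ext i; rw [act_apply, ← hc i]; rfl
  refine ⟨Matrix.of c, ?_, hcw⟩
  rw [← Matrix.isUnit_iff_isUnit_det, ← Matrix.linearIndependent_rows_iff_isUnit]
  rw [Fintype.linearIndependent_iff] at hw ⊢
  intro d hd
  refine hw d ?_
  rw [← hcw]
  have : ∀ j, ∑ i, d i * c i j = 0 := fun j => by
    have := congrFun hd j
    simpa [Finset.sum_apply] using this
  simp only [act_apply, Matrix.of_apply, Finset.smul_sum, smul_smul]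
  rw [Finset.sum_comm]
  simp only [← Finset.sum_smul, this, zero_smul, Finset.sum_const_zero]

/-- The minor of the tuple `v` given by the linear forms `φ`; it is a Plücker coordinate when `φ`
is a part of a dual basis. -/
def minor (φ : Fin k → Module.Dual K E) (v : Fin k → E) : K :=
  (Matrix.of fun i j => φ j (v i)).det

theorem minor_eq_zero {v : Fin k → E} (hv : ¬ LinearIndependent K v)
    (φ : Fin k → Module.Dual K E) : minor φ v = 0 := by
  by_contra h
  refine hv ?_
  have h1 : LinearIndependent K (Matrix.of fun i j => φ j (v i)).row := by
    rw [Matrix.linearIndependent_rows_iff_isUnit, Matrix.isUnit_iff_isUnit_det]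
    exact isUnit_iff_ne_zero.2 h
  exact LinearIndependent.of_comp (LinearMap.pi φ) h1

theorem exists_minor_ne_zero {v : Fin k → E} (hv : LinearIndependent K v) :
    ∃ φ : Fin k → Module.Dual K E, minor φ v ≠ 0 := by
  have hex : ∀ i, ∃ ψ : Module.Dual K E, ∀ j, ψ (v j) = if j = i then 1 else 0 := fun i => by
    obtain ⟨ψ, hψ⟩ := LinearMap.exists_extend ((Module.Basis.span hv).coord i)
    refine ⟨ψ, fun j => ?_⟩
    have h1 : v j = ((Module.Basis.span hv j : Submodule.span K (Set.range v)) : E) := by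
      rw [Module.Basis.span_apply]
    have h2 := LinearMap.congr_fun hψ (Module.Basis.span hv j)
    rw [LinearMap.comp_apply, Submodule.subtype_apply] at h2
    rw [h1, h2, Module.Basis.coord_apply, Module.Basis.repr_self, Finsupp.single_apply]
  choose φ hφ using hex
  refine ⟨φ, ?_⟩
  have : (Matrix.of fun i j => φ j (v i)) = 1 := by
    ext i j; simp [hφ, Matrix.one_apply]
  rw [minor, this, Matrix.det_one]; exact one_ne_zero

/-- Closedness of containment: `x` lies in the span of the independent tuple `v` if and only if
all the minors of `(x, v)` vanish. -/
theorem mem_span_iff_minor {v : Fin k → E} (hv : LinearIndependent K v) (x : E) :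
    x ∈ Submodule.span K (Set.range v) ↔
      ∀ φ : Fin (k + 1) → Module.Dual K E, minor φ (Fin.cons x v : Fin (k + 1) → E) = 0 := by
  constructor
  · intro h φ
    exact minor_eq_zero (fun h' => (linearIndependent_finCons.1 h').2 h) φ
  · intro h
    by_contra hx
    obtain ⟨φ, hφ⟩ := exists_minor_ne_zero (linearIndependent_finCons.2 ⟨hv, hx⟩)
    exact hφ (h φ)

theorem span_eq_of_mem {v w : Fin k → E} (hv : LinearIndependent K v) (hw : LinearIndependent K w)
    (h : ∀ i, w i ∈ Submodule.span K (Set.range v)) :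
    Submodule.span K (Set.range v) = Submodule.span K (Set.range w) := by
  symm
  have := FiniteDimensional.span_of_finite K (Set.finite_range v)
  refine Submodule.eq_of_le_of_finrank_eq (Submodule.span_le.2 ?_) ?_
  · rintro _ ⟨i, rfl⟩; exact h i
  · rw [finrank_span_eq_card hv, finrank_span_eq_card hw]

theorem IsPolyMap.finCons {x : A → E} {g : A → Fin k → E} (hx : IsPolyMap K x)
    (hg : IsPolyMap K g) : IsPolyMap K fun a => (Fin.cons (x a) (g a) : Fin (k + 1) → E) := by
  refine .pi fun i => ?_
  refine Fin.cases ?_ (fun j => ?_) i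
  · exact hx
  · exact hg.apply j

variable [FiniteDimensional K E] [FiniteDimensional K E₁]

theorem isFrame_iff {v : Fin k → E} {W : Gr K E k} :
    Framed.IsFrame v W ↔ Submodule.span K (Set.range v) = W.1 := Iff.rfl

theorem linearIndependent_of_isFrame {v : Fin k → E} {W : Gr K E k} (h : Framed.IsFrame v W) :
    LinearIndependent K v := by
  rw [linearIndependent_iff_card_eq_finrank_span, Fintype.card_fin, Set.finrank, isFrame_iff.1 h,
    W.2]

/-- The subspace spanned by linearly independent vectors. -/
def spanPoint (v : Fin k → E) (h : LinearIndependent K v) : Gr K E k :=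
  ⟨Submodule.span K (Set.range v), by rw [finrank_span_eq_card h, Fintype.card_fin]⟩

theorem isFrame_spanPoint (v : Fin k → E) (h : LinearIndependent K v) :
    Framed.IsFrame v (spanPoint v h) := isFrame_iff.2 rfl

theorem isFrame_act {g : Matrix (Fin k) (Fin k) K} (hg : IsUnit g.det) {v : Fin k → E}
    {W : Gr K E k} (h : Framed.IsFrame v W) : Framed.IsFrame (act g v) W := by
  rw [isFrame_iff, span_act hg]; exact h

theorem exists_act_eq_of_isFrame {v w : Fin k → E} {W : Gr K E k} (hv : Framed.IsFrame v W)
    (hw : Framed.IsFrame w W) :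
    ∃ g : Matrix (Fin k) (Fin k) K, IsUnit g.det ∧ act g v = w :=
  exists_act_eq (linearIndependent_of_isFrame hw) fun i => by
    rw [isFrame_iff.1 hv, ← isFrame_iff.1 hw]; exact Submodule.subset_span ⟨i, rfl⟩

theorem IsPoly.minor {φ : A → Fin k → Module.Dual K E} {g : A → Fin k → E} (hφ : IsPolyMap K φ)
    (hg : IsPolyMap K g) : IsPoly K fun a => minor (φ a) (g a) := by
  refine .det fun i j => ?_
  have : IsPolyMap K fun a => (LinearMap.id : Module.Dual K E →ₗ[K] Module.Dual K E) (φ a j)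
      (g a i) := IsPolyMap.bilin _ (hφ.apply j) (hg.apply i)
  exact this.isPoly

end Grassmannian

section Closure

variable {K : Type*} [Field K] {E E₁ E₂ : Type*} [AddCommGroup E] [Module K E]
  [FiniteDimensional K E] [AddCommGroup E₁] [Module K E₁] [FiniteDimensional K E₁]
  [AddCommGroup E₂] [Module K E₂] [FiniteDimensional K E₂]
  {k k₁ k₂ : ℕ}

theorem subset_zariskiClosure {M A : Type*} [AddCommGroup A] [Module K A] [Framed M A]
    (S : Set M) : S ⊆ zariskiClosure K S :=
  fun _ hx => Set.mem_sInter.2 fun _ hZ => hZ.2 hx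

theorem isZariskiClosed_zariskiClosure {M A : Type*} [AddCommGroup A] [Module K A] [Framed M A]
    (S : Set M) : IsZariskiClosed K (zariskiClosure K S) := by
  choose I hI using fun Z : {Z : Set M // IsZariskiClosed K Z ∧ S ⊆ Z} => Z.2.1
  refine ⟨⋃ Z, I Z, ?_, fun p a ha => ?_⟩
  · intro f hf
    obtain ⟨Z, hZ⟩ := Set.mem_iUnion.1 hf
    exact (hI Z).1 f hZ
  · constructor
    · intro hp f hf
      obtain ⟨Z, hZ⟩ := Set.mem_iUnion.1 hf
      exact ((hI Z).2 p a ha).1 (hp Z.1 Z.2) f hZ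
    · intro h Z hZ
      exact ((hI ⟨Z, hZ⟩).2 p a ha).2 fun f hf => h f (Set.mem_iUnion.2 ⟨_, hf⟩)

/-- A polynomial function on frames cuts out a closed set even when its vanishing depends on the
choice of the frame: one imposes the vanishing on all frames, and these form one orbit of a
linear group. -/
theorem isZariskiClosed_forall_isFrame {h : (Fin k → E) × (Fin k₁ → E₁) → K} (hh : IsPoly K h) :
    IsZariskiClosed K {p : Gr K E k × Gr K E₁ k₁ | ∀ a, Framed.IsFrame a p → h a = 0} := by
  refine ⟨{f | ∃ (g : Matrix (Fin k) (Fin k) K) (g₁ : Matrix (Fin k₁) (Fin k₁) K), IsUnit g.det ∧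
    IsUnit g₁.det ∧ f = fun a => h (act g a.1, act g₁ a.2)}, ?_, fun p a ha => ⟨?_, ?_⟩⟩
  · rintro _ ⟨g, g₁, -, -, rfl⟩
    exact hh.comp (.prodMk (IsPolyMap.fst.linear_comp _) (IsPolyMap.snd.linear_comp _))
  · rintro hp _ ⟨g, g₁, hg, hg₁, rfl⟩
    exact hp _ ⟨isFrame_act hg ha.1, isFrame_act hg₁ ha.2⟩
  · intro hp b hb
    obtain ⟨g, hg, e⟩ := exists_act_eq_of_isFrame ha.1 hb.1
    obtain ⟨g₁, hg₁, e₁⟩ := exists_act_eq_of_isFrame ha.2 hb.2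
    have := hp _ ⟨g, g₁, hg, hg₁, rfl⟩
    rwa [e, e₁] at this

theorem eq_zero_of_mem_zariskiClosure {Γ : Set (Gr K E k × Gr K E₁ k₁)}
    {h : (Fin k → E) × (Fin k₁ → E₁) → K} (hh : IsPoly K h)
    (hΓ : ∀ p ∈ Γ, ∀ a, Framed.IsFrame a p → h a = 0) {p : Gr K E k × Gr K E₁ k₁}
    (hp : p ∈ zariskiClosure K Γ) {a : (Fin k → E) × (Fin k₁ → E₁)} (ha : Framed.IsFrame a p) :
    h a = 0 :=
  Set.mem_sInter.1 hp _ ⟨isZariskiClosed_forall_isFrame hh, fun q hq => hΓ q hq⟩ a ha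

/-- A containment `x ∈ ⟨g⟩` between polynomial maps passes from a set to its closure. -/
theorem mem_span_of_mem_zariskiClosure {Γ : Set (Gr K E k × Gr K E₁ k₁)}
    {g : (Fin k → E) × (Fin k₁ → E₁) → Fin k₂ → E₂} {x : (Fin k → E) × (Fin k₁ → E₁) → E₂}
    (hg : IsPolyMap K g) (hx : IsPolyMap K x)
    (hΓ : ∀ p ∈ Γ, ∀ a, Framed.IsFrame a p → LinearIndependent K (g a) →
      x a ∈ Submodule.span K (Set.range (g a)))
    {p : Gr K E k × Gr K E₁ k₁} (hp : p ∈ zariskiClosure K Γ)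
    {a : (Fin k → E) × (Fin k₁ → E₁)} (ha : Framed.IsFrame a p) (hga : LinearIndependent K (g a)) :
    x a ∈ Submodule.span K (Set.range (g a)) := by
  refine (mem_span_iff_minor hga _).2 fun φ => ?_
  refine eq_zero_of_mem_zariskiClosure (h := fun a => minor φ (Fin.cons (x a) (g a)))
    (.minor (.const φ) (hx.finCons hg)) (fun q hq b hb => ?_) hp ha
  by_cases hgb : LinearIndependent K (g b)
  · exact (mem_span_iff_minor hgb _).1 (hΓ q hq b hb hgb) φ
  · exact minor_eq_zero (fun h => hgb (linearIndependent_finCons.1 h).1) φ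

/-- Grassmannians are separated: two polynomial maps to a Grassmannian which agree on a set agree
on its closure. -/
theorem span_eq_of_mem_zariskiClosure {Γ : Set (Gr K E k × Gr K E₁ k₁)}
    {g g' : (Fin k → E) × (Fin k₁ → E₁) → Fin k₂ → E₂} (hg : IsPolyMap K g) (hg' : IsPolyMap K g')
    (hΓ : ∀ p ∈ Γ, ∀ a, Framed.IsFrame a p → LinearIndependent K (g a) →
      LinearIndependent K (g' a) →
        Submodule.span K (Set.range (g a)) = Submodule.span K (Set.range (g' a)))
    {p : Gr K E k × Gr K E₁ k₁} (hp : p ∈ zariskiClosure K Γ)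
    {a : (Fin k → E) × (Fin k₁ → E₁)} (ha : Framed.IsFrame a p) (hga : LinearIndependent K (g a))
    (hga' : LinearIndependent K (g' a)) :
    Submodule.span K (Set.range (g a)) = Submodule.span K (Set.range (g' a)) := by
  refine span_eq_of_mem hga hga' fun i => ?_
  obtain ⟨ψ, hψ⟩ := exists_minor_ne_zero hga'
  refine (Submodule.smul_mem_iff _ hψ).1 ?_
  refine mem_span_of_mem_zariskiClosure (x := fun a => minor ψ (g' a) • g' a i) hg
    (.smul (.minor (.const ψ) hg') (hg'.apply i)) (fun q hq b hb hgb => ?_) hp ha hga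
  by_cases hgb' : LinearIndependent K (g' b)
  · rw [hΓ q hq b hb hgb hgb']
    exact Submodule.smul_mem _ _ (Submodule.subset_span ⟨i, rfl⟩)
  · rw [minor_eq_zero hgb', zero_smul]
    exact Submodule.zero_mem _

end Closure

/-! ### Extending a map between graphs to their closures -/

section Extension

variable {K : Type*} [Field K] {E E₁ E₂ : Type*} [AddCommGroup E] [Module K E]
  [FiniteDimensional K E] [AddCommGroup E₁] [Module K E₁] [FiniteDimensional K E₁]
  [AddCommGroup E₂] [Module K E₂] [FiniteDimensional K E₂]
  {k k₁ k₂ : ℕ} {X S : Set (Gr K E k)} {s : S → Gr K E₁ k₁} {s' : S → Gr K E₂ k₂}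

/-- The graph of a map `s` defined on a set `S` of points of a Grassmannian. -/
def graphOn (s : S → Gr K E₁ k₁) : Set (Gr K E k × Gr K E₁ k₁) :=
  Set.range fun x : S => ((x : Gr K E k), s x)

variable (X) in
/-- The part over `X` of the closure of the graph of `s`. -/
def closureOver (s : S → Gr K E₁ k₁) : Set (Gr K E k × Gr K E₁ k₁) :=
  (X ×ˢ Set.univ) ∩ zariskiClosure K (graphOn s)

/-- `g` is a polynomial map on frames which, wherever its value is a frame, takes frames of
`(x, s x)` to frames of `s' x`. -/
def IsLift (s : S → Gr K E₁ k₁) (s' : S → Gr K E₂ k₂)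
    (g : (Fin k → E) × (Fin k₁ → E₁) → Fin k₂ → E₂) : Prop :=
  IsPolyMap K g ∧ ∀ (x : S) (a : (Fin k → E) × (Fin k₁ → E₁)),
    Framed.IsFrame a ((x : Gr K E k), s x) → LinearIndependent K (g a) →
      Submodule.span K (Set.range (g a)) = (s' x).1

variable (X) in
/-- Near every point of the closure of the graph of `s`, the map `(x, s x) ↦ s' x` is given by
polynomials which have a value at that point. -/
def LocallyExtends (s : S → Gr K E₁ k₁) (s' : S → Gr K E₂ k₂) : Prop :=
  ∀ p ∈ closureOver X s, ∀ a, Framed.IsFrame a p → ∃ g, IsLift s s' g ∧ LinearIndependent K (g a)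

/-- `Φ` is the extension of `(x, s x) ↦ s' x` to the closure of the graph of `s`. -/
def IsExtension (s : S → Gr K E₁ k₁) (s' : S → Gr K E₂ k₂)
    (Φ : closureOver X s → Gr K E₂ k₂) : Prop :=
  ∀ (p : closureOver X s) (a : (Fin k → E) × (Fin k₁ → E₁))
    (g : (Fin k → E) × (Fin k₁ → E₁) → Fin k₂ → E₂), Framed.IsFrame a p.1 → IsLift s s' g →
      LinearIndependent K (g a) → Submodule.span K (Set.range (g a)) = (Φ p).1

/-- Two local lifts define the same point, since they agree on the graph. -/
theorem IsLift.span_eq {g g' : (Fin k → E) × (Fin k₁ → E₁) → Fin k₂ → E₂} (hg : IsLift s s' g)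
    (hg' : IsLift s s' g') {p : Gr K E k × Gr K E₁ k₁} (hp : p ∈ zariskiClosure K (graphOn s))
    {a : (Fin k → E) × (Fin k₁ → E₁)} (ha : Framed.IsFrame a p) (h : LinearIndependent K (g a))
    (h' : LinearIndependent K (g' a)) :
    Submodule.span K (Set.range (g a)) = Submodule.span K (Set.range (g' a)) := by
  refine span_eq_of_mem_zariskiClosure hg.1 hg'.1 ?_ hp ha h h'
  rintro _ ⟨x, rfl⟩ b hb hgb hgb'
  rw [hg.2 x b hb hgb, hg'.2 x b hb hgb']

theorem LocallyExtends.exists_isExtension (H : LocallyExtends X s s') :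
    ∃ Φ : closureOver X s → Gr K E₂ k₂, IsExtension s s' Φ := by
  choose b hb using fun p : closureOver X s => Framed.exists_frame p.1
  choose g hg hgb using fun p : closureOver X s => H p.1 p.2 (b p) (hb p)
  refine ⟨fun p => spanPoint (g p (b p)) (hgb p), fun p a g' ha hg' hga => ?_⟩
  -- the two frames `a` and `b p` of `p` are compared by an invertible linear change of frames
  obtain ⟨h, hh, e⟩ := exists_act_eq_of_isFrame ha.1 (hb p).1
  obtain ⟨h₁, hh₁, e₁⟩ := exists_act_eq_of_isFrame ha.2 (hb p).2
  have hl : IsLift s s' fun c => g p (act h c.1, act h₁ c.2) := by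
    refine ⟨(hg p).1.comp (.prodMk (IsPolyMap.fst.linear_comp _) (IsPolyMap.snd.linear_comp _)),
      fun x c hc hi => (hg p).2 x _ ⟨isFrame_act hh hc.1, isFrame_act hh₁ hc.2⟩ hi⟩
  have e₂ : g p (act h a.1, act h₁ a.2) = g p (b p) := by rw [e, e₁]
  have key := hg'.span_eq hl p.2.2 ha hga (by rw [e₂]; exact hgb p)
  rw [e₂] at key
  exact key

variable {Φ : closureOver X s → Gr K E₂ k₂} {Φ' : closureOver X s' → Gr K E₁ k₁}

theorem IsExtension.isMorphism (hΦ : IsExtension s s' Φ) (H : LocallyExtends X s s') :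
    IsMorphism K Φ := by
  intro p a ha
  obtain ⟨g, hg, hga⟩ := H p.1 p.2 a ha
  refine ⟨g, hg.1, hΦ p a g ha hg hga, fun p' b hb q hq => ?_⟩
  have hgb := linearIndependent_of_isFrame hq
  exact Subtype.ext ((isFrame_iff.1 hq).symm.trans (hΦ p' b g hb hg hgb))

theorem IsExtension.mem_closureOver (hΦ : IsExtension s s' Φ) (H : LocallyExtends X s s')
    (p : closureOver X s) : (p.1.1, Φ p) ∈ closureOver X s' := by
  refine ⟨⟨p.2.1.1, trivial⟩, Set.mem_sInter.2 fun Z hZ => ?_⟩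
  obtain ⟨⟨I, hI, hIZ⟩, hsub⟩ := hZ
  obtain ⟨a, ha⟩ := Framed.exists_frame p.1
  obtain ⟨g, hg, hga⟩ := H p.1 p.2 a ha
  refine (hIZ _ (a.1, g a) ⟨ha.1, hΦ p a g ha hg hga⟩).2 fun f hf => ?_
  obtain ⟨ψ, hψ⟩ := exists_minor_ne_zero hga
  -- the factor `minor ψ (g a)` makes the equation hold where `g` is not a frame
  have key : f (a.1, g a) * minor ψ (g a) = 0 := by
    refine eq_zero_of_mem_zariskiClosure (Γ := graphOn s)
      (h := fun a => f (a.1, g a) * minor ψ (g a))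
      (((hI f hf).comp (.prodMk .fst hg.1)).mul (.minor (.const ψ) hg.1)) ?_ p.2.2 ha
    rintro _ ⟨x, rfl⟩ b hb
    by_cases hgb : LinearIndependent K (g b)
    · rw [(hIZ (x.1, s' x) (b.1, g b) ⟨hb.1, hg.2 x b hb hgb⟩).1 (hsub ⟨x, rfl⟩) f hf,
        zero_mul]
    · rw [minor_eq_zero hgb, mul_zero]
  exact (mul_eq_zero.1 key).resolve_right hψ

theorem IsExtension.apply_of_mem (hΦ : IsExtension s s' Φ) (hs' : IsMorphism K s')
    (p : closureOver X s) (x : S) (hx : p.1.1 = x) : Φ p = s' x := by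
  obtain ⟨a, ha⟩ := Framed.exists_frame p.1
  obtain ⟨g, hg, hga, hloc⟩ := hs' x a.1 (hx ▸ ha.1)
  refine Subtype.ext ?_
  have hl : IsLift s s' fun b => g b.1 := by
    refine ⟨hg.comp .fst, fun y b hb hgb => ?_⟩
    exact congrArg Subtype.val (hloc y b.1 hb.1 (spanPoint _ hgb) (isFrame_spanPoint _ hgb))
  exact (hΦ p a _ ha hl (linearIndependent_of_isFrame hga)).symm.trans (isFrame_iff.1 hga)

/-- Over `S` a morphism extends, so only the points outside `S` have to be considered. -/
theorem LocallyExtends.of_isMorphism (hs' : IsMorphism K s')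
    (H : ∀ p ∈ closureOver X s, p.1 ∉ S → ∀ a, Framed.IsFrame a p →
      ∃ g, IsLift s s' g ∧ LinearIndependent K (g a)) : LocallyExtends X s s' := by
  intro p hp a ha
  by_cases hx : p.1 ∈ S
  · obtain ⟨g, hg, hga, hloc⟩ := hs' ⟨p.1, hx⟩ a.1 ha.1
    refine ⟨fun b => g b.1, ⟨hg.comp .fst, fun y b hb hgb => ?_⟩, linearIndependent_of_isFrame hga⟩
    exact congrArg Subtype.val (hloc y b.1 hb.1 (spanPoint _ hgb) (isFrame_spanPoint _ hgb))
  · exact H p hp hx a ha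

/-- The extensions of `(x, s x) ↦ s' x` and of `(x, s' x) ↦ s x` are inverse to each other. -/
theorem IsExtension.apply_apply (hΦ : IsExtension s s' Φ) (hΦ' : IsExtension s' s Φ')
    (H : LocallyExtends X s s') (H' : LocallyExtends X s' s) (p : closureOver X s) :
    Φ' ⟨(p.1.1, Φ p), hΦ.mem_closureOver H p⟩ = p.1.2 := by
  rcases Nat.eq_zero_or_pos k₁ with hk | hk
  · subst hk
    exact Subtype.ext ((Submodule.finrank_eq_zero.1 (Φ' _).2).trans
      (Submodule.finrank_eq_zero.1 p.1.2.2).symm)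
  obtain ⟨a, ha⟩ := Framed.exists_frame p.1
  obtain ⟨g, hg, hga⟩ := H p.1 p.2 a ha
  have ha' : Framed.IsFrame (a.1, g a) (p.1.1, Φ p) := ⟨ha.1, hΦ p a g ha hg hga⟩
  obtain ⟨g', hg', hga'⟩ := H' _ (hΦ.mem_closureOver H p) _ ha'
  obtain ⟨ψ, hψ⟩ := exists_minor_ne_zero hga
  refine Subtype.ext ?_
  rw [← hΦ' ⟨_, hΦ.mem_closureOver H p⟩ _ g' ha' hg' hga', ← isFrame_iff.1 ha.2]
  have hsm : ∀ c : K, c ≠ 0 → ∀ w : Fin k₁ → E₁, LinearIndependent K w →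
      LinearIndependent K (c • w) := fun c hc w hw => hw.units_smul fun _ => Units.mk0 c hc
  have key := span_eq_of_mem_zariskiClosure (Γ := graphOn s) (k₂ := k₁)
    (g := fun b => minor ψ (g b) • g' (b.1, g b)) (g' := fun b => b.2)
    (.smul (.minor (.const ψ) hg.1) (hg'.1.comp (.prodMk .fst hg.1))) .snd ?_ p.2.2 ha
    (hsm _ hψ _ hga') (linearIndependent_of_isFrame ha.2)
  · rw [← key]
    refine span_eq_of_mem hga' (hsm _ hψ _ hga') fun i => ?_
    exact Submodule.smul_mem _ _ (Submodule.subset_span ⟨i, rfl⟩)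
  · rintro _ ⟨x, rfl⟩ b hb hi -
    have hm : minor ψ (g b) ≠ 0 := by
      intro h0
      have := hi.ne_zero ⟨0, hk⟩
      simp [h0] at this
    have hgb : LinearIndependent K (g b) := by
      by_contra hgb
      exact hm (minor_eq_zero hgb ψ)
    have hgb' : LinearIndependent K (g' (b.1, g b)) := by
      have := hsm _ (inv_ne_zero hm) _ hi
      rwa [inv_smul_smul₀ hm] at this
    have e1 := hg'.2 x (b.1, g b) ⟨hb.1, hg.2 x b hb hgb⟩ hgb'
    rw [isFrame_iff.1 hb.2, ← e1]
    refine (span_eq_of_mem hgb' hi fun i => ?_).symm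
    exact Submodule.smul_mem _ _ (Submodule.subset_span ⟨i, rfl⟩)

/-- If `s` and `s'` determine each other locally, the closure of the graph of `s` is embedded by
the extension of `s'`. -/
theorem IsExtension.isClosedEmbedding (hΦ : IsExtension s s' Φ) (H : LocallyExtends X s s')
    (H' : LocallyExtends X s' s) :
    IsClosedEmbedding K (fun p : closureOver X s => (p.1.1, Φ p)) (X ×ˢ Set.univ) := by
  obtain ⟨Φ', hΦ'⟩ := H'.exists_isExtension
  have hrange : Set.range (fun p : closureOver X s => (p.1.1, Φ p)) = closureOver X s' := by
    refine Set.Subset.antisymm ?_ fun q hq => ?_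
    · rintro _ ⟨p, rfl⟩
      exact hΦ.mem_closureOver H p
    · refine ⟨⟨(q.1, Φ' ⟨q, hq⟩), hΦ'.mem_closureOver H' ⟨q, hq⟩⟩, ?_⟩
      exact Prod.ext rfl (hΦ'.apply_apply hΦ H' H ⟨q, hq⟩)
  have hmem : ∀ q : Set.range (fun p : closureOver X s => (p.1.1, Φ p)),
      q.1 ∈ closureOver X s' := fun q => hrange ▸ q.2
  refine ⟨?_, ⟨zariskiClosure K (graphOn s'), isZariskiClosed_zariskiClosure _, hrange⟩,
    fun q => (q.1.1, Φ' ⟨q.1, hmem q⟩), ?_, fun p => Prod.ext rfl (hΦ.apply_apply hΦ' H H' p)⟩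
  · intro p a ha
    obtain ⟨g, hg, hga, hloc⟩ := hΦ.isMorphism H p a ha
    refine ⟨fun b => (b.1, g b), .prodMk .fst hg, ⟨ha.1, hga⟩, fun p' b hb q hq => ?_⟩
    exact Prod.ext (Framed.eq_of_isFrame b.1 _ _ hq.1 hb.1) (hloc p' b hb q.2 hq.2)
  · intro q a ha
    obtain ⟨g, hg, hga, hloc⟩ := hΦ'.isMorphism H' ⟨q.1, hmem q⟩ a ha
    refine ⟨fun b => (b.1, g b), .prodMk .fst hg, ⟨ha.1, hga⟩, fun p' b hb r hr => ?_⟩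
    exact Prod.ext (Framed.eq_of_isFrame b.1 _ _ hr.1 hb.1)
      (hloc ⟨p'.1, hmem p'⟩ b hb r.2 hr.2)

end Extension

/-! ### Products of forms and the square of a net -/

section Products

variable {K : Type*} [Field K]

/-- The multiplication `ℱ_d × ℱ_e → ℱ_n` of forms, `n = d + e`. -/
noncomputable def formMul {d e n : ℕ} (h : d + e = n) : Form K d →ₗ[K] Form K e →ₗ[K] Form K n :=
  LinearMap.mk₂ K (fun a b => ⟨a.1 * b.1, h ▸ MvPolynomial.IsHomogeneous.mul a.2 b.2⟩)
    (fun a a' b => Subtype.ext (add_mul a.1 a'.1 b.1))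
    (fun c a b => Subtype.ext (smul_mul_assoc c a.1 b.1))
    (fun a b b' => Subtype.ext (mul_add a.1 b.1 b'.1))
    (fun c a b => Subtype.ext (mul_smul_comm c a.1 b.1))

@[simp] theorem coe_formMul {d e n : ℕ} (h : d + e = n) (a : Form K d) (b : Form K e) :
    (formMul h a b : MvPolynomial (Fin 4) K) = a * b := rfl

/-- The product of two quadratic forms. -/
noncomputable abbrev qmul : Form K 2 →ₗ[K] Form K 2 →ₗ[K] Form K 4 := formMul rfl

/-- The product of two linear forms. -/
noncomputable abbrev lmul : Form K 1 →ₗ[K] Form K 1 →ₗ[K] Form K 2 := formMul rfl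

theorem qmul_comm (a b : Form K 2) : qmul a b = qmul b a := Subtype.ext (mul_comm a.1 b.1)

/-- The six products of three quadrics.  The square of the second quadric comes last, because near
a net of the form `L²` it is the one to be replaced by `v₀v₂ - v₁²`. -/
noncomputable def products (v : Fin 3 → Form K 2) : Fin 6 → Form K 4 :=
  ![qmul (v 0) (v 0), qmul (v 0) (v 1), qmul (v 0) (v 2), qmul (v 1) (v 2), qmul (v 2) (v 2),
    qmul (v 1) (v 1)]

theorem qmul_mem_span_products (v : Fin 3 → Form K 2) (i j : Fin 3) :
    qmul (v i) (v j) ∈ Submodule.span K (Set.range (products v)) := by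
  have h : ∀ n, products v n ∈ Submodule.span K (Set.range (products v)) :=
    fun n => Submodule.subset_span ⟨n, rfl⟩
  fin_cases i <;> fin_cases j
  · exact h 0
  · exact h 1
  · exact h 2
  · exact qmul_comm (v 0) (v 1) ▸ h 1
  · exact h 5
  · exact h 3
  · exact qmul_comm (v 0) (v 2) ▸ h 2
  · exact qmul_comm (v 1) (v 2) ▸ h 3
  · exact h 4

theorem qmul_mem_span_products_of_mem (v : Fin 3 → Form K 2) {a b : Form K 2}
    (ha : a ∈ Submodule.span K (Set.range v)) (hb : b ∈ Submodule.span K (Set.range v)) :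
    qmul a b ∈ Submodule.span K (Set.range (products v)) := by
  obtain ⟨c, rfl⟩ := (Submodule.mem_span_range_iff_exists_fun K).1 ha
  obtain ⟨c', rfl⟩ := (Submodule.mem_span_range_iff_exists_fun K).1 hb
  simp only [map_sum, LinearMap.sum_apply, map_smul, LinearMap.smul_apply]
  exact Submodule.sum_mem _ fun i _ => Submodule.smul_mem _ _ <| Submodule.sum_mem _ fun j _ =>
    Submodule.smul_mem _ _ (qmul_mem_span_products v _ _)

theorem qmul_mem_square {V : Submodule K (Form K 2)} {a b : Form K 2} (ha : a ∈ V) (hb : b ∈ V) :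
    qmul a b ∈ square V :=
  Submodule.subset_span ⟨a, ha, b, hb, rfl⟩

theorem products_mem_square {V : Submodule K (Form K 2)} {v : Fin 3 → Form K 2}
    (hv : ∀ i, v i ∈ V) (n : Fin 6) : products v n ∈ square V := by
  fin_cases n <;> exact qmul_mem_square (hv _) (hv _)

theorem square_eq_span_products {V : Submodule K (Form K 2)} {v : Fin 3 → Form K 2}
    (hv : Submodule.span K (Set.range v) = V) :
    square V = Submodule.span K (Set.range (products v)) := by
  refine le_antisymm (Submodule.span_le.2 ?_) (Submodule.span_le.2 ?_)
  · rintro f ⟨q, hq, q', hq', hf⟩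
    have : f = qmul q q' := Subtype.ext hf
    rw [this]
    rw [← hv] at hq hq'
    exact qmul_mem_span_products_of_mem v hq hq'
  · rintro _ ⟨n, rfl⟩
    exact products_mem_square (fun i => hv ▸ Submodule.subset_span ⟨i, rfl⟩) n

theorem isPolyMap_products : IsPolyMap K (products : (Fin 3 → Form K 2) → Fin 6 → Form K 4) := by
  have h : ∀ i j : Fin 3, IsPolyMap K fun v : Fin 3 → Form K 2 => qmul (v i) (v j) :=
    fun i j => .bilin _ (IsPolyMap.id.apply i) (IsPolyMap.id.apply j)
  refine .pi fun n => ?_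
  fin_cases n <;> exact h _ _

theorem minor_act {E : Type*} [AddCommGroup E] [Module K E] {k : ℕ}
    (φ : Fin k → Module.Dual K E) (g : Matrix (Fin k) (Fin k) K) (v : Fin k → E) :
    minor φ (act g v) = g.det * minor φ v := by
  rw [minor, minor, ← Matrix.det_mul]
  congr 1
  ext i j
  simp [Matrix.mul_apply]

theorem act_transvection {E : Type*} [AddCommGroup E] [Module K E] {k : ℕ} {i j : Fin k}
    (hij : i ≠ j) (c : K) (v : Fin k → E) :
    act (Matrix.transvection i j c) v = Function.update v i (v i + c • v j) := by
  ext n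
  rw [act_apply]
  rcases eq_or_ne n i with rfl | hn
  · simp [Matrix.transvection, Matrix.one_apply, add_smul, Finset.sum_add_distrib,
      Matrix.single_apply]
  · simp [Matrix.transvection, Matrix.one_apply, hn, Ne.symm hn]

theorem minor_update {E : Type*} [AddCommGroup E] [Module K E] {k : ℕ}
    (φ : Fin k → Module.Dual K E) {i j : Fin k} (hij : i ≠ j) (c : K) (v : Fin k → E) :
    minor φ (Function.update v i (v i + c • v j)) = minor φ v := by
  rw [← act_transvection hij, minor_act, Matrix.det_transvection_of_ne _ _ hij, one_mul]

set_option maxHeartbeats 1000000 in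
/-- Adding a multiple of one quadric to another changes the products by elementary row
operations. -/
theorem minor_products_update (φ : Fin 6 → Module.Dual K (Form K 4)) {i j : Fin 3} (hij : i ≠ j)
    (c : K) (v : Fin 3 → Form K 2) :
    minor φ (products (Function.update v i (v i + c • v j))) = minor φ (products v) := by
  -- with `p = ii`, `q = ij`, `r = jj`, `s = ik`, `t = jk` among the six products
  have key : ∃ p q r s t : Fin 6, p ≠ q ∧ p ≠ r ∧ q ≠ r ∧ s ≠ t ∧
      (∀ w : Fin 3 → Form K 2, w = Function.update v i (v i + c • v j) → products w =
        let a := products v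
        let a₁ := Function.update a p (a p + (2 * c) • a q)
        let a₂ := Function.update a₁ p (a₁ p + (c * c) • a₁ r)
        let a₃ := Function.update a₂ q (a₂ q + c • a₂ r)
        Function.update a₃ s (a₃ s + c • a₃ t)) := by
    have e₁ := qmul_comm (v 1) (v 0)
    have e₂ := qmul_comm (v 2) (v 0)
    have e₃ := qmul_comm (v 2) (v 1)
    -- the position of the product of the quadrics number `a` and `b`
    let n : Fin 3 → Fin 3 → Fin 6 := ![![0, 1, 2], ![1, 5, 3], ![2, 3, 4]]
    obtain ⟨k, hk⟩ : ∃ k : Fin 3, k ≠ i ∧ k ≠ j := by decide +revert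
    refine ⟨n i i, n i j, n j j, n i k, n j k, ?_, ?_, ?_, ?_, ?_⟩
    · clear e₁ e₂ e₃; revert i j k; decide
    · clear e₁ e₂ e₃; revert i j k; decide
    · clear e₁ e₂ e₃; revert i j k; decide
    · clear e₁ e₂ e₃; revert i j k; decide
    · rintro w rfl
      ext1 m
      fin_cases i <;> fin_cases j <;> fin_cases k <;>
        first
        | exact absurd rfl hij
        | exact absurd rfl hk.1
        | exact absurd rfl hk.2
        | (fin_cases m <;> simp [products, Function.update, n, e₁, e₂, e₃]; all_goals module)
  obtain ⟨p, q, r, s, t, hpq, hpr, hqr, hst, h⟩ := key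
  rw [h _ rfl]
  dsimp only
  rw [minor_update _ hst, minor_update _ hqr, minor_update _ hpr, minor_update _ hpq]

/-- The `6 × 6` minors of the products of three quadrics are sections of `𝒪(4)`, as
`det (S₂ g) = det g ^ 4` for `g ∈ GL₃`. -/
theorem minor_products_act (φ : Fin 6 → Module.Dual K (Form K 4)) (g : Matrix (Fin 3) (Fin 3) K)
    (v : Fin 3 → Form K 2) :
    minor φ (products (act g v)) = g.det ^ 4 * minor φ (products v) := by
  revert v
  refine Matrix.diagonal_transvection_induction
    (fun g => ∀ v, minor φ (products (act g v)) = g.det ^ 4 * minor φ (products v)) g ?_ ?_ ?_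
  · intro d _ v
    have h : products (act (Matrix.diagonal d) v) = act (Matrix.diagonal
        ![d 0 * d 0, d 0 * d 1, d 0 * d 2, d 1 * d 2, d 2 * d 2, d 1 * d 1]) (products v) := by
      ext1 n
      fin_cases n <;>
        simp [products, Matrix.diagonal_apply, mul_smul] <;> exact smul_comm _ _ _
    have hd : (Matrix.diagonal ![d 0 * d 0, d 0 * d 1, d 0 * d 2, d 1 * d 2, d 2 * d 2,
        d 1 * d 1]).det = (Matrix.diagonal d).det ^ 4 := by
      rw [Matrix.det_diagonal, Matrix.det_diagonal, Fin.prod_univ_six, Fin.prod_univ_three]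
      change d 0 * d 0 * (d 0 * d 1) * (d 0 * d 2) * (d 1 * d 2) * (d 2 * d 2) * (d 1 * d 1) = _
      ring
    rw [h, minor_act, hd]
  · intro t v
    rw [t.det]
    obtain ⟨i, j, hij, c⟩ := t
    simp only [Matrix.TransvectionStruct.toMatrix_mk]
    rw [act_transvection hij, minor_products_update φ hij, one_pow, one_mul]
  · intro A B hA hB v
    rw [act_mul, hA, hB, Matrix.det_mul]
    ring

end Products

/-! ### The dimension of the square of a net -/

section Dimension

open MvPolynomial

variable {K : Type*} [Field K]

/-- The frame `(p², pq, q²)` of the double line with equations `p = q = 0`. -/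
noncomputable def doubleFrame (p q : Form K 1) : Fin 3 → Form K 2 :=
  ![lmul p p, lmul p q, lmul q q]

theorem square_eq_span_doubleFrame {L : Submodule K (Form K 1)} {p q : Form K 1}
    (hL : L = Submodule.span K {p, q}) :
    (square L : Submodule K (Form K 2)) = Submodule.span K (Set.range (doubleFrame p q)) := by
  have h : ∀ n, doubleFrame p q n ∈ Submodule.span K (Set.range (doubleFrame p q)) :=
    fun n => Submodule.subset_span ⟨n, rfl⟩
  have hp : p ∈ L := hL ▸ Submodule.subset_span (by simp)
  have hq : q ∈ L := hL ▸ Submodule.subset_span (by simp)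
  refine le_antisymm (Submodule.span_le.2 ?_) (Submodule.span_le.2 ?_)
  · rintro f ⟨a, ha, b, hb, hf⟩
    rw [hL, Submodule.mem_span_pair] at ha hb
    obtain ⟨a₁, a₂, rfl⟩ := ha
    obtain ⟨b₁, b₂, rfl⟩ := hb
    have hfe : f = (a₁ * b₁) • lmul p p + (a₁ * b₂ + a₂ * b₁) • lmul p q +
        (a₂ * b₂) • lmul q q := by
      refine Subtype.ext (hf.trans ?_)
      simp only [Submodule.coe_add, Submodule.coe_smul, coe_formMul, MvPolynomial.smul_eq_C_mul,
        map_add, map_mul]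
      ring
    rw [SetLike.mem_coe, hfe]
    exact add_mem (add_mem (Submodule.smul_mem _ _ (h 0)) (Submodule.smul_mem _ _ (h 1)))
      (Submodule.smul_mem _ _ (h 2))
  · rintro _ ⟨n, rfl⟩
    fin_cases n
    · exact Submodule.subset_span ⟨p, hp, p, hp, rfl⟩
    · exact Submodule.subset_span ⟨p, hp, q, hq, rfl⟩
    · exact Submodule.subset_span ⟨q, hq, q, hq, rfl⟩

theorem exists_span_pair (L : Gr K (Form K 1) 2) :
    ∃ p q : Form K 1, L.1 = Submodule.span K {p, q} := by
  obtain ⟨a, ha⟩ := Framed.exists_frame L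
  refine ⟨a 0, a 1, (isFrame_iff.1 ha).symm.trans ?_⟩
  congr 1
  ext x
  simp [Fin.exists_fin_two, eq_comm]

theorem not_linearIndependent_products_of_mem_doubleLines {W : Gr K (Form K 2) 3}
    (hW : W ∈ doubleLines K) {v : Fin 3 → Form K 2} (hv : Framed.IsFrame v W) :
    ¬ LinearIndependent K (products v) := by
  obtain ⟨L, hL⟩ := hW
  obtain ⟨p, q, hpq⟩ := exists_span_pair L
  intro h
  have ht := square_eq_span_products (hL.trans (square_eq_span_doubleFrame hpq)).symm
  rw [square_eq_span_products (isFrame_iff.1 hv)] at ht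
  have h1 : LinearIndependent K (products (doubleFrame p q)) := by
    rw [linearIndependent_iff_card_eq_finrank_span] at h ⊢
    rw [h, Set.finrank, Set.finrank, ht]
  have h2 : products (doubleFrame p q) 2 = products (doubleFrame p q) 5 := by
    refine Subtype.ext ?_
    change (p.1 * p.1) * (q.1 * q.1) = (p.1 * q.1) * (p.1 * q.1)
    ring
  exact absurd (h1.injective h2) (by decide)

/-- A square root, up to a constant, of a quadric is a linear form. -/
theorem isHomogeneous_of_mul_sq {x : Form K 2} {d : MvPolynomial (Fin 4) K} {γ : K}
    (hγ : γ ≠ 0) (hx : (x : MvPolynomial (Fin 4) K) = C γ * d ^ 2) (hd : d.totalDegree = 1) :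
    d.IsHomogeneous 1 := by
  have h0 : coeff 0 d = 0 := by
    have h1 : coeff 0 (x : MvPolynomial (Fin 4) K) = 0 := by
      refine IsHomogeneous.coeff_eq_zero (n := 2) x.2 ?_
      simp
    rw [hx, coeff_C_mul, ← constantCoeff_eq, map_pow] at h1
    simpa [hγ, constantCoeff_eq] using h1
  intro m hm
  have h2 := le_totalDegree (mem_support_iff.2 hm)
  rw [hd] at h2
  have h3 : m ≠ 0 := fun h => hm (h ▸ h0)
  have h4 : m.degree ≠ 0 := fun h => h3 ((Finsupp.degree_eq_zero_iff m).1 h)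
  have h5 : m.degree ≤ 1 := h2
  have e := DFunLike.congr_fun (Finsupp.degree_eq_weight_one (R := ℕ) (σ := Fin 4)) m
  change Finsupp.weight (fun _ => 1) m = 1
  exact e.symm.trans (by omega)

variable [IsAlgClosed K]

/-- Quadrics with `xy = z²`, where `x` and `y` are not proportional, are `p², q², pq` up to
constants. -/
theorem exists_doubleFrame_of_mul_eq_sq {x y z : Form K 2} (hxy : ∀ c : K, y ≠ c • x)
    (hx0 : x ≠ 0) (h : qmul x y = qmul z z) :
    ∃ p q : Form K 1, ∃ c₁ c₂ c₃ : K, x = c₁ • lmul p p ∧ y = c₂ • lmul q q ∧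
      z = c₃ • lmul p q := by
  let := UniqueFactorizationMonoid.toGCDMonoid (MvPolynomial (Fin 4) K)
  have h' : (x : MvPolynomial (Fin 4) K) * y = z * z := congrArg Subtype.val h
  have hX0 : (x : MvPolynomial (Fin 4) K) ≠ 0 := fun e => hx0 (Subtype.ext e)
  have hy0 : y ≠ 0 := by simpa using hxy 0
  have hY0 : (y : MvPolynomial (Fin 4) K) ≠ 0 := fun e => hy0 (Subtype.ext e)
  obtain ⟨x₀, y₀, hx, hy, hu⟩ := extract_gcd (x : MvPolynomial (Fin 4) K) y
  set g := gcd (x : MvPolynomial (Fin 4) K) y with hg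
  have hg0 : g ≠ 0 := fun e => hX0 (by rw [hx, e, zero_mul])
  have hgz : g ∣ z := by
    rw [← UniqueFactorizationMonoid.pow_dvd_pow_iff_dvd two_ne_zero, pow_two, pow_two, ← h']
    exact mul_dvd_mul ⟨_, hx⟩ ⟨_, hy⟩
  obtain ⟨z₀, hz⟩ := hgz
  have h0 : x₀ * y₀ = z₀ ^ 2 := by
    have : (g * g) * (x₀ * y₀) = (g * g) * z₀ ^ 2 := by
      calc (g * g) * (x₀ * y₀) = (g * x₀) * (g * y₀) := by ring
        _ = (g * g) * z₀ ^ 2 := by rw [← hx, ← hy, h', hz]; ring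
    exact mul_left_cancel₀ (mul_ne_zero hg0 hg0) this
  -- over an algebraically closed field the units are squares
  have hsq : ∀ {a b c : MvPolynomial (Fin 4) K}, IsUnit (gcd a b) → a * b = c ^ 2 →
      ∃ d, a = d ^ 2 := by
    intro a b c hab habc
    obtain ⟨d, u, hd⟩ := exists_associated_pow_of_mul_eq_pow hab habc
    obtain ⟨r, hr, hru⟩ := (isUnit_iff_eq_C_of_isReduced).1 u.isUnit
    obtain ⟨t, ht⟩ := IsAlgClosed.exists_pow_nat_eq r zero_lt_two
    exact ⟨d * C t, by rw [← hd, hru, mul_pow, ← map_pow, ht]⟩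
  obtain ⟨d, rfl⟩ := hsq hu h0
  obtain ⟨e, rfl⟩ := hsq ((gcd_comm' _ _).isUnit hu) (by rw [mul_comm]; exact h0)
  have hz' : ∃ c : K, z₀ = C c * (d * e) := by
    rw [← mul_pow] at h0
    rcases sq_eq_sq_iff_eq_or_eq_neg.1 h0.symm with h | h
    · exact ⟨1, by rw [h]; simp⟩
    · exact ⟨-1, by rw [h]; simp⟩
  obtain ⟨c, rfl⟩ := hz'
  have hd0 : d ≠ 0 := fun e => hX0 (by rw [hx, e]; simp)
  have he0 : e ≠ 0 := fun e => hY0 (by rw [hy, e]; simp)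
  have hdx : g.totalDegree + (d.totalDegree + d.totalDegree) = 2 := by
    rw [← totalDegree_mul_of_isDomain hd0 hd0, ← totalDegree_mul_of_isDomain hg0
      (mul_ne_zero hd0 hd0), ← pow_two, ← hx]
    exact IsHomogeneous.totalDegree x.2 hX0
  have hdy : g.totalDegree + (e.totalDegree + e.totalDegree) = 2 := by
    rw [← totalDegree_mul_of_isDomain he0 he0, ← totalDegree_mul_of_isDomain hg0
      (mul_ne_zero he0 he0), ← pow_two, ← hy]
    exact IsHomogeneous.totalDegree y.2 hY0
  have hd1 : d.totalDegree = 1 := by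
    by_contra hne
    obtain ⟨a, rfl⟩ := (totalDegree_eq_zero_iff_eq_C.1 (by omega : d.totalDegree = 0) ▸ ⟨_, rfl⟩ :
      ∃ a, d = C a)
    obtain ⟨b, rfl⟩ := (totalDegree_eq_zero_iff_eq_C.1 (by omega : e.totalDegree = 0) ▸ ⟨_, rfl⟩ :
      ∃ a, e = C a)
    have ha : a ≠ 0 := fun h => hd0 (by rw [h, C_0])
    refine hxy (b ^ 2 / a ^ 2) (Subtype.ext ?_)
    rw [Submodule.coe_smul, hx, hy, smul_eq_C_mul, ← map_pow, ← map_pow, mul_left_comm, ← map_mul,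
      div_mul_cancel₀ _ (pow_ne_zero 2 ha)]
  have he1 : e.totalDegree = 1 := by omega
  have hgC := totalDegree_eq_zero_iff_eq_C.1 (by omega : g.totalDegree = 0)
  set γ := coeff 0 g
  have hγ : γ ≠ 0 := fun h => hg0 (by rw [hgC, h, C_0])
  rw [hgC] at hx hy hz
  refine ⟨⟨d, isHomogeneous_of_mul_sq hγ hx hd1⟩, ⟨e, isHomogeneous_of_mul_sq hγ hy he1⟩,
    γ, γ, γ * c, Subtype.ext ?_, Subtype.ext ?_, Subtype.ext ?_⟩
  · rw [hx, Submodule.coe_smul, coe_formMul, smul_eq_C_mul, pow_two]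
  · rw [hy, Submodule.coe_smul, coe_formMul, smul_eq_C_mul, pow_two]
  · rw [hz, Submodule.coe_smul, coe_formMul, smul_eq_C_mul, map_mul, mul_assoc]

end Dimension

section Conic

open MvPolynomial

variable {K : Type*} [Field K]

theorem pair_of_ne {E : Type*} [AddCommGroup E] [Module K E] {k : ℕ} {v : Fin k → E}
    (hv : LinearIndependent K v) {i j : Fin k} (hij : i ≠ j) (s t : K)
    (h : s • v i + t • v j = 0) : s = 0 ∧ t = 0 := by
  have hp : LinearIndependent K ![v i, v j] := by
    have h1 := hv.comp ![i, j] (by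
      intro a b; fin_cases a <;> fin_cases b <;> simp [hij, hij.symm])
    convert h1 using 1
    ext a; fin_cases a <;> rfl
  exact LinearIndependent.pair_iff.1 hp s t h

variable [CharZero K]

/-- Symmetric matrices over a field of characteristic zero are diagonal up to congruence. -/
theorem exists_mul_mul_transpose_eq_diagonal (S : Matrix (Fin 3) (Fin 3) K) (hS : S.IsSymm) :
    ∃ (Q : Matrix (Fin 3) (Fin 3) K) (w : Fin 3 → K), IsUnit Q.det ∧
      Q * S * Q.transpose = Matrix.diagonal w := by
  have : Invertible (2 : K) := invertibleOfNonzero two_ne_zero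
  have hBs : (Matrix.toBilin' S).IsSymm := Matrix.isSymm_toBilin'_iff_isSymm.2 hS
  obtain ⟨e', he'⟩ := LinearMap.BilinForm.exists_orthogonal_basis
    (LinearMap.BilinForm.isSymm_iff.1 hBs)
  have hfr : Module.finrank K (Fin 3 → K) = 3 := by simp
  have hli : LinearIndependent K fun k => e' ((finCongr hfr).symm k) :=
    e'.linearIndependent.comp _ (finCongr hfr).symm.injective
  refine ⟨Matrix.of fun k => e' ((finCongr hfr).symm k), fun k =>
    Matrix.toBilin' S (e' ((finCongr hfr).symm k)) (e' ((finCongr hfr).symm k)), ?_, ?_⟩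
  · rw [← Matrix.isUnit_iff_isUnit_det, ← Matrix.linearIndependent_rows_iff_isUnit]
    exact hli
  · have hval : ∀ k l, ((Matrix.of fun k => e' ((finCongr hfr).symm k)) * S *
        (Matrix.of fun k => e' ((finCongr hfr).symm k)).transpose) k l =
        Matrix.toBilin' S (e' ((finCongr hfr).symm k)) (e' ((finCongr hfr).symm l)) := by
      intro k l
      rw [Matrix.toBilin'_apply', Matrix.mul_apply, dotProduct]
      simp only [Matrix.mul_apply, Matrix.mulVec, dotProduct, Finset.sum_mul, Finset.mul_sum,
        Matrix.of_apply, Matrix.transpose_apply]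
      rw [Finset.sum_comm]
      simp only [mul_assoc]
    ext k l
    rw [hval]
    rcases eq_or_ne k l with rfl | hkl
    · rw [Matrix.diagonal_apply_eq]
    · rw [Matrix.diagonal_apply_ne _ hkl]
      exact he' fun h => hkl ((finCongr hfr).symm.injective h)

/-- A quadratic relation between three vectors can be diagonalized. -/
theorem exists_diagonal_relation {E H : Type*} [AddCommGroup E] [Module K E]
    [AddCommGroup H] [Module K H] (β : E →ₗ[K] E →ₗ[K] H) (v : Fin 3 → E)
    (S : Matrix (Fin 3) (Fin 3) K) (hS : S.IsSymm) (hS0 : S ≠ 0)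
    (h : ∑ i, ∑ j, S i j • β (v i) (v j) = 0) :
    ∃ (u : Fin 3 → E) (w : Fin 3 → K), w ≠ 0 ∧
      Submodule.span K (Set.range u) = Submodule.span K (Set.range v) ∧
      ∑ i, w i • β (u i) (u i) = 0 := by
  obtain ⟨Q, w, hQ, hw⟩ := exists_mul_mul_transpose_eq_diagonal S hS
  have hQt : IsUnit Q.transpose.det := by rwa [Matrix.det_transpose]
  have hQi : IsUnit (Q.transpose⁻¹).det := Matrix.isUnit_nonsing_inv_det _ hQt
  refine ⟨act Q.transpose⁻¹ v, w, ?_, span_act hQi v, ?_⟩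
  · rintro rfl
    refine hS0 ?_
    have : Q⁻¹ * (Q * S * Q.transpose) * Q.transpose⁻¹ = S := by
      rw [← mul_assoc, ← mul_assoc, Matrix.nonsing_inv_mul Q hQ, one_mul, mul_assoc,
        Matrix.mul_nonsing_inv _ hQt, mul_one]
    rw [← this, hw]
    simp
  · set u := act Q.transpose⁻¹ v
    have hv : v = act Q.transpose u := by
      rw [← act_mul, Matrix.mul_nonsing_inv _ hQt, act_one]
    have hsum : ∑ i, ∑ j, S i j • β (v i) (v j) =
        ∑ k, ∑ l, (Q * S * Q.transpose) k l • β (u k) (u l) := by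
      rw [hv]
      simp only [act_apply, map_sum, LinearMap.sum_apply, map_smul, LinearMap.smul_apply,
        Finset.smul_sum, smul_smul, Matrix.mul_apply, Finset.sum_smul, Finset.sum_mul,
        Matrix.transpose_apply]
      have hcomm : ∀ F : Fin 3 → Fin 3 → Fin 3 → Fin 3 → H,
          ∑ i, ∑ j, ∑ l, ∑ k, F i j l k = ∑ k, ∑ l, ∑ j, ∑ i, F i j l k := fun F => by
        simp only [Fin.sum_univ_three]
        abel
      rw [hcomm]
      refine Finset.sum_congr rfl fun k _ => Finset.sum_congr rfl fun l _ =>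
        Finset.sum_congr rfl fun j _ => Finset.sum_congr rfl fun i _ => ?_
      congr 1
      ring
    rw [hsum, hw] at h
    simpa [Matrix.diagonal_apply] using h

variable [IsAlgClosed K]

/-- The square of a net outside `𝔾` has dimension `6`: a relation between the products of the
quadrics of the net is a conic; it cannot be reducible, as the polynomial ring is a domain, and a
smooth conic `xy = z²` forces the net to be `⟨p², pq, q²⟩` by unique factorization. -/
theorem linearIndependent_products {W : Gr K (Form K 2) 3} (hW : W ∉ doubleLines K)
    {v : Fin 3 → Form K 2} (hv : Framed.IsFrame v W) : LinearIndependent K (products v) := by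
  by_contra hdep
  obtain ⟨c, hc, n, hn⟩ := Fintype.not_linearIndependent_iff.1 hdep
  obtain ⟨u, w, hw, huv, hrel⟩ := exists_diagonal_relation (qmul (K := K)) v
    !![c 0, c 1 / 2, c 2 / 2; c 1 / 2, c 5, c 3 / 2; c 2 / 2, c 3 / 2, c 4]
    (by ext i j; fin_cases i <;> fin_cases j <;> rfl)
    (by
      intro h
      have h' : ∀ i j, !![c 0, c 1 / 2, c 2 / 2; c 1 / 2, c 5, c 3 / 2; c 2 / 2, c 3 / 2, c 4] i j
        = (0 : K) := fun i j => by rw [h]; rfl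
      have h00 := h' 0 0
      have h01 := h' 0 1
      have h02 := h' 0 2
      have h12 := h' 1 2
      have h22 := h' 2 2
      have h11 := h' 1 1
      simp at h00 h01 h02 h12 h22 h11
      refine hn ?_
      fin_cases n <;> assumption)
    (by
      rw [← hc]
      simp only [Fin.sum_univ_three, Fin.sum_univ_six, products]
      have e₁ := qmul_comm (v 1) (v 0)
      have e₂ := qmul_comm (v 2) (v 0)
      have e₃ := qmul_comm (v 2) (v 1)
      simp [e₁, e₂, e₃]
      module)
  have hu : Framed.IsFrame u W := huv.trans hv
  have hui := linearIndependent_of_isFrame hu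
  obtain ⟨I, hI⟩ := IsAlgClosed.exists_pow_nat_eq (-1 : K) zero_lt_two
  have hI0 : I ≠ 0 := by
    rintro rfl
    simp at hI
  choose α hα using fun k => IsAlgClosed.exists_pow_nat_eq (w k) zero_lt_two
  have hfac : ∀ i j, qmul (α i • u i + (I * α j) • u j) (α i • u i - (I * α j) • u j) =
      w i • qmul (u i) (u i) + w j • qmul (u j) (u j) := by
    intro i j
    have e₁ := qmul_comm (u j) (u i)
    rw [← hα i, ← hα j]
    simp only [map_add, map_sub, map_smul, LinearMap.add_apply, LinearMap.smul_apply, e₁]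
    have : (I * α j) * (I * α j) = - α j ^ 2 := by rw [← neg_one_mul, ← hI]; ring
    linear_combination (norm := module) (-this) • qmul (u j) (u j)
  -- a relation between two squares is a product of two non-zero quadrics
  have htwo : ∀ i j, i ≠ j → w i • qmul (u i) (u i) + w j • qmul (u j) (u j) = 0 → w i = 0 := by
    intro i j hij h
    rw [← hfac i j] at h
    have hz := mul_eq_zero.1 (congrArg Subtype.val h)
    have hij' := pair_of_ne hui hij
    rcases hz with hz | hz
    · rw [← hα i, (hij' _ _ (Subtype.ext hz)).1]; simp
    · have : α i • u i + (-(I * α j)) • u j = 0 := by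
        have h2 : α i • u i - (I * α j) • u j = 0 := Subtype.ext hz
        rw [← h2]
        module
      rw [← hα i, (hij' _ _ this).1]; simp
  have hw0 : ∀ k, w k ≠ 0 := by
    rw [Fin.sum_univ_three] at hrel
    have h01 : w 2 = 0 → w = 0 := fun h => by
      rw [h, zero_smul, add_zero] at hrel
      have h0 := htwo 0 1 (by decide) hrel
      have h1 := htwo 1 0 (by decide) (by rw [add_comm]; exact hrel)
      ext k; fin_cases k <;> assumption
    have h02 : w 1 = 0 → w = 0 := fun h => by
      rw [h, zero_smul, add_zero] at hrel
      have h0 := htwo 0 2 (by decide) hrel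
      have h1 := htwo 2 0 (by decide) (by rw [add_comm]; exact hrel)
      ext k; fin_cases k <;> assumption
    have h12 : w 0 = 0 → w = 0 := fun h => by
      rw [h, zero_smul, zero_add] at hrel
      have h0 := htwo 1 2 (by decide) hrel
      have h1 := htwo 2 1 (by decide) (by rw [add_comm]; exact hrel)
      ext k; fin_cases k <;> assumption
    intro k hk
    fin_cases k
    · exact hw (h12 hk)
    · exact hw (h02 hk)
    · exact hw (h01 hk)
  have hα0 : ∀ k, α k ≠ 0 := fun k h => hw0 k (by rw [← hα k, h]; simp)
  have h01 := pair_of_ne hui (by decide : (0 : Fin 3) ≠ 1)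
  obtain ⟨p, q, c₁, c₂, c₃, h₁, h₂, h₃⟩ := exists_doubleFrame_of_mul_eq_sq
    (x := α 0 • u 0 + (I * α 1) • u 1) (y := α 0 • u 0 - (I * α 1) • u 1) (z := (I * α 2) • u 2)
    (fun c h => by
      have := h01 (α 0 - c * α 0) (-(I * α 1) - c * (I * α 1)) (by
        rw [← sub_eq_zero] at h
        rw [← h]; module)
      have hc : c = 1 := by
        have := this.1
        have h3 : α 0 * (1 - c) = 0 := by rw [← this]; ring
        have := (mul_eq_zero.1 h3).resolve_left (hα0 0)
        exact (sub_eq_zero.1 this).symm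
      have h4 := this.2
      rw [hc] at h4
      have h5 : (-2 : K) * (I * α 1) = 0 := by rw [← h4]; ring
      simp [hI0, hα0 1] at h5)
    (fun h => hα0 0 (h01 _ _ h).1)
    (by
      rw [hfac 0 1]
      rw [Fin.sum_univ_three] at hrel
      rw [eq_neg_of_add_eq_zero_left hrel]
      simp only [map_smul, LinearMap.smul_apply, smul_smul]
      have : (I * α 2) * (I * α 2) = - w 2 := by rw [← neg_one_mul, ← hI, ← hα 2]; ring
      rw [this, neg_smul])
  have hle : W.1 ≤ Submodule.span K (Set.range (doubleFrame p q)) := by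
    rw [← isFrame_iff.1 hu, Submodule.span_le]
    have h : ∀ n, doubleFrame p q n ∈ Submodule.span K (Set.range (doubleFrame p q)) :=
      fun n => Submodule.subset_span ⟨n, rfl⟩
    have hx : α 0 • u 0 + (I * α 1) • u 1 ∈ Submodule.span K (Set.range (doubleFrame p q)) :=
      h₁ ▸ Submodule.smul_mem _ _ (h 0)
    have hy : α 0 • u 0 - (I * α 1) • u 1 ∈ Submodule.span K (Set.range (doubleFrame p q)) :=
      h₂ ▸ Submodule.smul_mem _ _ (h 2)
    have hz : (I * α 2) • u 2 ∈ Submodule.span K (Set.range (doubleFrame p q)) :=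
      h₃ ▸ Submodule.smul_mem _ _ (h 1)
    rintro _ ⟨k, rfl⟩
    fin_cases k
    · have h5 := add_mem hx hy
      rw [show α 0 • u 0 + (I * α 1) • u 1 + (α 0 • u 0 - (I * α 1) • u 1) = (2 * α 0) • u 0 by
        module] at h5
      exact (Submodule.smul_mem_iff _ (mul_ne_zero two_ne_zero (hα0 0))).1 h5
    · have h5 := sub_mem hx hy
      rw [show α 0 • u 0 + (I * α 1) • u 1 - (α 0 • u 0 - (I * α 1) • u 1) =
        (2 * (I * α 1)) • u 1 by module] at h5
      exact (Submodule.smul_mem_iff _ (mul_ne_zero two_ne_zero (mul_ne_zero hI0 (hα0 1)))).1 h5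
    · exact (Submodule.smul_mem_iff _ (mul_ne_zero hI0 (hα0 2))).1 hz
  have hdim : Module.finrank K (Submodule.span K (Set.range (doubleFrame p q))) ≤ 3 :=
    (finrank_range_le_card _).trans (by simp)
  have heq : W.1 = Submodule.span K (Set.range (doubleFrame p q)) :=
    Submodule.eq_of_le_of_finrank_le hle (by rw [W.2]; exact hdim)
  have hdf : LinearIndependent K (doubleFrame p q) :=
    linearIndependent_of_isFrame (isFrame_iff.2 heq.symm)
  have hpq : LinearIndependent K ![p, q] := by
    refine LinearIndependent.pair_iff.2 fun s t hst => ?_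
    refine pair_of_ne hdf (by decide : (0 : Fin 3) ≠ 1) s t ?_
    have : lmul p (s • p + t • q) = 0 := by rw [hst, map_zero]
    simpa [doubleFrame] using this
  refine hW ⟨⟨Submodule.span K {p, q}, ?_⟩, ?_⟩
  · have := finrank_span_eq_card hpq
    rw [Matrix.range_cons_cons_empty] at this
    simpa using this
  · exact heq.trans (square_eq_span_doubleFrame rfl).symm

end Conic

/-! ### Coordinates on the determinantal nets near a double line -/

section Chart

open MvPolynomial

variable {K : Type*} [Field K]

/-- The algebra homomorphism on polynomials which extends a linear map on linear forms. -/
noncomputable def liftLinear {R : Type*} [CommRing R] [Algebra K R] (φ : Form K 1 →ₗ[K] R) :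
    MvPolynomial (Fin 4) K →ₐ[K] R :=
  aeval fun i => φ ⟨X i, isHomogeneous_X K i⟩

theorem liftLinear_apply {R : Type*} [CommRing R] [Algebra K R] (φ : Form K 1 →ₗ[K] R)
    (x : Form K 1) : liftLinear φ (x : MvPolynomial (Fin 4) K) = φ x := by
  have hspan : (x : MvPolynomial (Fin 4) K) ∈ Submodule.span K (Set.range X) :=
    (homogeneousSubmodule_one_eq_span_X (σ := Fin 4) (R := K)).le x.2
  obtain ⟨c, hc⟩ := (Submodule.mem_span_range_iff_exists_fun K).1 hspan
  have hx : x = ∑ i, c i • (⟨X i, isHomogeneous_X K i⟩ : Form K 1) := by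
    refine Subtype.ext ?_
    rw [← hc]
    simp
  rw [← hc]
  conv_rhs => rw [hx]
  simp [liftLinear]

theorem finrank_form_one : Module.finrank K (Form K 1) = 4 := by
  have h : (homogeneousSubmodule (Fin 4) K 1) = Submodule.span K (Set.range X) :=
    homogeneousSubmodule_one_eq_span_X
  rw [(LinearEquiv.ofEq _ _ h).finrank_eq, finrank_span_eq_card (linearIndependent_X (Fin 4) K)]
  simp

variable (z : Module.Basis (Fin 4) K (Form K 1))

/-- Restriction to the line `z₂ = z₃ = 0`, with affine coordinate `z₁ / z₀`. -/
noncomputable def lineHom : MvPolynomial (Fin 4) K →ₐ[K] Polynomial K :=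
  liftLinear (z.constr K ![1, Polynomial.X, 0, 0])

/-- Restriction to the first-order neighbourhood of the line `z₂ = z₃ = 0` in the direction
`(z₂, z₃) = (c₀ ε, c₁ ε)`. -/
noncomputable def normalHom (c : Fin 2 → K) : MvPolynomial (Fin 4) K →ₐ[K]
    DualNumber (Polynomial K) :=
  liftLinear (z.constr K ![1, TrivSqZeroExt.inl Polynomial.X,
    TrivSqZeroExt.inr (Polynomial.C (c 0)), TrivSqZeroExt.inr (Polynomial.C (c 1))])

/-- The coefficient of `z₀ ^ (d - k) z₁ ^ k` in a form of degree `d`. -/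
noncomputable def lineCoeff {d : ℕ} (k : ℕ) : Module.Dual K (Form K d) :=
  Polynomial.lcoeff K k ∘ₗ (lineHom z).toLinearMap ∘ₗ Submodule.subtype _

/-- The coefficient of `z₀ ^ (d - 1 - k) z₁ ^ k z_(j + 2)` in a form of degree `d`. -/
noncomputable def normalCoeff {d : ℕ} (j : Fin 2) (k : ℕ) : Module.Dual K (Form K d) :=
  Polynomial.lcoeff K k ∘ₗ (TrivSqZeroExt.sndHom (Polynomial K) (Polynomial K)).restrictScalars K ∘ₗ
    (normalHom z (Pi.single j 1)).toLinearMap ∘ₗ Submodule.subtype _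

/-- The linear form `c₀ z₂ + c₁ z₃`. -/
noncomputable def conormal (c : Fin 2 → K) : Form K 1 := c 0 • z 2 + c 1 • z 3

/-- The minors of the matrix with rows `(p, w₄), (q + w₂, p + w₃), (w₁, q)`, where
`p = z₀ + n₀`, `q = z₁ + n₁` and `w₁, …, w₄` are given by `n₂, …, n₅`; the twelve coordinates `n`
are affine coordinates on the nets near `⟨z₀², z₀z₁, z₁²⟩`, and the squares of lines are given by
`w = 0`. -/
noncomputable def normalNet (n : Fin 6 → Fin 2 → K) : Fin 3 → Form K 2 :=
  let p := z 0 + conormal z (n 0)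
  let q := z 1 + conormal z (n 1)
  ![lmul p (p + conormal z (n 4)) - lmul (conormal z (n 5)) (q + conormal z (n 3)),
    lmul p q - lmul (conormal z (n 5)) (conormal z (n 2)),
    lmul (q + conormal z (n 3)) q - lmul (conormal z (n 2)) (p + conormal z (n 4))]

/-- The coordinates `n` of a net in normal form are linear in its normalized frame. -/
noncomputable def normalCoord (N : Fin 3 → Form K 2) : Fin 6 → Fin 2 → K :=
  ![fun j => normalCoeff z j 1 (N 1), fun j => normalCoeff z j 0 (N 1),
    fun j => - normalCoeff z j 0 (N 2),
    fun j => normalCoeff z j 1 (N 2) - 2 * normalCoeff z j 0 (N 1),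
    fun j => normalCoeff z j 0 (N 0) - 2 * normalCoeff z j 1 (N 1),
    fun j => - normalCoeff z j 1 (N 0)]

/-- The quartic `N₀N₂ - N₁²`, which vanishes for the frame `(p², pq, q²)`. -/
noncomputable def conic (N : Fin 3 → Form K 2) : Form K 4 := qmul (N 0) (N 2) - qmul (N 1) (N 1)

@[simp] theorem lineHom_zero : lineHom z (z 0 : MvPolynomial (Fin 4) K) = 1 := by
  simp [lineHom, liftLinear_apply]

@[simp] theorem lineHom_one : lineHom z (z 1 : MvPolynomial (Fin 4) K) = Polynomial.X := by
  simp [lineHom, liftLinear_apply]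

@[simp] theorem lineHom_two : lineHom z (z 2 : MvPolynomial (Fin 4) K) = 0 := by
  simp [lineHom, liftLinear_apply]

@[simp] theorem lineHom_three : lineHom z (z 3 : MvPolynomial (Fin 4) K) = 0 := by
  simp [lineHom, liftLinear_apply]

@[simp] theorem lineHom_conormal (c : Fin 2 → K) :
    lineHom z (conormal z c : MvPolynomial (Fin 4) K) = 0 := by
  simp [conormal]

@[simp] theorem normalHom_zero (c : Fin 2 → K) :
    normalHom z c (z 0 : MvPolynomial (Fin 4) K) = 1 := by
  simp [normalHom, liftLinear_apply]

@[simp] theorem normalHom_one (c : Fin 2 → K) :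
    normalHom z c (z 1 : MvPolynomial (Fin 4) K) = TrivSqZeroExt.inl Polynomial.X := by
  simp [normalHom, liftLinear_apply]

@[simp] theorem normalHom_conormal (j : Fin 2) (c : Fin 2 → K) :
    normalHom z (Pi.single j 1) (conormal z c : MvPolynomial (Fin 4) K) =
      TrivSqZeroExt.inr (Polynomial.C (c j)) := by
  have h2 : normalHom z (Pi.single j 1) (z 2 : MvPolynomial (Fin 4) K) =
      TrivSqZeroExt.inr (Polynomial.C ((Pi.single j 1 : Fin 2 → K) 0)) := by
    simp [normalHom, liftLinear_apply]
  have h3 : normalHom z (Pi.single j 1) (z 3 : MvPolynomial (Fin 4) K) =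
      TrivSqZeroExt.inr (Polynomial.C ((Pi.single j 1 : Fin 2 → K) 1)) := by
    simp [normalHom, liftLinear_apply]
  simp only [conormal, Submodule.coe_add, Submodule.coe_smul, map_add, map_smul, h2, h3]
  fin_cases j <;> refine TrivSqZeroExt.ext ?_ ?_ <;>
    simp [Polynomial.smul_eq_C_mul]

theorem normalHom_normalNet (n : Fin 6 → Fin 2 → K) (j : Fin 2) (i : Fin 3) :
    normalHom z (Pi.single j 1) (normalNet z n i : MvPolynomial (Fin 4) K) =
      TrivSqZeroExt.inl (Polynomial.X ^ (i : ℕ)) + TrivSqZeroExt.inr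
        (![2 * Polynomial.C (n 0 j) + Polynomial.C (n 4 j) - Polynomial.C (n 5 j) * Polynomial.X,
          Polynomial.C (n 1 j) + Polynomial.C (n 0 j) * Polynomial.X,
          (2 * Polynomial.C (n 1 j) + Polynomial.C (n 3 j)) * Polynomial.X -
            Polynomial.C (n 2 j)] i) := by
  fin_cases i <;> refine TrivSqZeroExt.ext ?_ ?_ <;> simp [normalNet, pow_two] <;> ring

theorem normalCoord_normalNet (n : Fin 6 → Fin 2 → K) : normalCoord z (normalNet z n) = n := by
  have h : ∀ (j : Fin 2) (k : ℕ) (i : Fin 3), normalCoeff z j k (normalNet z n i) =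
      (![2 * Polynomial.C (n 0 j) + Polynomial.C (n 4 j) - Polynomial.C (n 5 j) * Polynomial.X,
          Polynomial.C (n 1 j) + Polynomial.C (n 0 j) * Polynomial.X,
          (2 * Polynomial.C (n 1 j) + Polynomial.C (n 3 j)) * Polynomial.X -
            Polynomial.C (n 2 j)] i).coeff k := by
    intro j k i
    simp [normalCoeff, normalHom_normalNet]
  ext i j
  simp only [normalCoord, h]
  fin_cases i <;> simp [Polynomial.coeff_C]

/-- The four coordinates transversal to the double lines are, up to sign, coefficients of the
quartic `N₀N₂ - N₁²`. -/
theorem normalCoeff_conic_normalNet (n : Fin 6 → Fin 2 → K) (j : Fin 2) :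
    normalCoeff z j 0 (conic (normalNet z n)) = - n 2 j ∧
    normalCoeff z j 1 (conic (normalNet z n)) = n 3 j ∧
    normalCoeff z j 2 (conic (normalNet z n)) = n 4 j ∧
    normalCoeff z j 3 (conic (normalNet z n)) = - n 5 j := by
  have h : ∀ k, normalCoeff z j k (conic (normalNet z n)) =
      (- Polynomial.C (n 2 j) + Polynomial.C (n 3 j) * Polynomial.X +
        Polynomial.C (n 4 j) * Polynomial.X ^ 2 - Polynomial.C (n 5 j) * Polynomial.X ^ 3).coeff k
      := by
    intro k
    simp only [normalCoeff, conic, LinearMap.comp_apply, Polynomial.lcoeff_apply]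
    congr 1
    simp [normalHom_normalNet]
    ring
  simp only [h]
  refine ⟨?_, ?_, ?_, ?_⟩ <;> simp [Polynomial.coeff_C, Polynomial.coeff_X, Polynomial.coeff_X_pow]

end Chart

/-! ### The normal form of a determinantal net -/

section NormalForm

open MvPolynomial

variable {K : Type*} [Field K]

/-- The vector product of the columns of a `3 × 2` matrix of linear forms: its minors, with
signs. -/
noncomputable def cross (m : Fin 3 → Fin 2 → Form K 1) : Fin 3 → Form K 2 :=
  ![lmul (m 1 0) (m 2 1) - lmul (m 1 1) (m 2 0), lmul (m 2 0) (m 0 1) - lmul (m 2 1) (m 0 0),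
    lmul (m 0 0) (m 1 1) - lmul (m 0 1) (m 1 0)]

theorem minorSpan_eq (m : Matrix (Fin 3) (Fin 2) (Form K 1)) :
    minorSpan m = Submodule.span K (Set.range (cross m)) := by
  have h : ∀ n, cross m n ∈ Submodule.span K (Set.range (cross m)) :=
    fun n => Submodule.subset_span ⟨n, rfl⟩
  refine le_antisymm (Submodule.span_le.2 ?_) (Submodule.span_le.2 ?_)
  · rintro f ⟨i, j, hij, hf⟩
    fin_cases i <;> fin_cases j <;> simp at hij
    · have : f = cross m 2 := Subtype.ext hf
      exact this ▸ h 2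
    · have : f = - cross m 1 := Subtype.ext (hf.trans (by simp [cross]; ring))
      exact this ▸ neg_mem (h 1)
    · have : f = cross m 0 := Subtype.ext hf
      exact this ▸ h 0
  · rintro _ ⟨n, rfl⟩
    fin_cases n
    · exact Submodule.subset_span ⟨1, 2, by decide, rfl⟩
    · have : cross m 1 = - (lmul (m 0 0) (m 2 1) - lmul (m 0 1) (m 2 0)) :=
        Subtype.ext (by simp [cross]; ring)
      change cross m 1 ∈ _
      rw [this]
      exact neg_mem (Submodule.subset_span ⟨0, 2, by decide, rfl⟩)
    · exact Submodule.subset_span ⟨0, 1, by decide, rfl⟩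

/-- Row operations on the matrix realize every change of frame of the net of its minors. -/
theorem exists_cross_eq_act (m : Fin 3 → Fin 2 → Form K 1) {G : Matrix (Fin 3) (Fin 3) K}
    (hG : IsUnit G.det) : ∃ m' : Fin 3 → Fin 2 → Form K 1, cross m' = act G (cross m) := by
  refine ⟨fun i => ![G.det⁻¹ • ∑ k, G.adjugate k i • m k 0, ∑ k, G.adjugate k i • m k 1], ?_⟩
  have hd : C G.det⁻¹ * C G.det = (1 : MvPolynomial (Fin 4) K) := by
    rw [← C_mul, inv_mul_cancel₀ hG.ne_zero, C_1]
  rw [Matrix.det_fin_three G] at hd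
  ext1 i
  refine Subtype.ext ?_
  rw [act_apply, Matrix.adjugate_fin_three, Fin.sum_univ_three, Matrix.det_fin_three G]
  fin_cases i <;>
    simp [cross, Fin.sum_univ_three, smul_eq_C_mul] at hd ⊢
  · linear_combination (
      C (G 0 0) * (m 1 0 * m 2 1 - m 1 1 * m 2 0 : MvPolynomial (Fin 4) K) +
      C (G 0 1) * (m 2 0 * m 0 1 - m 2 1 * m 0 0 : MvPolynomial (Fin 4) K) +
      C (G 0 2) * (m 0 0 * m 1 1 - m 0 1 * m 1 0 : MvPolynomial (Fin 4) K)) * hd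
  · linear_combination (
      C (G 1 0) * (m 1 0 * m 2 1 - m 1 1 * m 2 0 : MvPolynomial (Fin 4) K) +
      C (G 1 1) * (m 2 0 * m 0 1 - m 2 1 * m 0 0 : MvPolynomial (Fin 4) K) +
      C (G 1 2) * (m 0 0 * m 1 1 - m 0 1 * m 1 0 : MvPolynomial (Fin 4) K)) * hd
  · linear_combination (
      C (G 2 0) * (m 1 0 * m 2 1 - m 1 1 * m 2 0 : MvPolynomial (Fin 4) K) +
      C (G 2 1) * (m 2 0 * m 0 1 - m 2 1 * m 0 0 : MvPolynomial (Fin 4) K) +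
      C (G 2 2) * (m 0 0 * m 1 1 - m 0 1 * m 1 0 : MvPolynomial (Fin 4) K)) * hd

variable (z : Module.Basis (Fin 4) K (Form K 1))

theorem eq_add_conormal (x : Form K 1) :
    x = z.repr x 0 • z 0 + z.repr x 1 • z 1 + conormal z ![z.repr x 2, z.repr x 3] := by
  conv_lhs => rw [← z.sum_repr x]
  rw [Fin.sum_univ_four, conormal]
  simp [add_assoc]

theorem lineHom_linear (x : Form K 1) : lineHom z (x : MvPolynomial (Fin 4) K) =
    Polynomial.C (z.repr x 0) + Polynomial.C (z.repr x 1) * Polynomial.X := by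
  conv_lhs => rw [eq_add_conormal z x]
  simp [Polynomial.smul_eq_C_mul]

theorem cubic_eq_zero {c₀ c₁ c₂ c₃ : K} (h : Polynomial.C c₀ + Polynomial.C c₁ * Polynomial.X +
    Polynomial.C c₂ * Polynomial.X ^ 2 + Polynomial.C c₃ * Polynomial.X ^ 3 = 0) :
    c₀ = 0 ∧ c₁ = 0 ∧ c₂ = 0 ∧ c₃ = 0 := by
  have hc := fun k => congrArg (fun p => Polynomial.coeff p k) h
  simp only [Polynomial.coeff_add, Polynomial.coeff_C_mul, Polynomial.coeff_C, Polynomial.coeff_X,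
    Polynomial.coeff_X_pow, Polynomial.coeff_zero] at hc
  exact ⟨by simpa using hc 0, by simpa using hc 1, by simpa using hc 2, by simpa using hc 3⟩

theorem conormal_sub (c d : Fin 2 → K) : conormal z (c - d) = conormal z c - conormal z d := by
  simp only [conormal, Pi.sub_apply]
  module

/-- A determinantal net whose restriction to the line `z₂ = z₃ = 0` has the frame `1, t, t²` is in
normal form: on the line, the columns of the matrix are syzygies of `1, t, t²`, so that column
operations bring it to the form `(1, 0), (t, 1), (0, t)`. -/
theorem exists_eq_normalNet {m : Matrix (Fin 3) (Fin 2) (Form K 1)} {N : Fin 3 → Form K 2}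
    (hNi : LinearIndependent K N) (hN : Submodule.span K (Set.range N) = minorSpan m)
    (hl : ∀ i, lineHom z (N i : MvPolynomial (Fin 4) K) = Polynomial.X ^ (i : ℕ)) :
    ∃ n, N = normalNet z n := by
  -- the signed frame, which is the vector product of the columns of a matrix `a`
  have hspan : Submodule.span K (Set.range ![N 2, -N 1, N 0]) = Submodule.span K (Set.range N) := by
    refine le_antisymm (Submodule.span_le.2 ?_) (Submodule.span_le.2 ?_)
    · rintro _ ⟨i, rfl⟩
      fin_cases i
      · exact Submodule.subset_span ⟨2, rfl⟩
      · exact neg_mem (Submodule.subset_span ⟨1, rfl⟩)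
      · exact Submodule.subset_span ⟨0, rfl⟩
    · rintro _ ⟨i, rfl⟩
      have h : ∀ i, ![N 2, -N 1, N 0] i ∈ Submodule.span K (Set.range ![N 2, -N 1, N 0]) :=
        fun i => Submodule.subset_span ⟨i, rfl⟩
      fin_cases i
      · exact h 2
      · have h1 := neg_mem (h 1)
        rwa [show -(![N 2, -N 1, N 0] 1) = N 1 from neg_neg (N 1)] at h1
      · exact h 0
  have hNs : LinearIndependent K ![N 2, -N 1, N 0] := by
    rw [linearIndependent_iff_card_eq_finrank_span] at hNi ⊢
    rw [hNi, Set.finrank, Set.finrank, hspan]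
  obtain ⟨G, hG, hGm⟩ := exists_act_eq (v := cross m) hNs fun i => by
    rw [← minorSpan_eq, ← hN, ← hspan]; exact Submodule.subset_span ⟨i, rfl⟩
  obtain ⟨a, ha⟩ := exists_cross_eq_act m hG
  rw [hGm] at ha
  have hM0 : (N 0 : MvPolynomial (Fin 4) K) = a 0 0 * a 1 1 - a 0 1 * a 1 0 :=
    (congrArg Subtype.val (congrFun ha 2)).symm
  have hM1 : (N 1 : MvPolynomial (Fin 4) K) = a 0 0 * a 2 1 - a 0 1 * a 2 0 := by
    have : (a 2 0 * a 0 1 - a 2 1 * a 0 0 : MvPolynomial (Fin 4) K) = - N 1 :=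
      congrArg Subtype.val (congrFun ha 1)
    linear_combination this
  have hM2 : (N 2 : MvPolynomial (Fin 4) K) = a 1 0 * a 2 1 - a 1 1 * a 2 0 :=
    (congrArg Subtype.val (congrFun ha 0)).symm
  have hl0 := hl 0
  have hl1 := hl 1
  have hl2 := hl 2
  simp only [Fin.val_zero, pow_zero, Fin.val_one, pow_one, Fin.val_two] at hl0 hl1 hl2
  -- the columns of `a` are syzygies of `N`; their restrictions to the line are therefore
  -- combinations of `(1, t, 0)` and `(0, 1, t)`
  have hsyz : ∀ b : Fin 2, z.repr (a 0 b) 1 = 0 ∧ z.repr (a 1 b) 1 = z.repr (a 0 b) 0 ∧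
      z.repr (a 2 b) 0 = 0 ∧ z.repr (a 2 b) 1 = z.repr (a 1 b) 0 := by
    intro b
    have hs : (a 0 b * N 2 - a 1 b * N 1 + a 2 b * N 0 : MvPolynomial (Fin 4) K) = 0 := by
      rw [hM0, hM1, hM2]
      fin_cases b <;> simp <;> ring
    have h := congrArg (lineHom z) hs
    simp only [map_add, map_sub, map_mul, hl0, hl1, hl2, lineHom_linear, map_zero] at h
    have hp : Polynomial.C (z.repr (a 2 b) 0) +
        Polynomial.C (z.repr (a 2 b) 1 - z.repr (a 1 b) 0) * Polynomial.X +
        Polynomial.C (z.repr (a 0 b) 0 - z.repr (a 1 b) 1) * Polynomial.X ^ 2 +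
        Polynomial.C (z.repr (a 0 b) 1) * Polynomial.X ^ 3 = 0 := by
      rw [← h]
      simp only [map_sub]
      ring
    obtain ⟨h0, h1, h2, h3⟩ := cubic_eq_zero hp
    exact ⟨h3, (sub_eq_zero.1 h2).symm, h0, sub_eq_zero.1 h1⟩
  have hdet : z.repr (a 0 0) 0 * z.repr (a 1 1) 0 - z.repr (a 0 1) 0 * z.repr (a 1 0) 0 = 1 := by
    have h := hl0
    rw [hM0] at h
    simp only [map_sub, map_mul, lineHom_linear, (hsyz _).1, (hsyz _).2.1] at h
    have hc := congrArg (fun p => Polynomial.coeff p 0) h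
    simpa using hc
  -- the column operation which makes the restriction to the line standard
  set α₀ := z.repr (a 0 0) 0
  set α₁ := z.repr (a 0 1) 0
  set β₀ := z.repr (a 1 0) 0
  set β₁ := z.repr (a 1 1) 0
  obtain ⟨b₀, hb₀⟩ : ∃ b : Fin 3 → Form K 1, ∀ i, b i = β₁ • a i 0 - β₀ • a i 1 :=
    ⟨_, fun _ => rfl⟩
  obtain ⟨b₁, hb₁⟩ : ∃ b : Fin 3 → Form K 1, ∀ i, b i = α₀ • a i 1 - α₁ • a i 0 :=
    ⟨_, fun _ => rfl⟩
  have hminor : ∀ i j, (b₀ i * b₁ j - b₁ i * b₀ j : MvPolynomial (Fin 4) K) =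
      a i 0 * a j 1 - a i 1 * a j 0 := by
    intro i j
    have hd : (C α₀ * C β₁ - C α₁ * C β₀ : MvPolynomial (Fin 4) K) = 1 := by
      rw [← C_mul, ← C_mul, ← C_sub, hdet, C_1]
    simp only [hb₀, hb₁, Submodule.coe_sub, Submodule.coe_smul, smul_eq_C_mul]
    linear_combination (a i 0 * a j 1 - a i 1 * a j 0 : MvPolynomial (Fin 4) K) * hd
  have hform : ∀ x : Form K 1, ∃ c, x = z.repr x 0 • z 0 + z.repr x 1 • z 1 + conormal z c :=
    fun x => ⟨_, eq_add_conormal z x⟩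
  have hr0 : ∀ i k, z.repr (b₀ i) k = β₁ * z.repr (a i 0) k - β₀ * z.repr (a i 1) k := by
    intro i k; rw [hb₀]; simp
  have hr1 : ∀ i k, z.repr (b₁ i) k = α₀ * z.repr (a i 1) k - α₁ * z.repr (a i 0) k := by
    intro i k; rw [hb₁]; simp
  obtain ⟨P, hP⟩ := hform (b₀ 0)
  obtain ⟨w₄, hw₄⟩ := hform (b₁ 0)
  obtain ⟨A, hA⟩ := hform (b₀ 1)
  obtain ⟨B, hB⟩ := hform (b₁ 1)
  obtain ⟨w₁, hw₁⟩ := hform (b₀ 2)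
  obtain ⟨Q, hQ⟩ := hform (b₁ 2)
  have e₁ : β₁ * β₀ - β₀ * β₁ = 0 := by ring
  have e₂ : α₀ * α₁ - α₁ * α₀ = 0 := by ring
  have e₃ : β₁ * α₀ - β₀ * α₁ = 1 := by rw [← hdet]; ring
  have e₄ : α₀ * β₁ - α₁ * β₀ = 1 := hdet
  simp only [hr0, hr1, (hsyz _).1, (hsyz _).2.1, (hsyz _).2.2.1,
    (hsyz _).2.2.2] at hP hw₄ hA hB hw₁ hQ
  simp only [mul_zero, sub_zero, zero_smul, zero_add, add_zero] at hP hw₄ hA hB hw₁ hQ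
  change b₀ 0 = (β₁ * α₀ - β₀ * α₁) • z 0 + _ at hP
  change b₁ 0 = (α₀ * α₁ - α₁ * α₀) • z 0 + _ at hw₄
  change b₀ 1 = (β₁ * β₀ - β₀ * β₁) • z 0 + (β₁ * α₀ - β₀ * α₁) • z 1 + _ at hA
  change b₁ 1 = (α₀ * β₁ - α₁ * β₀) • z 0 + (α₀ * α₁ - α₁ * α₀) • z 1 + _ at hB
  change b₀ 2 = (β₁ * β₀ - β₀ * β₁) • z 1 + _ at hw₁
  change b₁ 2 = (α₀ * β₁ - α₁ * β₀) • z 1 + _ at hQ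
  rw [e₃, one_smul] at hP
  rw [e₂, zero_smul, zero_add] at hw₄
  rw [e₁, e₃, one_smul, zero_smul, zero_add] at hA
  rw [e₂, e₄, one_smul, zero_smul, add_zero] at hB
  rw [e₁, zero_smul, zero_add] at hw₁
  rw [e₄, one_smul] at hQ
  refine ⟨![P, Q, w₁, A - Q, B - P, w₄], ?_⟩
  have hA' : z 1 + conormal z Q + conormal z (A - Q) = b₀ 1 := by
    rw [hA, conormal_sub]; abel
  have hB' : z 0 + conormal z P + conormal z (B - P) = b₁ 1 := by
    rw [hB, conormal_sub]; abel
  have hnet : normalNet z ![P, Q, w₁, A - Q, B - P, w₄] =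
      ![lmul (z 0 + conormal z P) (z 0 + conormal z P + conormal z (B - P)) -
        lmul (conormal z w₄) (z 1 + conormal z Q + conormal z (A - Q)),
        lmul (z 0 + conormal z P) (z 1 + conormal z Q) - lmul (conormal z w₄) (conormal z w₁),
        lmul (z 1 + conormal z Q + conormal z (A - Q)) (z 1 + conormal z Q) -
        lmul (conormal z w₁) (z 0 + conormal z P + conormal z (B - P))] := rfl
  rw [hnet, hA', hB', ← hP, ← hQ, ← hw₁, ← hw₄]
  ext1 i
  refine Subtype.ext ?_
  fin_cases i
  · exact hM0.trans (hminor 0 1).symm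
  · exact hM1.trans (hminor 0 2).symm
  · refine hM2.trans ((hminor 1 2).symm.trans ?_)
    change _ = (b₀ 1 * b₁ 2 - b₀ 2 * b₁ 1 : MvPolynomial (Fin 4) K)
    ring

end NormalForm

/-! ### Functions regular where a polynomial does not vanish -/

section Regular

variable {K : Type*} [Field K] {A B C H : Type*} [AddCommGroup A] [Module K A] [AddCommGroup B]
  [Module K B] [AddCommGroup C] [Module K C] [AddCommGroup H] [Module K H]

/-- Functions which are quotients of a polynomial by a power of `D` where `D ≠ 0`. -/
def IsRegularAway (D : A → K) (f : A → K) : Prop :=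
  ∃ (N : ℕ) (c : A → K), IsPoly K c ∧ ∀ v, D v ≠ 0 → D v ^ N * f v = c v

/-- Maps to a vector space with regular coordinates where `D ≠ 0`. -/
def IsRegularMapAway (D : A → K) (x : A → B) : Prop :=
  ∀ φ : Module.Dual K B, IsRegularAway D fun v => φ (x v)

/-- Functions which on `T`, where `D ≠ 0`, belong to the ideal generated by the coordinates of the
vector valued function `δ`. -/
def InIdealAway (T : Set A) (D : A → K) (δ : A → H) (f : A → K) : Prop :=
  ∃ (N : ℕ) (c : A → Module.Dual K H), IsPolyMap K c ∧
    ∀ v ∈ T, D v ≠ 0 → D v ^ N * f v = c v (δ v)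

/-- Maps to a vector space with coordinates in the ideal of `InIdealAway`. -/
def MapInIdealAway (T : Set A) (D : A → K) (δ : A → H) (x : A → B) : Prop :=
  ∀ φ : Module.Dual K B, InIdealAway T D δ fun v => φ (x v)

variable {D : A → K} {T : Set A} {δ : A → H} {f g : A → K}

theorem IsPoly.isRegularAway (hf : IsPoly K f) : IsRegularAway D f :=
  ⟨0, f, hf, fun v _ => by simp⟩

theorem IsRegularAway.add (hD : IsPoly K D) (hf : IsRegularAway D f) (hg : IsRegularAway D g) :
    IsRegularAway D fun v => f v + g v := by
  obtain ⟨N, c, hc, h⟩ := hf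
  obtain ⟨M, d, hd, h'⟩ := hg
  refine ⟨N + M, _, ((hD.pow M).mul hc).add ((hD.pow N).mul hd), fun v hv => ?_⟩
  rw [← h v hv, ← h' v hv]
  ring

theorem IsRegularAway.mul (hf : IsRegularAway D f) (hg : IsRegularAway D g) :
    IsRegularAway D fun v => f v * g v := by
  obtain ⟨N, c, hc, h⟩ := hf
  obtain ⟨M, d, hd, h'⟩ := hg
  refine ⟨N + M, _, hc.mul hd, fun v hv => ?_⟩
  rw [← h v hv, ← h' v hv]
  ring

theorem IsRegularAway.sum (hD : IsPoly K D) {ι : Type*} (s : Finset ι) {f : ι → A → K}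
    (hf : ∀ i ∈ s, IsRegularAway D (f i)) : IsRegularAway D fun v => ∑ i ∈ s, f i v := by
  classical
  induction s using Finset.induction_on with
  | empty => simpa using (IsPoly.const 0).isRegularAway
  | insert i s hi ih =>
    simp only [Finset.sum_insert hi]
    exact (hf i (by simp)).add hD (ih fun j hj => hf j (by simp [hj]))

theorem IsPoly.isRegularAway_comp (hD : IsPoly K D) {F : B → K} (hF : IsPoly K F) {x : A → B}
    (hx : IsRegularMapAway D x) : IsRegularAway D fun v => F (x v) :=
  IsPoly.induction (p := fun F => IsRegularAway D fun v => F (x v)) hx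
    (fun c => (IsPoly.const c).isRegularAway) (fun _ _ _ _ h h' => h.add hD h')
    (fun _ _ _ _ h h' => h.mul h') hF

theorem IsPolyMap.isRegularMapAway {x : A → B} (hx : IsPolyMap K x) : IsRegularMapAway D x :=
  fun φ => (hx φ).isRegularAway

theorem IsRegularMapAway.add (hD : IsPoly K D) {x y : A → B} (hx : IsRegularMapAway D x)
    (hy : IsRegularMapAway D y) : IsRegularMapAway D fun v => x v + y v := fun φ => by
  simpa only [map_add] using (hx φ).add hD (hy φ)

theorem IsRegularMapAway.sum (hD : IsPoly K D) {ι : Type*} (s : Finset ι) {x : ι → A → B}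
    (hx : ∀ i ∈ s, IsRegularMapAway D (x i)) : IsRegularMapAway D fun v => ∑ i ∈ s, x i v :=
  fun φ => by
    simpa only [map_sum] using IsRegularAway.sum hD s fun i hi => hx i hi φ

theorem IsRegularMapAway.smul {x : A → B} (hf : IsRegularAway D f) (hx : IsRegularMapAway D x) :
    IsRegularMapAway D fun v => f v • x v := fun φ => by
  simpa only [map_smul, smul_eq_mul] using hf.mul (hx φ)

theorem IsRegularMapAway.bilin (hD : IsPoly K D) [FiniteDimensional K B] [FiniteDimensional K C]
    (β : B →ₗ[K] C →ₗ[K] H) {x : A → B} {y : A → C} (hx : IsRegularMapAway D x)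
    (hy : IsRegularMapAway D y) : IsRegularMapAway D fun v => β (x v) (y v) := by
  simp only [fun v => bilin_expand β (x v) (y v)]
  exact .sum hD _ fun i _ => .sum hD _ fun j _ =>
    .smul ((hx _).mul (hy _)) (IsPolyMap.const _).isRegularMapAway

theorem IsRegularMapAway.pi (hD : IsPoly K D) {ι : Type*} [Fintype ι] {x : A → ι → B}
    (hx : ∀ i, IsRegularMapAway D fun v => x v i) : IsRegularMapAway D x := by
  classical
  intro φ
  have e : (fun v => φ (x v)) =
      fun v => ∑ i, (φ ∘ₗ LinearMap.single K (fun _ : ι => B) i) (x v i) := by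
    ext v
    conv_lhs => rw [← Finset.univ_sum_single (x v), map_sum]
    rfl
  rw [e]
  exact .sum hD _ fun i _ => hx i _

theorem InIdealAway.congr (hf : InIdealAway T D δ f) (h : ∀ v ∈ T, D v ≠ 0 → f v = g v) :
    InIdealAway T D δ g := by
  obtain ⟨N, c, hc, hN⟩ := hf
  exact ⟨N, c, hc, fun v hv hDv => by rw [← h v hv hDv, hN v hv hDv]⟩

theorem InIdealAway.add (hD : IsPoly K D) (hf : InIdealAway T D δ f) (hg : InIdealAway T D δ g) :
    InIdealAway T D δ fun v => f v + g v := by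
  obtain ⟨N, c, hc, h⟩ := hf
  obtain ⟨M, d, hd, h'⟩ := hg
  refine ⟨N + M, fun v => D v ^ M • c v + D v ^ N • d v,
    (IsPolyMap.smul (hD.pow M) hc).add (IsPolyMap.smul (hD.pow N) hd), fun v hv hDv => ?_⟩
  rw [LinearMap.add_apply, LinearMap.smul_apply, LinearMap.smul_apply, ← h v hv hDv,
    ← h' v hv hDv, smul_eq_mul, smul_eq_mul]
  ring

theorem InIdealAway.mul_left (hf : IsRegularAway D f) (hg : InIdealAway T D δ g) :
    InIdealAway T D δ fun v => f v * g v := by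
  obtain ⟨N, c, hc, h⟩ := hf
  obtain ⟨M, d, hd, h'⟩ := hg
  refine ⟨N + M, fun v => c v • d v, IsPolyMap.smul hc hd, fun v hv hDv => ?_⟩
  rw [LinearMap.smul_apply, ← h' v hv hDv, ← h v hDv, smul_eq_mul]
  ring

theorem InIdealAway.zero : InIdealAway T D δ fun _ => 0 :=
  ⟨0, fun _ => 0, IsPolyMap.const 0, fun v _ _ => by simp⟩

theorem InIdealAway.sum (hD : IsPoly K D) {ι : Type*} (s : Finset ι) {f : ι → A → K}
    (hf : ∀ i ∈ s, InIdealAway T D δ (f i)) : InIdealAway T D δ fun v => ∑ i ∈ s, f i v := by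
  classical
  induction s using Finset.induction_on with
  | empty => simpa using InIdealAway.zero
  | insert i s hi ih =>
    simp only [Finset.sum_insert hi]
    exact (hf i (by simp)).add hD (ih fun j hj => hf j (by simp [hj]))

theorem MapInIdealAway.congr {x y : A → B} (hx : MapInIdealAway T D δ x)
    (h : ∀ v ∈ T, D v ≠ 0 → x v = y v) : MapInIdealAway T D δ y :=
  fun φ => (hx φ).congr fun v hv hDv => by rw [h v hv hDv]

theorem MapInIdealAway.add (hD : IsPoly K D) {x y : A → B} (hx : MapInIdealAway T D δ x)
    (hy : MapInIdealAway T D δ y) : MapInIdealAway T D δ fun v => x v + y v := fun φ => by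
  simpa only [map_add] using (hx φ).add hD (hy φ)

theorem MapInIdealAway.smul {x : A → B} (hf : IsRegularAway D f) (hx : MapInIdealAway T D δ x) :
    MapInIdealAway T D δ fun v => f v • x v := fun φ => by
  simpa only [map_smul, smul_eq_mul] using InIdealAway.mul_left hf (hx φ)

theorem MapInIdealAway.smul_const (hf : InIdealAway T D δ f) (b : B) :
    MapInIdealAway T D δ fun v => f v • b := fun φ => by
  have := InIdealAway.mul_left (D := D) (IsPoly.const (φ b)).isRegularAway hf
  simpa only [map_smul, smul_eq_mul, mul_comm] using this

theorem MapInIdealAway.sub (hD : IsPoly K D) {x y : A → B} (hx : MapInIdealAway T D δ x)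
    (hy : MapInIdealAway T D δ y) : MapInIdealAway T D δ fun v => x v - y v := by
  have := hx.add hD (MapInIdealAway.smul (D := D) (IsPoly.const (-1 : K)).isRegularAway hy)
  simpa only [neg_smul, one_smul, ← sub_eq_add_neg] using this

theorem MapInIdealAway.sum (hD : IsPoly K D) {ι : Type*} (s : Finset ι) {x : ι → A → B}
    (hx : ∀ i ∈ s, MapInIdealAway T D δ (x i)) : MapInIdealAway T D δ fun v => ∑ i ∈ s, x i v :=
  fun φ => by
    simpa only [map_sum] using InIdealAway.sum hD s fun i hi => hx i hi φ

theorem MapInIdealAway.bilin (hD : IsPoly K D) [FiniteDimensional K B] [FiniteDimensional K C]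
    {E : Type*} [AddCommGroup E] [Module K E]
    (β : B →ₗ[K] C →ₗ[K] E) {x : A → B} {y : A → C} (hx : IsRegularMapAway D x)
    (hy : MapInIdealAway T D δ y) : MapInIdealAway T D δ fun v => β (x v) (y v) := by
  simp only [fun v => bilin_expand β (x v) (y v)]
  exact .sum hD _ fun i _ => .sum hD _ fun j _ => .smul_const (.mul_left (hx _) (hy _)) _

theorem MapInIdealAway.pi (hD : IsPoly K D) {ι : Type*} [Fintype ι] {x : A → ι → B}
    (hx : ∀ i, MapInIdealAway T D δ fun v => x v i) : MapInIdealAway T D δ x := by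
  classical
  intro φ
  have e : (fun v => φ (x v)) =
      fun v => ∑ i, (φ ∘ₗ LinearMap.single K (fun _ : ι => B) i) (x v i) := by
    ext v
    conv_lhs => rw [← Finset.univ_sum_single (x v), map_sum]
    rfl
  rw [e]
  exact .sum hD _ fun i _ => hx i _

/-- A polynomial takes, at two points whose difference has coordinates in the ideal, values whose
difference is in the ideal. -/
theorem InIdealAway.sub_comp (hD : IsPoly K D) {F : A → K} (hF : IsPoly K F) {x : A → A}
    (hx : IsRegularMapAway D x) (hd : MapInIdealAway T D δ fun v => v - x v) :
    InIdealAway T D δ fun v => F v - F (x v) := by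
  refine IsPoly.induction (p := fun F => InIdealAway T D δ fun v => F v - F (x v)) ?_ ?_ ?_ ?_ hF
  · intro φ
    simpa only [map_sub] using hd φ
  · intro c
    simpa using InIdealAway.zero
  · intro f g _ _ h h'
    exact (h.add hD h').congr fun v _ _ => by ring
  · intro f g hf hg h h'
    refine InIdealAway.congr (InIdealAway.add hD (InIdealAway.mul_left (D := D)
      hf.isRegularAway h') (InIdealAway.mul_left (IsPoly.isRegularAway_comp hD hg hx) h))
      fun v _ _ => ?_
    ring

end Regular

/-! ### The ideal of the double lines in the variety of determinantal nets -/

section Ideal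

open MvPolynomial

variable {K : Type*} [Field K] (z : Module.Basis (Fin 4) K (Form K 1))

theorem natDegree_liftLinear_le {φ : Form K 1 →ₗ[K] Polynomial K} (hφ : ∀ x, (φ x).natDegree ≤ 1)
    {d : ℕ} (f : Form K d) : (liftLinear φ (f : MvPolynomial (Fin 4) K)).natDegree ≤ d := by
  have h := MvPolynomial.aeval_natDegree_le (m := d) (n := 1) (f : MvPolynomial (Fin 4) K)
    (IsHomogeneous.totalDegree_le f.2) (fun i => φ ⟨X i, isHomogeneous_X K i⟩) fun i => hφ _
  rw [mul_one] at h
  exact h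

theorem lineHom_natDegree_le {d : ℕ} (f : Form K d) :
    (lineHom z (f : MvPolynomial (Fin 4) K)).natDegree ≤ d := by
  refine natDegree_liftLinear_le (fun x => ?_) f
  rw [Module.Basis.constr_apply_fintype, Fin.sum_univ_four]
  refine Polynomial.natDegree_add_le_of_degree_le (Polynomial.natDegree_add_le_of_degree_le
    (Polynomial.natDegree_add_le_of_degree_le ((Polynomial.natDegree_smul_le _ _).trans ?_)
      ((Polynomial.natDegree_smul_le _ _).trans ?_)) ((Polynomial.natDegree_smul_le _ _).trans ?_))
    ((Polynomial.natDegree_smul_le _ _).trans ?_)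
  · exact Polynomial.natDegree_one.le.trans zero_le_one
  · exact Polynomial.natDegree_X_le
  · exact Polynomial.natDegree_zero.le.trans zero_le_one
  · exact Polynomial.natDegree_zero.le.trans zero_le_one

theorem coeff_lineHom {d : ℕ} (k : ℕ) (f : Form K d) :
    (lineHom z (f : MvPolynomial (Fin 4) K)).coeff k = lineCoeff z k f := rfl

/-- The coefficients of `z₀², z₀z₁, z₁²` in the three quadrics of a frame. -/
noncomputable def lineMatrix (v : Fin 3 → Form K 2) : Matrix (Fin 3) (Fin 3) K :=
  Matrix.of fun i k => lineCoeff z k (v i)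

/-- The determinant of `lineMatrix`; the nets with a frame where it does not vanish are those which
restrict to the line `z₂ = z₃ = 0` as the system of all quadrics. -/
noncomputable def lineDet (v : Fin 3 → Form K 2) : K := (lineMatrix z v).det

/-- The frame whose restriction to the line is `lineDet • (z₀², z₀z₁, z₁²)`. -/
noncomputable def adjFrame (v : Fin 3 → Form K 2) : Fin 3 → Form K 2 :=
  act (lineMatrix z v).adjugate v

/-- The frame whose restriction to the line is `(z₀², z₀z₁, z₁²)`. -/
noncomputable def normFrame (v : Fin 3 → Form K 2) : Fin 3 → Form K 2 :=
  act (lineMatrix z v)⁻¹ v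

/-- The quartic `N₀N₂ - N₁²` for the normalized frame `N`, without its denominators.  Near the
double line `z₀ = z₁ = 0` its coefficients generate the ideal of the double lines.  It is
multiplied by `lineDet` once more than necessary, to make it vanish where `lineDet` does. -/
noncomputable def deltaForm (v : Fin 3 → Form K 2) : Form K 4 := lineDet z v • conic (adjFrame z v)

theorem isPoly_lineMatrix (i k : Fin 3) :
    IsPoly K fun v : Fin 3 → Form K 2 => lineMatrix z v i k := by
  have h : IsPoly K fun v : Fin 3 → Form K 2 =>
      ((lineCoeff z (k : ℕ) : Module.Dual K (Form K 2)) ∘ₗ LinearMap.proj i :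
        (Fin 3 → Form K 2) →ₗ[K] K) v := .linear _
  exact h

theorem isPoly_lineDet : IsPoly K (lineDet z) := .det fun i k => isPoly_lineMatrix z i k

theorem isPolyMap_adjFrame : IsPolyMap K (adjFrame z) := by
  refine .pi fun i => ?_
  simp only [adjFrame, act_apply]
  refine .sum _ fun j _ => .smul ?_ (IsPolyMap.id.apply j)
  simp only [Matrix.adjugate_apply]
  refine .det fun k l => ?_
  simp only [Matrix.updateRow_apply]
  split_ifs
  · exact .const _
  · exact isPoly_lineMatrix z k l

theorem isPolyMap_conic : IsPolyMap K (conic : (Fin 3 → Form K 2) → Form K 4) :=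
  .sub (.bilin _ (IsPolyMap.id.apply 0) (IsPolyMap.id.apply 2))
    (.bilin _ (IsPolyMap.id.apply 1) (IsPolyMap.id.apply 1))

theorem isPolyMap_deltaForm : IsPolyMap K (deltaForm z) :=
  .smul (isPoly_lineDet z) (isPolyMap_conic.comp (isPolyMap_adjFrame z))

theorem conic_smul (c : K) (N : Fin 3 → Form K 2) : conic (c • N) = c ^ 2 • conic N := by
  simp only [conic, Pi.smul_apply, map_smul, LinearMap.smul_apply, smul_smul, smul_sub, pow_two]

theorem lineHom_conic {N : Fin 3 → Form K 2} {c : K}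
    (h : ∀ i, lineHom z (N i : MvPolynomial (Fin 4) K) = c • Polynomial.X ^ (i : ℕ)) :
    lineHom z (conic N : MvPolynomial (Fin 4) K) = 0 := by
  simp only [conic, Submodule.coe_sub, coe_formMul, map_sub, map_mul, h, Fin.val_zero, Fin.val_one,
    Fin.val_two, pow_zero, pow_one, Polynomial.smul_eq_C_mul]
  ring

theorem lineHom_adjFrame (v : Fin 3 → Form K 2) (i : Fin 3) :
    lineHom z (adjFrame z v i : MvPolynomial (Fin 4) K) =
      lineDet z v • Polynomial.X ^ (i : ℕ) := by
  ext k
  rw [coeff_lineHom]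
  by_cases hk : k < 3
  · have h : lineCoeff z k (adjFrame z v i) =
        ((lineMatrix z v).adjugate * lineMatrix z v) i ⟨k, hk⟩ := by
      simp [adjFrame, Matrix.mul_apply, lineMatrix]
    rw [h, Matrix.adjugate_mul]
    simp [Polynomial.coeff_X_pow, Matrix.one_apply, lineDet, Fin.ext_iff, eq_comm]
  · rw [← coeff_lineHom, Polynomial.coeff_eq_zero_of_natDegree_lt
      ((lineHom_natDegree_le z _).trans_lt (by omega)), Polynomial.coeff_smul,
      Polynomial.coeff_X_pow, if_neg (by omega), smul_zero]

theorem lineHom_deltaForm (v : Fin 3 → Form K 2) :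
    lineHom z (deltaForm z v : MvPolynomial (Fin 4) K) = 0 := by
  rw [deltaForm, Submodule.coe_smul, map_smul, lineHom_conic z (lineHom_adjFrame z v), smul_zero]

variable {z} {v : Fin 3 → Form K 2}

theorem isUnit_lineMatrix_det (hD : lineDet z v ≠ 0) : IsUnit (lineMatrix z v).det :=
  isUnit_iff_ne_zero.2 hD

theorem adjFrame_eq (hD : lineDet z v ≠ 0) : adjFrame z v = lineDet z v • normFrame z v := by
  ext1 i
  rw [Pi.smul_apply, adjFrame, normFrame, act_apply, act_apply, Finset.smul_sum, Matrix.inv_def,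
    Ring.inverse_eq_inv']
  refine Finset.sum_congr rfl fun j _ => ?_
  rw [Matrix.smul_apply, smul_smul, smul_eq_mul, ← mul_assoc,
    show (lineMatrix z v).det = lineDet z v from rfl, mul_inv_cancel₀ hD, one_mul]

theorem act_normFrame (hD : lineDet z v ≠ 0) : act (lineMatrix z v) (normFrame z v) = v := by
  rw [normFrame, ← act_mul, Matrix.mul_nonsing_inv _ (isUnit_lineMatrix_det hD), act_one]

theorem isFrame_normFrame (hD : lineDet z v ≠ 0) {V : Gr K (Form K 2) 3}
    (hv : Framed.IsFrame v V) : Framed.IsFrame (normFrame z v) V :=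
  isFrame_act (Matrix.isUnit_nonsing_inv_det _ (isUnit_lineMatrix_det hD)) hv

theorem lineHom_normFrame (hD : lineDet z v ≠ 0) (i : Fin 3) :
    lineHom z (normFrame z v i : MvPolynomial (Fin 4) K) = Polynomial.X ^ (i : ℕ) := by
  have h := lineHom_adjFrame z v i
  rw [adjFrame_eq hD, Pi.smul_apply, Submodule.coe_smul, map_smul] at h
  exact smul_right_injective _ hD h

theorem deltaForm_eq (hD : lineDet z v ≠ 0) :
    deltaForm z v = lineDet z v ^ 3 • conic (normFrame z v) := by
  rw [deltaForm, adjFrame_eq hD, conic_smul, smul_smul]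
  congr 1
  ring

theorem isRegularMapAway_normFrame : IsRegularMapAway (lineDet z) (normFrame z) := by
  intro φ
  refine ⟨1, _, isPolyMap_adjFrame z φ, fun v hD => ?_⟩
  rw [adjFrame_eq hD, map_smul, pow_one, smul_eq_mul]

variable (z) in
/-- The coordinates of a frame over a determinantal net in normal form are regular. -/
theorem isRegularAway_normalCoord (i : Fin 6) (j : Fin 2) :
    IsRegularAway (lineDet z) fun v => normalCoord z (normFrame z v) i j := by
  have h : ∀ (k : ℕ) (l : Fin 3),
      IsRegularAway (lineDet z) fun v => normalCoeff z j k (normFrame z v l) :=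
    fun k l => isRegularMapAway_normFrame (normalCoeff z j k ∘ₗ LinearMap.proj l)
  have hD := isPoly_lineDet z
  have hm : ∀ {f : (Fin 3 → Form K 2) → K} (c : K), IsRegularAway (lineDet z) f →
      IsRegularAway (lineDet z) fun v => c * f v :=
    fun c hf => (IsPoly.const c).isRegularAway.mul hf
  fin_cases i
  · exact h 1 1
  · exact h 0 1
  · simpa [normalCoord] using hm (-1) (h 0 2)
  · simpa [normalCoord, sub_eq_add_neg] using (h 1 2).add hD (hm (-2) (h 0 1))
  · simpa [normalCoord, sub_eq_add_neg] using (h 0 0).add hD (hm (-2) (h 1 1))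
  · simpa [normalCoord] using hm (-1) (h 1 0)

theorem isRegularMapAway_conormal (i : Fin 6) : IsRegularMapAway (lineDet z) fun v =>
    conormal z (normalCoord z (normFrame z v) i) :=
  .add (isPoly_lineDet z)
    (.smul (isRegularAway_normalCoord z i 0) (IsPolyMap.const _).isRegularMapAway)
    (.smul (isRegularAway_normalCoord z i 1) (IsPolyMap.const _).isRegularMapAway)

variable (K) in
/-- The frames over the determinantal nets. -/
def detFrames : Set (Fin 3 → Form K 2) := {v | ∃ V ∈ detNets K, Framed.IsFrame v V}

theorem normFrame_eq_normalNet (hD : lineDet z v ≠ 0) (hv : v ∈ detFrames K) :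
    normFrame z v = normalNet z (normalCoord z (normFrame z v)) := by
  obtain ⟨V, ⟨m, hm⟩, hV⟩ := hv
  have hf := isFrame_normFrame hD hV
  obtain ⟨n, hn⟩ := exists_eq_normalNet z (linearIndependent_of_isFrame hf)
    ((isFrame_iff.1 hf).trans hm) (lineHom_normFrame hD)
  conv_rhs => rw [hn, normalCoord_normalNet]
  exact hn

/-- The four coordinates transversal to the double lines belong to the ideal generated by the
coefficients of `deltaForm`. -/
theorem inIdealAway_normalCoord (i : Fin 6) (hi : 2 ≤ i) (j : Fin 2) :
    InIdealAway (detFrames K) (lineDet z) (deltaForm z)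
      fun v => normalCoord z (normFrame z v) i j := by
  have h : ∀ (k : ℕ) (c : K), (∀ n, c * normalCoeff z j k (conic (normalNet z n)) = n i j) →
      InIdealAway (detFrames K) (lineDet z) (deltaForm z)
        fun v => normalCoord z (normFrame z v) i j := by
    intro k c hc
    refine ⟨3, fun _ => c • normalCoeff z j k, IsPolyMap.const _, fun v hv hD => ?_⟩
    dsimp only
    rw [deltaForm_eq hD, LinearMap.smul_apply, map_smul,
      ← hc (normalCoord z (normFrame z v)), ← normFrame_eq_normalNet hD hv, smul_eq_mul,
      smul_eq_mul]
    ring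
  fin_cases i
  · exact absurd hi (by decide)
  · exact absurd hi (by decide)
  · exact h 0 (-1) fun n => by rw [(normalCoeff_conic_normalNet z n j).1]; simp
  · exact h 1 1 fun n => by rw [(normalCoeff_conic_normalNet z n j).2.1]; simp
  · exact h 2 1 fun n => by rw [(normalCoeff_conic_normalNet z n j).2.2.1]; simp
  · exact h 3 (-1) fun n => by rw [(normalCoeff_conic_normalNet z n j).2.2.2]; simp

theorem mapInIdealAway_conormal (i : Fin 6) (hi : 2 ≤ i) :
    MapInIdealAway (detFrames K) (lineDet z) (deltaForm z) fun v =>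
      conormal z (normalCoord z (normFrame z v) i) :=
  .add (isPoly_lineDet z) (.smul_const (inIdealAway_normalCoord i hi 0) _)
    (.smul_const (inIdealAway_normalCoord i hi 1) _)

variable (z) in
/-- The frame of the double line with equations `p = q = 0`, where `p` and `q` are the linear forms
in the normal form of the frame `v`: the projection of `v` to the double lines. -/
noncomputable def lineProj (v : Fin 3 → Form K 2) : Fin 3 → Form K 2 :=
  act (lineMatrix z v) (doubleFrame (z 0 + conormal z (normalCoord z (normFrame z v) 0))
    (z 1 + conormal z (normalCoord z (normFrame z v) 1)))

theorem isRegularMapAway_lineProj : IsRegularMapAway (lineDet z) (lineProj z) := by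
  have hD := isPoly_lineDet z
  have hp : ∀ (y : Form K 1) (i : Fin 6), IsRegularMapAway (lineDet z) fun v =>
      y + conormal z (normalCoord z (normFrame z v) i) := fun y i =>
    .add hD (IsPolyMap.const _).isRegularMapAway (isRegularMapAway_conormal i)
  have hd : ∀ k : Fin 3, IsRegularMapAway (lineDet z) fun v =>
      doubleFrame (z 0 + conormal z (normalCoord z (normFrame z v) 0))
        (z 1 + conormal z (normalCoord z (normFrame z v) 1)) k := by
    intro k
    fin_cases k
    · exact .bilin hD lmul (hp _ _) (hp _ _)
    · exact .bilin hD lmul (hp _ _) (hp _ _)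
    · exact .bilin hD lmul (hp _ _) (hp _ _)
  refine .pi hD fun i => ?_
  simp only [lineProj, act_apply]
  exact .sum hD _ fun k _ => .smul (isPoly_lineMatrix z i k).isRegularAway (hd k)

/-- In normal form, each term of the difference of a frame and its projection has a factor among
the linear forms `wᵢ`. -/
theorem mapInIdealAway_sub_lineProj :
    MapInIdealAway (detFrames K) (lineDet z) (deltaForm z) fun v => v - lineProj z v := by
  have hD := isPoly_lineDet z
  have hr : ∀ (i : Fin 6) (y : Form K 1), IsRegularMapAway (lineDet z) fun v =>
      y + conormal z (normalCoord z (normFrame z v) i) := fun i y =>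
    .add hD (IsPolyMap.const _).isRegularMapAway (isRegularMapAway_conormal i)
  have hr' := fun i : Fin 6 => isRegularMapAway_conormal (z := z) i
  have hI := fun (i : Fin 6) (hi : 2 ≤ i) => mapInIdealAway_conormal (z := z) i hi
  have hd : ∀ k : Fin 3, MapInIdealAway (detFrames K) (lineDet z) (deltaForm z) fun v =>
      normFrame z v k - doubleFrame (z 0 + conormal z (normalCoord z (normFrame z v) 0))
        (z 1 + conormal z (normalCoord z (normFrame z v) 1)) k := by
    intro k
    fin_cases k
    · refine MapInIdealAway.congr (.sub hD (.bilin hD lmul (hr 0 (z 0)) (hI 4 (by decide)))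
        (.bilin hD lmul (.add hD (hr 1 (z 1)) (hr' 3)) (hI 5 (by decide)))) fun v hv hDv => ?_
      have e := normFrame_eq_normalNet hDv hv
      generalize normalCoord z (normFrame z v) = n at e ⊢
      rw [e]
      refine Subtype.ext ?_
      simp [normalNet, doubleFrame]
      ring
    · refine MapInIdealAway.congr (.smul (D := lineDet z) (IsPoly.const (-1 : K)).isRegularAway
        (.bilin hD lmul (hr' 2) (hI 5 (by decide)))) fun v hv hDv => ?_
      have e := normFrame_eq_normalNet hDv hv
      generalize normalCoord z (normFrame z v) = n at e ⊢
      rw [e]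
      refine Subtype.ext ?_
      simp [normalNet, doubleFrame]
      ring
    · refine MapInIdealAway.congr (.sub hD (.bilin hD lmul (hr 1 (z 1)) (hI 3 (by decide)))
        (.bilin hD lmul (.add hD (hr 0 (z 0)) (hr' 4)) (hI 2 (by decide)))) fun v hv hDv => ?_
      have e := normFrame_eq_normalNet hDv hv
      generalize normalCoord z (normFrame z v) = n at e ⊢
      rw [e]
      refine Subtype.ext ?_
      simp [normalNet, doubleFrame]
      ring
  refine .pi hD fun i => ?_
  refine MapInIdealAway.congr (.sum hD Finset.univ fun k _ =>
    .smul (isPoly_lineMatrix z i k).isRegularAway (hd k)) fun v hv hDv => ?_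
  have e := congrFun (act_normFrame hDv) i
  rw [act_apply] at e
  simp only [smul_sub, Finset.sum_sub_distrib, Pi.sub_apply, lineProj, act_apply, e]

theorem linearIndependent_of_lineHom {n d : ℕ} {w : Fin n → Form K d}
    (h : ∀ i, lineHom z (w i : MvPolynomial (Fin 4) K) = Polynomial.X ^ (i : ℕ)) :
    LinearIndependent K w := by
  refine Fintype.linearIndependent_iff.2 fun c hc i => ?_
  have := congrArg (lineCoeff z (i : ℕ)) hc
  simpa [← coeff_lineHom, h, Polynomial.coeff_X_pow, Fin.val_inj] using this

theorem exists_isFrame_doubleFrame {p q : Form K 1}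
    (hp : lineHom z (p : MvPolynomial (Fin 4) K) = 1)
    (hq : lineHom z (q : MvPolynomial (Fin 4) K) = Polynomial.X) :
    ∃ V ∈ doubleLines K, Framed.IsFrame (doubleFrame p q) V := by
  have hpq : LinearIndependent K ![p, q] := linearIndependent_of_lineHom (z := z) fun i => by
    fin_cases i <;> simp [hp, hq]
  have hd : LinearIndependent K (doubleFrame p q) := linearIndependent_of_lineHom (z := z)
    fun i => by fin_cases i <;> simp [doubleFrame, hp, hq, pow_two]
  refine ⟨spanPoint _ hd, ⟨spanPoint _ hpq, ?_⟩, isFrame_spanPoint _ hd⟩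
  rw [square_eq_span_doubleFrame (p := p) (q := q)]
  · rfl
  · simp [spanPoint, Set.pair_comm q p]

theorem span_lineProj_mem_doubleLines (hD : lineDet z v ≠ 0) :
    ∃ V ∈ doubleLines K, Framed.IsFrame (lineProj z v) V := by
  obtain ⟨V, hV, h⟩ := exists_isFrame_doubleFrame (z := z)
    (p := z 0 + conormal z (normalCoord z (normFrame z v) 0))
    (q := z 1 + conormal z (normalCoord z (normFrame z v) 1)) (by simp) (by simp)
  exact ⟨V, hV, isFrame_act (isUnit_lineMatrix_det hD) h⟩

variable (z) in
/-- The coefficients of `deltaForm` generate the ideal of the double lines in the variety of frames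
over the determinantal nets, where `lineDet` does not vanish. -/
theorem exists_eq_apply_deltaForm {f : (Fin 3 → Form K 2) → K} (hf : IsPoly K f)
    (h0 : VanishesOn K (doubleLines K) f) :
    ∃ (N : ℕ) (c : (Fin 3 → Form K 2) → Module.Dual K (Form K 4)), IsPolyMap K c ∧
      ∀ V ∈ detNets K, ∀ v : Fin 3 → Form K 2, Framed.IsFrame v V →
        lineDet z v ^ N * f v = c v (deltaForm z v) := by
  obtain ⟨N, c, hc, h⟩ := InIdealAway.sub_comp (isPoly_lineDet z) hf
    (isRegularMapAway_lineProj (z := z)) mapInIdealAway_sub_lineProj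
  refine ⟨N + 1, fun v => lineDet z v • c v, .smul (isPoly_lineDet z) hc, fun V hV v hv => ?_⟩
  by_cases hD : lineDet z v = 0
  · dsimp only
    rw [hD, zero_smul, LinearMap.zero_apply, pow_succ, mul_zero, zero_mul]
  · obtain ⟨W, hW, hWv⟩ := span_lineProj_mem_doubleLines hD
    have := h v ⟨V, hV, hv⟩ hD
    dsimp only at this ⊢
    rw [h0 W hW _ hWv, sub_zero] at this
    rw [LinearMap.smul_apply, ← this, smul_eq_mul]
    ring

/-- If the quartic were not zero, the normalized frame would have independent products. -/
theorem deltaForm_eq_zero {V : Gr K (Form K 2) 3} (hV : V ∈ doubleLines K)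
    (hv : Framed.IsFrame v V) : deltaForm z v = 0 := by
  by_cases hD : lineDet z v = 0
  · rw [deltaForm, hD, zero_smul]
  have hN := lineHom_normFrame hD
  have hf := isFrame_normFrame hD hv
  rw [deltaForm_eq hD]
  generalize normFrame z v = N at hN hf
  by_contra hne
  have hc : conic N ≠ 0 := right_ne_zero_of_smul hne
  refine not_linearIndependent_products_of_mem_doubleLines hV hf ?_
  refine Fintype.linearIndependent_iff.2 fun c h => ?_
  have hk : ∀ k, lineCoeff z k (∑ i, c i • products N i) = 0 := fun k => by rw [h, map_zero]
  simp only [Fin.sum_univ_six, map_add, map_smul, ← coeff_lineHom, products, Matrix.cons_val,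
    coe_formMul, map_mul, hN, Fin.val_zero, Fin.val_one, Fin.val_two, ← pow_add,
    Polynomial.coeff_X_pow] at hk
  have h0 := hk 0
  have h1 := hk 1
  have h2 := hk 2
  have h3 := hk 3
  have h4 := hk 4
  norm_num at h0 h1 h2 h3 h4
  have h5 : c 2 • conic N = 0 := by
    have : c 5 = - c 2 := by linear_combination h2
    rw [← h, Fin.sum_univ_six, h0, h1, h3, h4, this]
    simp [products, conic, sub_eq_add_neg]
  have h6 : c 2 = 0 := (smul_eq_zero.1 h5).resolve_right hc
  have h7 : c 5 = 0 := by linear_combination h2 - h6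
  intro i
  fin_cases i <;> assumption

end Ideal

/-! ### Minors adapted to a line -/

section LineMinors

open MvPolynomial

variable {K : Type*} [Field K] (z : Module.Basis (Fin 4) K (Form K 1))

/-- The five coefficients of the restriction of a quartic to the line `z₂ = z₃ = 0`, followed by
another linear form. -/
noncomputable def lineForms (ξ : Module.Dual K (Form K 4)) : Fin 6 → Module.Dual K (Form K 4) :=
  ![lineCoeff z 0, lineCoeff z 1, lineCoeff z 2, lineCoeff z 3, lineCoeff z 4, ξ]

theorem isPolyMap_lineForms {A : Type*} [AddCommGroup A] [Module K A]
    {c : A → Module.Dual K (Form K 4)} (hc : IsPolyMap K c) :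
    IsPolyMap K fun v => lineForms z (c v) := by
  refine .pi fun i => ?_
  fin_cases i
  · exact IsPolyMap.const _
  · exact IsPolyMap.const _
  · exact IsPolyMap.const _
  · exact IsPolyMap.const _
  · exact IsPolyMap.const _
  · exact hc

/-- The matrix of the minor is triangular. -/
theorem minor_lineForms (ξ : Module.Dual K (Form K 4)) {t : Fin 6 → Form K 4} {c : K}
    (h : ∀ i, i ≠ 5 → lineHom z (t i : MvPolynomial (Fin 4) K) = c • Polynomial.X ^ (i : ℕ))
    (h5 : lineHom z (t 5 : MvPolynomial (Fin 4) K) = 0) :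
    minor (lineForms z ξ) t = c ^ 5 * ξ (t 5) := by
  have hl : ∀ j : Fin 6, j ≠ 5 → lineForms z ξ j = lineCoeff z (j : ℕ) := fun j hj => by
    fin_cases j <;> first | rfl | exact absurd rfl hj
  have hij : ∀ i j : Fin 6, j ≠ 5 → i ≠ 5 →
      lineForms z ξ j (t i) = if j = i then c else 0 := fun i j hj hi => by
    rw [hl j hj, ← coeff_lineHom, h i hi, Polynomial.coeff_smul, Polynomial.coeff_X_pow]
    simp [Fin.ext_iff]
  have h5j : ∀ j : Fin 6, j ≠ 5 → lineForms z ξ j (t 5) = 0 := fun j hj => by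
    rw [hl j hj, ← coeff_lineHom, h5, Polynomial.coeff_zero]
  rw [minor, Matrix.det_of_isUpperTriangular]
  · simp only [Matrix.of_apply, Fin.prod_univ_six]
    rw [hij 0 0 (by decide) (by decide), hij 1 1 (by decide) (by decide),
      hij 2 2 (by decide) (by decide), hij 3 3 (by decide) (by decide),
      hij 4 4 (by decide) (by decide)]
    simp only [if_true, lineForms, Matrix.cons_val]
    ring
  · intro i j hji
    have hji : j < i := hji
    have hj : j ≠ 5 := fun e => by omega
    rw [Matrix.of_apply]
    by_cases hi : i = 5
    · rw [hi, h5j j hj]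
    · rw [hij i j hj hi, if_neg hji.ne]

/-- The products of three quadrics, the last one replaced by another quartic. -/
noncomputable def normalProducts (N : Fin 3 → Form K 2) (e : Form K 4) : Fin 6 → Form K 4 :=
  Function.update (products N) 5 e

theorem isPolyMap_normalProducts {A : Type*} [AddCommGroup A] [Module K A]
    {N : A → Fin 3 → Form K 2} {e : A → Form K 4} (hN : IsPolyMap K N) (he : IsPolyMap K e) :
    IsPolyMap K fun a => normalProducts (N a) (e a) := by
  refine .pi fun i => ?_
  simp only [normalProducts]
  by_cases hi : i = 5
  · subst hi
    simpa using he
  · simpa [Function.update_of_ne hi] using (isPolyMap_products.comp hN).apply i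

theorem normalProducts_last (N : Fin 3 → Form K 2) (e : Form K 4) : normalProducts N e 5 = e :=
  Function.update_self ..

variable {z}

theorem lineHom_products {N : Fin 3 → Form K 2} {c : K}
    (hN : ∀ i, lineHom z (N i : MvPolynomial (Fin 4) K) = c • Polynomial.X ^ (i : ℕ))
    {i : Fin 6} (hi : i ≠ 5) :
    lineHom z (products N i : MvPolynomial (Fin 4) K) = c ^ 2 • Polynomial.X ^ (i : ℕ) := by
  fin_cases i <;> first | exact absurd rfl hi | skip
  all_goals
    simp [products, hN, Polynomial.smul_eq_C_mul]
    try ring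

theorem minor_normalProducts (ξ : Module.Dual K (Form K 4)) {N : Fin 3 → Form K 2} {c : K}
    (hN : ∀ i, lineHom z (N i : MvPolynomial (Fin 4) K) = c • Polynomial.X ^ (i : ℕ))
    {e : Form K 4} (he : lineHom z (e : MvPolynomial (Fin 4) K) = 0) :
    minor (lineForms z ξ) (normalProducts N e) = c ^ 10 * ξ e := by
  rw [minor_lineForms z ξ (c := c ^ 2) (fun i hi => ?_) ?_, normalProducts_last]
  · ring
  · rw [normalProducts_last, he]
  · rw [normalProducts, Function.update_of_ne hi, lineHom_products hN hi]

theorem linearIndependent_normalProducts {N : Fin 3 → Form K 2} {c : K} (hc : c ≠ 0)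
    (hN : ∀ i, lineHom z (N i : MvPolynomial (Fin 4) K) = c • Polynomial.X ^ (i : ℕ))
    {e : Form K 4} (he : lineHom z (e : MvPolynomial (Fin 4) K) = 0) (he0 : e ≠ 0) :
    LinearIndependent K (normalProducts N e) := by
  by_contra h
  refine he0 ((Module.forall_dual_apply_eq_zero_iff K e).1 fun ξ => ?_)
  have := minor_eq_zero h (lineForms z ξ)
  rw [minor_normalProducts ξ hN he] at this
  exact (mul_eq_zero.1 this).resolve_left (pow_ne_zero _ hc)

theorem minor_products (ξ : Module.Dual K (Form K 4)) {N : Fin 3 → Form K 2} {c : K}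
    (hN : ∀ i, lineHom z (N i : MvPolynomial (Fin 4) K) = c • Polynomial.X ^ (i : ℕ)) :
    minor (lineForms z ξ) (products N) = - (c ^ 10 * ξ (conic N)) := by
  have h := minor_normalProducts ξ hN (e := - conic N) (by simp [lineHom_conic z hN])
  have e : products N = Function.update (normalProducts N (- conic N)) 5
      (normalProducts N (- conic N) 5 + (1 : K) • normalProducts N (- conic N) 2) := by
    rw [normalProducts_last, normalProducts, Function.update_idem, eq_comm,
      Function.update_eq_self_iff, Function.update_of_ne (by decide)]
    simp [products, conic]
  rw [e, minor_update _ (by decide), h, map_neg, mul_neg]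

/-- The coefficients of `deltaForm` are minors of the products, up to a factor. -/
theorem lineDet_mul_minor_products (ξ : Module.Dual K (Form K 4)) (v : Fin 3 → Form K 2) :
    lineDet z v * minor (lineForms z ξ) (products v) = - (lineDet z v ^ 2 * ξ (deltaForm z v)) := by
  by_cases hD : lineDet z v = 0
  · simp [hD]
  have h := minor_products ξ (lineHom_adjFrame z v)
  rw [adjFrame, minor_products_act, Matrix.det_adjugate, Fintype.card_fin,
    show (lineMatrix z v).det = lineDet z v from rfl, ← adjFrame] at h
  refine mul_left_cancel₀ (pow_ne_zero 7 hD) ?_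
  rw [deltaForm, map_smul, smul_eq_mul]
  linear_combination h

/-- A space of quartics of dimension `6` contains one which vanishes on the line `z₂ = z₃ = 0`. -/
theorem exists_lineHom_eq_zero (z : Module.Basis (Fin 4) K (Form K 1)) (Y : Gr K (Form K 4) 6) :
    ∃ e ∈ Y.1, e ≠ 0 ∧ lineHom z (e : MvPolynomial (Fin 4) K) = 0 := by
  have h := LinearMap.ker_ne_bot_of_finrank_lt (V := Y.1)
    (f := LinearMap.pi fun k : Fin 5 => lineCoeff z (k : ℕ) ∘ₗ Y.1.subtype)
    (by rw [Y.2, Module.finrank_fin_fun]; decide)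
  obtain ⟨e, he, he0⟩ := Submodule.exists_mem_ne_zero_of_ne_bot h
  refine ⟨e, e.2, fun h0 => he0 (Subtype.ext h0), ?_⟩
  ext k
  by_cases hk : k < 5
  · exact congrFun (LinearMap.mem_ker.1 he) ⟨k, hk⟩
  · rw [Polynomial.coeff_eq_zero_of_natDegree_lt ((lineHom_natDegree_le z _).trans_lt (by omega)),
      Polynomial.coeff_zero]

theorem exists_basis_fin_four {E : Type*} [AddCommGroup E] [Module K E]
    (hE : Module.finrank K E = 4) {w : Fin 2 → E} (hw : LinearIndependent K w) :
    ∃ b : Module.Basis (Fin 4) K E, b 0 = w 0 ∧ b 1 = w 1 := by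
  obtain ⟨M, hM⟩ := Submodule.exists_isCompl (Submodule.span K (Set.range w))
  have := FiniteDimensional.of_finrank_pos (K := K) (V := E) (by omega)
  have hM2 : Module.finrank K M = 2 := by
    have := Submodule.finrank_add_eq_of_isCompl hM
    rw [finrank_span_eq_card hw, Fintype.card_fin, hE] at this
    omega
  refine ⟨(((Module.Basis.span hw).prod (Module.finBasisOfFinrankEq K M hM2)).map
    (Submodule.prodEquivOfIsCompl _ M hM)).reindex finSumFinEquiv, ?_, ?_⟩
  · have : (finSumFinEquiv (m := 2) (n := 2)).symm 0 = Sum.inl 0 := rfl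
    rw [Module.Basis.reindex_apply, this]
    simp [Module.Basis.span_apply]
  · have : (finSumFinEquiv (m := 2) (n := 2)).symm 1 = Sum.inl 1 := rfl
    rw [Module.Basis.reindex_apply, this]
    simp [Module.Basis.span_apply]

/-- Every double line is `z₀ = z₁ = 0` for some coordinates `z`. -/
theorem exists_basis_of_mem_doubleLines {V : Gr K (Form K 2) 3} (hV : V ∈ doubleLines K) :
    ∃ z : Module.Basis (Fin 4) K (Form K 1), Framed.IsFrame (doubleFrame (z 0) (z 1)) V := by
  obtain ⟨L, hL⟩ := hV
  obtain ⟨w, hw⟩ := Framed.exists_frame L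
  obtain ⟨z, h0, h1⟩ := exists_basis_fin_four finrank_form_one (linearIndependent_of_isFrame hw)
  refine ⟨z, isFrame_iff.2 ?_⟩
  rw [hL, square_eq_span_doubleFrame]
  rw [h0, h1, ← isFrame_iff.1 hw]
  congr 1
  ext x
  simp [Fin.exists_fin_two, eq_comm]

theorem lineMatrix_act (g : Matrix (Fin 3) (Fin 3) K) (v : Fin 3 → Form K 2) :
    lineMatrix z (act g v) = g * lineMatrix z v := by
  ext i k
  simp [lineMatrix, Matrix.mul_apply]

theorem lineMatrix_eq_one {v : Fin 3 → Form K 2}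
    (h : ∀ i, lineHom z (v i : MvPolynomial (Fin 4) K) = Polynomial.X ^ (i : ℕ)) :
    lineMatrix z v = 1 := by
  ext i k
  simp [lineMatrix, ← coeff_lineHom, h, Polynomial.coeff_X_pow, Matrix.one_apply, Fin.ext_iff,
    eq_comm]

theorem lineHom_doubleFrame (i : Fin 3) :
    lineHom z (doubleFrame (z 0) (z 1) i : MvPolynomial (Fin 4) K) = Polynomial.X ^ (i : ℕ) := by
  fin_cases i <;> simp [doubleFrame, pow_two]

theorem lineDet_ne_zero {V : Gr K (Form K 2) 3} (hV : Framed.IsFrame (doubleFrame (z 0) (z 1)) V)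
    {a : Fin 3 → Form K 2} (ha : Framed.IsFrame a V) : lineDet z a ≠ 0 := by
  obtain ⟨g, hg, rfl⟩ := exists_act_eq_of_isFrame hV ha
  rw [lineDet, lineMatrix_act, lineMatrix_eq_one lineHom_doubleFrame, mul_one]
  exact hg.ne_zero

end LineMinors

/-! ### The map given by generators of the ideal sheaf, and the map `V ↦ V²` -/

section Lifts

open MvPolynomial

variable {K : Type*} [Field K]

section Local

variable {d r : ℕ} {F : Fin r → (Fin 3 → Form K 2) → K}

/-- Generators of the ideal sheaf express `deltaForm`, up to a unit. -/
theorem GenerateIdealSheaf.exists_smul_deltaForm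
    (hF : GenerateIdealSheaf K (detNets K) (doubleLines K) d F)
    (z : Module.Basis (Fin 4) K (Form K 1)) {V : Gr K (Form K 2) 3} (hV : V ∈ detNets K)
    {a : Fin 3 → Form K 2} (ha : Framed.IsFrame a V) :
    ∃ (u : (Fin 3 → Form K 2) → K) (C : Fin r → (Fin 3 → Form K 2) → Form K 4),
      IsPoly K u ∧ u a ≠ 0 ∧ (∀ j, IsPolyMap K (C j)) ∧
      ∀ W ∈ detNets K, ∀ v : Fin 3 → Form K 2, Framed.IsFrame v W →
        u v • deltaForm z v = ∑ j, F j v • C j v := by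
  classical
  let B := Module.finBasis K (Form K 4)
  choose u c hu hc hua h using fun i => hF.2.2 V hV a ha (fun v => B.coord i (deltaForm z v))
    (isPolyMap_deltaForm z (B.coord i))
    fun W hW b hb => by
      dsimp only
      rw [deltaForm_eq_zero hW hb, map_zero]
  refine ⟨fun v => ∏ i, u i v, fun j v => ∑ i, ((∏ l ∈ Finset.univ.erase i, u l v) * c i j v) • B i,
    .prod _ fun i _ => hu i, Finset.prod_ne_zero_iff.2 fun i _ => hua i,
    fun j => .sum _ fun i _ => .smul ((IsPoly.prod _ fun l _ => hu l).mul (hc i j)) (.const _),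
    fun W hW v hv => ?_⟩
  have h' : ∀ i, u i v * B.coord i (deltaForm z v) = ∑ j, c i j v * F j v :=
    fun i => sub_eq_zero.1 (h i W hW v hv)
  calc (∏ i, u i v) • deltaForm z v
      = ∑ i, ((∏ l ∈ Finset.univ.erase i, u l v) * (u i v * B.coord i (deltaForm z v))) • B i := by
        conv_lhs => rw [← B.sum_repr (deltaForm z v), Finset.smul_sum]
        refine Finset.sum_congr rfl fun i _ => ?_
        rw [smul_smul, ← Finset.mul_prod_erase Finset.univ (fun i => u i v) (Finset.mem_univ i),
          Module.Basis.coord_apply]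
        congr 1
        ring
    _ = ∑ i, ∑ j, F j v • ((∏ l ∈ Finset.univ.erase i, u l v) * c i j v) • B i := by
        refine Finset.sum_congr rfl fun i _ => ?_
        rw [h', Finset.mul_sum, Finset.sum_smul]
        refine Finset.sum_congr rfl fun j _ => ?_
        rw [smul_smul]
        congr 1
        ring
    _ = _ := by
        rw [Finset.sum_comm]
        simp only [Finset.smul_sum]

/-- Generators of the ideal sheaf are combinations of the coefficients of `deltaForm`, up to a
power of `lineDet`. -/
theorem GenerateIdealSheaf.exists_apply_deltaForm
    (hF : GenerateIdealSheaf K (detNets K) (doubleLines K) d F)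
    (z : Module.Basis (Fin 4) K (Form K 1)) :
    ∃ (N : ℕ) (c : Fin r → (Fin 3 → Form K 2) → Module.Dual K (Form K 4)),
      (∀ j, IsPolyMap K (c j)) ∧ ∀ W ∈ detNets K, ∀ v : Fin 3 → Form K 2, Framed.IsFrame v W →
        ∀ j, lineDet z v ^ N * F j v = c j v (deltaForm z v) := by
  choose N c hc h using fun j => exists_eq_apply_deltaForm z (hF.1 j).1 (hF.2.1 j)
  refine ⟨Finset.univ.sup N, fun j v => lineDet z v ^ (Finset.univ.sup N - N j) • c j v,
    fun j => .smul ((isPoly_lineDet z).pow _) (hc j), fun W hW v hv j => ?_⟩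
  dsimp only
  rw [LinearMap.smul_apply, ← h j W hW v hv, smul_eq_mul, ← mul_assoc, ← pow_add,
    Nat.sub_add_cancel (Finset.le_sup (Finset.mem_univ j))]

theorem linearIndependent_fin_one {E : Type*} [AddCommGroup E] [Module K E] {x : E} (hx : x ≠ 0) :
    LinearIndependent K fun _ : Fin 1 => x :=
  .of_subsingleton 0 hx

variable [IsAlgClosed K] [CharZero K]

/-- Outside `𝔾` some generator does not vanish. -/
theorem GenerateIdealSheaf.ne_zero (hF : GenerateIdealSheaf K (detNets K) (doubleLines K) d F)
    {V : Gr K (Form K 2) 3} (hV : V ∈ detNets K \ doubleLines K) {a : Fin 3 → Form K 2}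
    (ha : Framed.IsFrame a V) : (fun i => F i a) ≠ 0 := by
  obtain ⟨φ, hφ⟩ := exists_minor_ne_zero (linearIndependent_products hV.2 ha)
  obtain ⟨u, c, -, -, hua, h⟩ := hF.2.2 V hV.1 a ha (fun v => minor φ (products v))
    (.minor (.const φ) isPolyMap_products) fun W hW b hb =>
      minor_eq_zero (not_linearIndependent_products_of_mem_doubleLines hW hb) φ
  intro h0
  have := h V hV.1 a ha
  simp only [fun i => show F i a = 0 from congrFun h0 i, mul_zero, Finset.sum_const_zero,
    sub_zero] at this
  exact mul_ne_zero hua hφ this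

/-- The map `V ↦ [F₀ : … : F_{r-1}]` outside `𝔾`. -/
noncomputable def generatorMap (hF : GenerateIdealSheaf K (detNets K) (doubleLines K) d F)
    (V : ↥(detNets K \ doubleLines K)) : Gr K (Fin r → K) 1 :=
  spanPoint (fun _ i => F i (Framed.exists_frame (V : Gr K (Form K 2) 3)).choose)
    (linearIndependent_fin_one (hF.ne_zero V.2 (Framed.exists_frame V.1).choose_spec))

theorem isFrame_generatorMap (hF : GenerateIdealSheaf K (detNets K) (doubleLines K) d F)
    (V : ↥(detNets K \ doubleLines K)) {b : Fin 3 → Form K 2} (hb : Framed.IsFrame b V.1) :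
    Framed.IsFrame (fun (_ : Fin 1) i => F i b) (generatorMap hF V) := by
  have ha := (Framed.exists_frame V.1).choose_spec
  obtain ⟨g, hg, e⟩ := exists_act_eq_of_isFrame hb ha
  rw [isFrame_iff]
  refine span_eq_of_mem (linearIndependent_fin_one (hF.ne_zero V.2 hb))
    (linearIndependent_fin_one (hF.ne_zero V.2 ha)) fun i => ?_
  have h : (fun i => F i (Framed.exists_frame V.1).choose) = g.det ^ d • fun i => F i b := by
    ext i
    rw [← e, show act g b = fun i => ∑ j, g i j • b j from funext (act_apply g b), (hF.1 i).2]
    rfl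
  rw [h]
  exact Submodule.smul_mem _ _ (Submodule.subset_span ⟨0, rfl⟩)

theorem blowUpGraph_eq (hF : GenerateIdealSheaf K (detNets K) (doubleLines K) d F) :
    blowUpGraph K (detNets K) (doubleLines K) F = graphOn (generatorMap hF) := by
  have hr : ∀ x : Fin r → K, Set.range (fun _ : Fin 1 => x) = {x} := fun x => Set.range_const
  ext p
  constructor
  · rintro ⟨hp, h⟩
    refine ⟨⟨p.1, hp⟩, Prod.ext rfl (Subtype.ext ?_)⟩
    obtain ⟨a, ha⟩ := Framed.exists_frame p.1
    rw [h a ha, ← isFrame_iff.1 (isFrame_generatorMap hF ⟨p.1, hp⟩ ha), hr]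
  · rintro ⟨V, rfl⟩
    exact ⟨V.2, fun a ha => by rw [← isFrame_iff.1 (isFrame_generatorMap hF V ha), hr]⟩

theorem blowUp_eq (hF : GenerateIdealSheaf K (detNets K) (doubleLines K) d F) :
    blowUp K (detNets K) (doubleLines K) F = closureOver (detNets K) (generatorMap hF) := by
  rw [blowUp, closureOver, blowUpGraph_eq hF]

theorem isMorphism_generatorMap (hF : GenerateIdealSheaf K (detNets K) (doubleLines K) d F) :
    IsMorphism K (generatorMap hF) := fun V _ ha =>
  ⟨fun b _ i => F i b, .pi fun _ => .pi fun i => (hF.1 i).1.isPolyMap, isFrame_generatorMap hF V ha,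
    fun W _ hb _ hq => Framed.eq_of_isFrame _ _ _ hq (isFrame_generatorMap hF W hb)⟩

variable (K) in
/-- The map `V ↦ V²` outside `𝔾`. -/
noncomputable def squareMap (V : ↥(detNets K \ doubleLines K)) : Gr K (Form K 4) 6 :=
  ⟨square V.1.1, by
    obtain ⟨a, ha⟩ := Framed.exists_frame V.1
    rw [show (square V.1.1 : Submodule K (Form K 4)) = _ from
      square_eq_span_products (isFrame_iff.1 ha)]
    rw [finrank_span_eq_card (linearIndependent_products V.2.2 ha), Fintype.card_fin]⟩

theorem isFrame_squareMap (V : ↥(detNets K \ doubleLines K)) {b : Fin 3 → Form K 2}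
    (hb : Framed.IsFrame b V.1) : Framed.IsFrame (products b) (squareMap K V) :=
  isFrame_iff.2 (square_eq_span_products (isFrame_iff.1 hb)).symm

theorem isMorphism_squareMap : IsMorphism K (squareMap K) := fun V _ ha =>
  ⟨products, isPolyMap_products, isFrame_squareMap V ha,
    fun W _ hb _ hq => Framed.eq_of_isFrame _ _ _ hq (isFrame_squareMap W hb)⟩

end Local

end Lifts

/-! ### The local extensions at the double lines -/

section Extend

open MvPolynomial

variable {K : Type*} [Field K] [IsAlgClosed K] [CharZero K] {d r : ℕ}
  {F : Fin r → (Fin 3 → Form K 2) → K}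

/-- The frames of the points of the graph of `generatorMap`. -/
theorem exists_eq_smul_of_isFrame (hF : GenerateIdealSheaf K (detNets K) (doubleLines K) d F)
    {x : ↥(detNets K \ doubleLines K)} {b : (Fin 3 → Form K 2) × (Fin 1 → Fin r → K)}
    (hb : Framed.IsFrame b (x.1, generatorMap hF x)) : ∃ l : K, ∀ j, b.2 0 j = l * F j b.1 := by
  have h : b.2 0 ∈ Submodule.span K (Set.range fun (_ : Fin 1) i => F i b.1) := by
    rw [isFrame_iff.1 (isFrame_generatorMap hF x hb.1), ← isFrame_iff.1 hb.2]
    exact Submodule.subset_span ⟨0, rfl⟩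
  rw [Set.range_const, Submodule.mem_span_singleton] at h
  obtain ⟨l, hl⟩ := h
  exact ⟨l, fun j => by rw [← hl]; rfl⟩

/-- Near a point `(V, y)` of the exceptional divisor, `V'²` is spanned by the products of the
normalized frame of `V'`, where the last product is replaced by the multiple of `N₀N₂ - N₁²` which
is given by `y` and the generators. -/
theorem locallyExtends_squareMap (hF : GenerateIdealSheaf K (detNets K) (doubleLines K) d F) :
    LocallyExtends (detNets K) (generatorMap hF) (squareMap K) := by
  refine .of_isMorphism isMorphism_squareMap fun p hp hS a ha => ?_
  have hV : p.1 ∈ doubleLines K := by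
    by_contra h
    exact hS ⟨hp.1.1, h⟩
  obtain ⟨z, hz⟩ := exists_basis_of_mem_doubleLines hV
  have hD := lineDet_ne_zero hz ha.1
  obtain ⟨u, C, hu, hua, hC, huC⟩ := hF.exists_smul_deltaForm z hp.1.1 ha.1
  obtain ⟨N, c, hc, hcF⟩ := hF.exists_apply_deltaForm z
  let e : (Fin 3 → Form K 2) × (Fin 1 → Fin r → K) → Form K 4 := fun b => ∑ j, b.2 0 j • C j b.1
  have hbj : ∀ j, IsPoly K fun b : (Fin 3 → Form K 2) × (Fin 1 → Fin r → K) => b.2 0 j :=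
    fun j => ((IsPolyMap.snd.apply 0).apply j).isPoly
  have he : IsPolyMap K e := .sum _ fun j _ => .smul (hbj j) ((hC j).comp .fst)
  -- on the graph, `e` is a multiple of `deltaForm`
  have heq : ∀ (x : ↥(detNets K \ doubleLines K)) b, Framed.IsFrame b (x.1, generatorMap hF x) →
      ∃ l : K, (∀ j, b.2 0 j = l * F j b.1) ∧ e b = (l * u b.1) • deltaForm z b.1 := by
    intro x b hb
    obtain ⟨l, hl⟩ := exists_eq_smul_of_isFrame hF hb
    refine ⟨l, hl, ?_⟩
    rw [mul_smul, huC x.1 x.2.1 b.1 hb.1, Finset.smul_sum]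
    exact Finset.sum_congr rfl fun j _ => by rw [hl, mul_smul]
  have hline : lineHom z (e a : MvPolynomial (Fin 4) K) = 0 := by
    ext k
    rw [coeff_lineHom, Polynomial.coeff_zero]
    refine eq_zero_of_mem_zariskiClosure (h := fun b => lineCoeff z k (e b)) (he _) ?_ hp.2 ha
    rintro _ ⟨x, rfl⟩ b hb
    obtain ⟨l, -, h⟩ := heq x b hb
    rw [h, map_smul, ← coeff_lineHom, lineHom_deltaForm, Polynomial.coeff_zero, smul_zero]
  have hne : e a ≠ 0 := by
    intro h0
    have hb0 : a.2 0 ≠ 0 := (linearIndependent_of_isFrame ha.2).ne_zero 0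
    refine hb0 (funext fun j => ?_)
    have h : u a.1 * lineDet z a.1 ^ N * a.2 0 j - c j a.1 (e a) = 0 := by
      refine eq_zero_of_mem_zariskiClosure
        (h := fun b : (Fin 3 → Form K 2) × (Fin 1 → Fin r → K) =>
          u b.1 * lineDet z b.1 ^ N * b.2 0 j - c j b.1 (e b)) ?_ ?_ hp.2 ha
      · refine .sub (.mul (.mul (hu.comp .fst) (((isPoly_lineDet z).pow N).comp .fst)) (hbj j)) ?_
        have : IsPolyMap K fun b : (Fin 3 → Form K 2) × (Fin 1 → Fin r → K) =>
            (LinearMap.id : Module.Dual K (Form K 4) →ₗ[K] Module.Dual K (Form K 4)) (c j b.1)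
              (e b) := .bilin _ ((hc j).comp .fst) he
        exact this.isPoly
      · rintro _ ⟨x, rfl⟩ b hb
        obtain ⟨l, hl, h⟩ := heq x b hb
        rw [h, map_smul, ← hcF x.1 x.2.1 b.1 hb.1 j, hl, smul_eq_mul]
        ring
    rw [h0, map_zero, sub_zero] at h
    exact (mul_eq_zero.1 h).resolve_left (mul_ne_zero hua (pow_ne_zero _ hD))
  refine ⟨fun b => normalProducts (adjFrame z b.1) (e b), ⟨isPolyMap_normalProducts
    ((isPolyMap_adjFrame z).comp .fst) he, fun x b hb hi => ?_⟩,
    linearIndependent_normalProducts hD (lineHom_adjFrame z a.1) hline hne⟩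
  rw [← isFrame_iff.1 (isFrame_squareMap x hb.1)]
  refine (span_eq_of_mem (linearIndependent_products x.2.2 hb.1) hi fun i => ?_).symm
  have hmem : ∀ k, adjFrame z b.1 k ∈ Submodule.span K (Set.range b.1) :=
    fun k => span_act_le _ _ (Submodule.subset_span ⟨k, rfl⟩)
  dsimp only
  by_cases hi5 : i = 5
  · obtain ⟨l, -, h⟩ := heq x b hb
    rw [hi5, normalProducts_last, h, deltaForm]
    exact Submodule.smul_mem _ _ (Submodule.smul_mem _ _ (sub_mem
      (qmul_mem_span_products_of_mem _ (hmem _) (hmem _))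
      (qmul_mem_span_products_of_mem _ (hmem _) (hmem _))))
  · rw [normalProducts, Function.update_of_ne hi5, ← square_eq_span_products rfl]
    exact products_mem_square hmem i

theorem square_le_of_mem_zariskiClosure {p : Gr K (Form K 2) 3 × Gr K (Form K 4) 6}
    (hp : p ∈ zariskiClosure K (graphOn (squareMap K))) : square p.1.1 ≤ p.2.1 := by
  obtain ⟨a, ha⟩ := Framed.exists_frame p
  rw [square_eq_span_products (isFrame_iff.1 ha.1), ← isFrame_iff.1 ha.2, Submodule.span_le]
  rintro _ ⟨i, rfl⟩
  refine mem_span_of_mem_zariskiClosure (g := fun b => b.2) (x := fun b => products b.1 i) .snd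
    ((isPolyMap_products.comp .fst).apply i) ?_ hp ha (linearIndependent_of_isFrame ha.2)
  rintro _ ⟨x, rfl⟩ b hb -
  rw [isFrame_iff.1 hb.2, ← isFrame_iff.1 (isFrame_squareMap x hb.1)]
  exact Submodule.subset_span ⟨i, rfl⟩

/-- Near a point `(V, Y)` over a double line, the values of the generators are proportional to
minors of `Y`. -/
theorem locallyExtends_generatorMap
    (hF : GenerateIdealSheaf K (detNets K) (doubleLines K) d F) :
    LocallyExtends (detNets K) (squareMap K) (generatorMap hF) := by
  refine .of_isMorphism (isMorphism_generatorMap hF) fun p hp hS a ha => ?_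
  have hV : p.1 ∈ doubleLines K := by
    by_contra h
    exact hS ⟨hp.1.1, h⟩
  obtain ⟨z, hz⟩ := exists_basis_of_mem_doubleLines hV
  have hD := lineDet_ne_zero hz ha.1
  obtain ⟨u, C, hu, hua, hC, huC⟩ := hF.exists_smul_deltaForm z hp.1.1 ha.1
  obtain ⟨N, c, hc, hcF⟩ := hF.exists_apply_deltaForm z
  have hm : ∀ ξ : (Fin 3 → Form K 2) × (Fin 6 → Form K 4) → Module.Dual K (Form K 4),
      IsPolyMap K ξ → IsPoly K fun b : (Fin 3 → Form K 2) × (Fin 6 → Form K 4) =>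
        lineDet z b.1 * minor (lineForms z (ξ b)) b.2 := fun ξ hξ =>
    .mul ((isPoly_lineDet z).comp .fst) (.minor (isPolyMap_lineForms z hξ) .snd)
  -- on the graph, the minors are values at `deltaForm`, up to a common factor
  have heq : ∀ (x : ↥(detNets K \ doubleLines K)) b, Framed.IsFrame b (x.1, squareMap K x) →
      ∃ l : K, ∀ ξ, lineDet z b.1 * minor (lineForms z ξ) b.2 =
        l * lineDet z b.1 ^ 2 * ξ (deltaForm z b.1) := by
    intro x b hb
    obtain ⟨g, -, e⟩ := exists_act_eq_of_isFrame (isFrame_squareMap x hb.1) hb.2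
    refine ⟨- g.det, fun ξ => ?_⟩
    rw [← e, minor_act]
    linear_combination g.det * lineDet_mul_minor_products ξ b.1
  let y : (Fin 3 → Form K 2) × (Fin 6 → Form K 4) → Fin 1 → Fin r → K :=
    fun b _ j => lineDet z b.1 * minor (lineForms z (c j b.1)) b.2
  have hy : IsPolyMap K y := .pi fun _ => .pi fun j => (hm _ ((hc j).comp .fst)).isPolyMap
  refine ⟨y, ⟨hy, fun x b hb hi => ?_⟩, linearIndependent_fin_one fun h0 => ?_⟩
  · rw [← isFrame_iff.1 (isFrame_generatorMap hF x hb.1)]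
    refine (span_eq_of_mem (linearIndependent_fin_one (hF.ne_zero x.2 hb.1)) hi fun i => ?_).symm
    obtain ⟨l, hl⟩ := heq x b hb
    have h : y b i = (l * lineDet z b.1 ^ 2 * lineDet z b.1 ^ N) • fun j => F j b.1 := by
      ext j
      simp only [y, Pi.smul_apply, smul_eq_mul]
      rw [hl, ← hcF x.1 x.2.1 b.1 hb.1 j]
      ring
    rw [h]
    exact Submodule.smul_mem _ _ (Submodule.subset_span ⟨0, rfl⟩)
  · obtain ⟨t, ht, ht0, htl⟩ := exists_lineHom_eq_zero z p.2
    have hN := lineHom_adjFrame z a.1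
    have hi := linearIndependent_normalProducts hD hN htl ht0
    have ha2 := linearIndependent_of_isFrame ha.2
    have hsub : ∀ i, normalProducts (adjFrame z a.1) t i ∈ Submodule.span K (Set.range a.2) := by
      intro i
      rw [isFrame_iff.1 ha.2]
      by_cases hi5 : i = 5
      · rw [hi5, normalProducts_last]
        exact ht
      · rw [normalProducts, Function.update_of_ne hi5]
        refine square_le_of_mem_zariskiClosure hp.2 (products_mem_square (fun k => ?_) i)
        rw [← isFrame_iff.1 ha.1]
        exact span_act_le _ _ (Submodule.subset_span ⟨k, rfl⟩)
    obtain ⟨g, hg, e⟩ := exists_act_eq (v := normalProducts (adjFrame z a.1) t) ha2 fun i => by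
      rw [← span_eq_of_mem ha2 hi hsub]
      exact Submodule.subset_span ⟨i, rfl⟩
    refine ht0 ((Module.forall_dual_apply_eq_zero_iff K t).1 fun ξ => ?_)
    have h : u a.1 * lineDet z a.1 ^ N * (lineDet z a.1 * minor (lineForms z ξ) a.2) -
        ∑ j, lineDet z a.1 * minor (lineForms z (c j a.1)) a.2 * ξ (C j a.1) = 0 := by
      refine eq_zero_of_mem_zariskiClosure (h := fun b : (Fin 3 → Form K 2) × (Fin 6 → Form K 4) =>
        u b.1 * lineDet z b.1 ^ N * (lineDet z b.1 * minor (lineForms z ξ) b.2) -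
          ∑ j, lineDet z b.1 * minor (lineForms z (c j b.1)) b.2 * ξ (C j b.1)) ?_ ?_ hp.2 ha
      · exact .sub (.mul (.mul (hu.comp .fst) (((isPoly_lineDet z).pow N).comp .fst))
          (hm _ (.const ξ))) (.sum _ fun j _ => .mul (hm _ ((hc j).comp .fst))
            ((hC j).comp .fst ξ))
      · rintro _ ⟨x, rfl⟩ b hb
        obtain ⟨l, hl⟩ := heq x b hb
        have hξ := congrArg ξ (huC x.1 x.2.1 b.1 hb.1)
        simp only [map_smul, map_sum, smul_eq_mul] at hξ
        simp only [hl]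
        simp only [← hcF x.1 x.2.1 b.1 hb.1]
        calc _ = l * lineDet z b.1 ^ 2 * lineDet z b.1 ^ N * (u b.1 * ξ (deltaForm z b.1) -
              ∑ j, F j b.1 * ξ (C j b.1)) := by
              rw [mul_sub, Finset.mul_sum]
              congr 1
              · ring
              · exact Finset.sum_congr rfl fun j _ => by ring
          _ = 0 := by rw [hξ, sub_self, mul_zero]
    have h0' : ∀ j, lineDet z a.1 * minor (lineForms z (c j a.1)) a.2 = 0 := fun j => congrFun h0 j
    simp only [h0', zero_mul, Finset.sum_const_zero, sub_zero] at h
    rw [← e, minor_act, minor_normalProducts ξ hN htl] at h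
    simpa [hua, hD, hg.ne_zero] using h

end Extend

/-! ### Generators of the ideal of the double lines -/

section Generators

open MvPolynomial

variable {K : Type*} [Field K]

/-- A minor is multilinear in the linear forms, hence a combination of those given by the
coordinates with respect to a basis. -/
theorem minor_expand {E ι : Type*} [AddCommGroup E] [Module K E] [Fintype ι] {k : ℕ}
    (b : Module.Basis ι K E) (φ : Fin k → Module.Dual K E) (t : Fin k → E) :
    minor φ t = ∑ σ : Fin k → ι, (∏ j, φ j (b (σ j))) * minor (fun j => b.coord (σ j)) t := by
  let L : Module.Dual K E →ₗ[K] (Fin k → K) := LinearMap.pi fun i => Module.Dual.eval K E (t i)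
  let M : MultilinearMap K (fun _ : Fin k => Module.Dual K E) K :=
    (Matrix.detRowAlternating (n := Fin k) (R := K)).toMultilinearMap.compLinearMap fun _ => L
  have hM : ∀ ψ : Fin k → Module.Dual K E, minor ψ t = M ψ := fun ψ => by
    rw [minor, ← Matrix.det_transpose]
    rfl
  have hφ : φ = fun j => ∑ i, φ j (b i) • b.coord i := by
    ext1 j
    refine b.ext fun i => ?_
    classical
    simp
  rw [hM]
  conv_lhs => rw [hφ, MultilinearMap.map_sum]
  refine Finset.sum_congr rfl fun σ _ => ?_
  rw [MultilinearMap.map_smul_univ, hM, smul_eq_mul]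

variable (K) in
/-- The `6 × 6` minors of the products of three quadrics, in coordinates. -/
noncomputable def productMinor (σ : Fin 6 → Fin (Module.finrank K (Form K 4)))
    (v : Fin 3 → Form K 2) : K :=
  minor (fun j => (Module.finBasis K (Form K 4)).coord (σ j)) (products v)

theorem isSection_productMinor (σ : Fin 6 → Fin (Module.finrank K (Form K 4))) :
    IsSection K 4 (productMinor K σ) :=
  ⟨.minor (.const _) isPolyMap_products, fun g v => by
    rw [show (fun i => ∑ j, g i j • v j) = act g v from funext fun i => (act_apply g v i).symm]
    exact minor_products_act _ g v⟩

variable [IsAlgClosed K] [CharZero K]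

/-- The `6 × 6` minors of the products generate the ideal sheaf of the double lines. -/
theorem generateIdealSheaf_productMinor {r : ℕ}
    (e : Fin r ≃ (Fin 6 → Fin (Module.finrank K (Form K 4)))) :
    GenerateIdealSheaf K (detNets K) (doubleLines K) 4 fun i => productMinor K (e i) := by
  have hexp : ∀ (φ : Fin 6 → Module.Dual K (Form K 4)) (v : Fin 3 → Form K 2),
      minor φ (products v) =
        ∑ i, (∏ j, φ j (Module.finBasis K (Form K 4) (e i j))) * productMinor K (e i) v :=
    fun φ v => (minor_expand (Module.finBasis K (Form K 4)) φ (products v)).trans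
      (e.sum_comp fun σ => (∏ j, φ j (Module.finBasis K (Form K 4) (σ j))) *
        productMinor K σ v).symm
  refine ⟨fun i => isSection_productMinor (e i), fun i W hW b hb => minor_eq_zero
    (not_linearIndependent_products_of_mem_doubleLines hW hb) _, fun V hV a ha f hf hf0 => ?_⟩
  by_cases hVG : V ∈ doubleLines K
  · obtain ⟨z, hz⟩ := exists_basis_of_mem_doubleLines hVG
    have hD := lineDet_ne_zero hz ha
    obtain ⟨N, c, hc, h⟩ := exists_eq_apply_deltaForm z hf hf0
    refine ⟨fun v => lineDet z v ^ (N + 2), fun i v => (-1) * (lineDet z v *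
      ∏ j, lineForms z (c v) j (Module.finBasis K (Form K 4) (e i j))), ?_, fun i => ?_, ?_,
      fun W hW v hv => ?_⟩
    · exact (isPoly_lineDet z).pow _
    · refine .mul (.const _) (.mul (isPoly_lineDet z) (.prod _ fun j _ => ?_))
      exact ((isPolyMap_lineForms z hc).apply j).linear_comp
        (Module.Dual.eval K (Form K 4) _) |>.isPoly
    · exact pow_ne_zero _ hD
    · have h1 := lineDet_mul_minor_products (z := z) (c v) v
      rw [hexp] at h1
      have h2 : ∑ i, (-1) * (lineDet z v *
          ∏ j, lineForms z (c v) j (Module.finBasis K (Form K 4) (e i j))) *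
            productMinor K (e i) v =
          lineDet z v ^ 2 * c v (deltaForm z v) := by
        rw [← neg_neg (lineDet z v ^ 2 * _), ← h1, Finset.mul_sum, ← Finset.sum_neg_distrib]
        exact Finset.sum_congr rfl fun i _ => by ring
      dsimp only
      rw [h2, ← h W hW v hv]
      ring
  · -- some minor does not vanish at the point
    obtain ⟨φ, hφ⟩ := exists_minor_ne_zero (linearIndependent_products hVG ha)
    obtain ⟨i, hi⟩ : ∃ i, productMinor K (e i) a ≠ 0 := by
      by_contra! h0
      rw [hexp] at hφ
      exact hφ (Finset.sum_eq_zero fun i _ => by rw [h0 i, mul_zero])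
    refine ⟨productMinor K (e i), fun j v => if j = i then f v else 0,
      (isSection_productMinor (e i)).1, fun j => ?_, hi, fun W _ v _ => ?_⟩
    · dsimp only
      split_ifs
      · exact hf
      · exact .const 0
    · simp [mul_comm]

end Generators

/-! ### Density of the complement of the double lines -/

section Density

open MvPolynomial

variable {K : Type*} [Field K]

theorem IsPoly.exists_eval {f : K → K} (hf : IsPoly K f) :
    ∃ P : Polynomial K, ∀ t, f t = P.eval t := by
  refine IsPoly.induction (p := fun f => ∃ P : Polynomial K, ∀ t, f t = P.eval t) ?_ ?_ ?_ ?_ hf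
  · intro φ
    refine ⟨Polynomial.X * Polynomial.C (φ 1), fun t => ?_⟩
    rw [Polynomial.eval_mul, Polynomial.eval_X, Polynomial.eval_C, ← smul_eq_mul, ← map_smul,
      smul_eq_mul, mul_one]
  · exact fun c => ⟨Polynomial.C c, fun t => Polynomial.eval_C.symm⟩
  · rintro f g - - ⟨P, hP⟩ ⟨Q, hQ⟩
    exact ⟨P + Q, fun t => by dsimp only; rw [Polynomial.eval_add, hP, hQ]⟩
  · rintro f g - - ⟨P, hP⟩ ⟨Q, hQ⟩
    exact ⟨P * Q, fun t => by dsimp only; rw [Polynomial.eval_mul, hP, hQ]⟩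

/-- A polynomial function on the affine line which vanishes outside `0` vanishes at `0`. -/
theorem IsPoly.eq_zero_of_forall_ne [Infinite K] {f : K → K} (hf : IsPoly K f)
    (h : ∀ t, t ≠ 0 → f t = 0) : f 0 = 0 := by
  obtain ⟨P, hP⟩ := hf.exists_eval
  have : P = 0 := by
    refine Polynomial.eq_zero_of_infinite_isRoot P
      ((Set.finite_singleton (0 : K)).infinite_compl.mono fun t ht => ?_)
    rw [Set.mem_ofPred_eq, Polynomial.IsRoot, ← hP, h t ht]
  rw [hP, this, Polynomial.eval_zero]

/-- A family of nets with the double line `z₀ = z₁ = 0` at `t = 0`: the minors of the matrix with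
rows `(z₀, 0)`, `(z₁, z₀)`, `(t z₂, z₁)`. -/
noncomputable def deformation (z : Module.Basis (Fin 4) K (Form K 1)) (t : K) :
    Fin 3 → Form K 2 :=
  ![lmul (z 0) (z 0), lmul (z 0) (z 1), lmul (z 1) (z 1) - t • lmul (z 0) (z 2)]

theorem lineHom_deformation (z : Module.Basis (Fin 4) K (Form K 1)) (t : K) (i : Fin 3) :
    lineHom z (deformation z t i : MvPolynomial (Fin 4) K) = Polynomial.X ^ (i : ℕ) := by
  fin_cases i <;> simp [deformation, pow_two]

theorem span_deformation (z : Module.Basis (Fin 4) K (Form K 1)) (t : K) :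
    Submodule.span K (Set.range (deformation z t)) =
      minorSpan (Matrix.of ![![z 0, 0], ![z 1, z 0], ![t • z 2, z 1]]) := by
  have h0 : cross ![![z 0, 0], ![z 1, z 0], ![t • z 2, z 1]] 0 = deformation z t 2 :=
    Subtype.ext (by simp [cross, deformation])
  have h1 : cross ![![z 0, 0], ![z 1, z 0], ![t • z 2, z 1]] 1 = - deformation z t 1 :=
    Subtype.ext (by simp [cross, deformation]; ring)
  have h2 : cross ![![z 0, 0], ![z 1, z 0], ![t • z 2, z 1]] 2 = deformation z t 0 :=
    Subtype.ext (by simp [cross, deformation])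
  refine Eq.trans ?_ (minorSpan_eq _).symm
  refine le_antisymm (Submodule.span_le.2 ?_) (Submodule.span_le.2 ?_)
  · rintro _ ⟨i, rfl⟩
    fin_cases i
    · exact Submodule.subset_span ⟨2, h2⟩
    · exact neg_mem_iff.1 (Submodule.subset_span ⟨1, h1⟩)
    · exact Submodule.subset_span ⟨0, h0⟩
  · rintro _ ⟨i, rfl⟩
    fin_cases i
    · exact Submodule.subset_span ⟨2, h0.symm⟩
    · refine neg_mem_iff.1 (Submodule.subset_span ⟨1, ?_⟩)
      exact (neg_eq_iff_eq_neg.2 h1).symm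
    · exact Submodule.subset_span ⟨0, h2.symm⟩

theorem deformation_notMem_doubleLines (z : Module.Basis (Fin 4) K (Form K 1)) {t : K} (ht : t ≠ 0)
    {W : Gr K (Form K 2) 3} (hW : Framed.IsFrame (deformation z t) W) : W ∉ doubleLines K := by
  intro h
  have h0 := deltaForm_eq_zero (z := z) h hW
  have h1 := lineMatrix_eq_one (lineHom_deformation z t)
  rw [deltaForm, lineDet, adjFrame, h1, Matrix.det_one, one_smul, Matrix.adjugate_one,
    act_one] at h0
  have h2 : (conic (deformation z t) : MvPolynomial (Fin 4) K) =
      - (C t * ((z 0 : MvPolynomial (Fin 4) K) ^ 3 * (z 2 : MvPolynomial (Fin 4) K))) := by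
    simp [conic, deformation, smul_eq_C_mul]
    ring
  rw [h0] at h2
  have hz : ∀ i, (z i : MvPolynomial (Fin 4) K) ≠ 0 := fun i h => z.ne_zero i (Subtype.ext h)
  refine neg_ne_zero.2 (mul_ne_zero ?_ (mul_ne_zero (pow_ne_zero 3 (hz 0)) (hz 2))) h2.symm
  rwa [Ne, C_eq_zero]

theorem detNets_subset_zariskiClosure [Infinite K] :
    detNets K ⊆ zariskiClosure K (detNets K \ doubleLines K) := by
  intro V hV
  by_cases hVG : V ∈ doubleLines K
  · refine Set.mem_sInter.2 fun Z ⟨⟨I, hI, hIZ⟩, hsub⟩ => ?_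
    obtain ⟨z, hz⟩ := exists_basis_of_mem_doubleLines hVG
    have e0 : deformation z 0 = doubleFrame (z 0) (z 1) := by
      simp [deformation, doubleFrame]
    refine (hIZ V _ hz).2 fun f hf => ?_
    rw [← e0]
    refine IsPoly.eq_zero_of_forall_ne (f := fun t => f (deformation z t))
      ((hI f hf).comp ?_) fun t ht => ?_
    · refine .pi fun i => ?_
      fin_cases i
      · exact IsPolyMap.const _
      · exact IsPolyMap.const _
      · exact .sub (.const _) (.smul (IsPolyMap.id (A := K)).isPoly (.const _))
    · have hi := linearIndependent_of_lineHom (lineHom_deformation z t)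
      have hW := isFrame_spanPoint _ hi
      exact (hIZ _ _ hW).1 (hsub ⟨⟨_, span_deformation z t⟩,
        deformation_notMem_doubleLines z ht hW⟩) f hf
  · exact subset_zariskiClosure _ ⟨hV, hVG⟩

end Density

end DetNets

theorem mainTheorem6 (K : Type*) [Field K] [IsAlgClosed K] [CharZero K] :
    -- the sections needed to describe the blow-up of `𝕏` along `𝔾` exist
    (∃ (d r : ℕ) (F : Fin r → (Fin 3 → Form K 2) → K),
      GenerateIdealSheaf K (detNets K) (doubleLines K) d F) ∧
    -- `V ↦ V²` is a rational map from `𝕏` to `G(6, ℱ₄)`, defined as a morphism outside `𝔾`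
    detNets K ⊆ zariskiClosure K (detNets K \ doubleLines K) ∧
    ∃ κ : ↥(detNets K \ doubleLines K) → Gr K (Form K 4) 6,
      IsMorphism K κ ∧ (∀ V, (κ V).1 = square V.1.1) ∧
      -- for the blow-up, in every description:
      ∀ (d r : ℕ) (F : Fin r → (Fin 3 → Form K 2) → K),
        GenerateIdealSheaf K (detNets K) (doubleLines K) d F →
        ∃ Φ : blowUp K (detNets K) (doubleLines K) F → Gr K (Form K 4) 6,
          -- the rational map extends to a morphism `Φ` on the blow-up
          IsMorphism K Φ ∧
          (∀ (p : blowUp K (detNets K) (doubleLines K) F)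
            (hp : p.1.1 ∈ detNets K \ doubleLines K), Φ p = κ ⟨p.1.1, hp⟩) ∧
          -- `(blow-up morphism, Φ)` embeds the blow-up in `𝕏 × G(6, ℱ₄)`
          IsClosedEmbedding K
            (fun p : blowUp K (detNets K) (doubleLines K) F => (p.1.1, Φ p))
            (detNets K ×ˢ Set.univ) ∧
          -- the pullback of the tautological subbundle contains the image of `μ`
          ∀ p : blowUp K (detNets K) (doubleLines K) F, square p.1.1.1 ≤ (Φ p).1 := by
  refine ⟨⟨4, _, _, generateIdealSheaf_productMinor (Fintype.equivFin _).symm⟩,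
    detNets_subset_zariskiClosure, squareMap K, isMorphism_squareMap, fun V => rfl,
    fun d r F hF => ?_⟩
  have H := locallyExtends_squareMap hF
  obtain ⟨Φ, hΦ⟩ := H.exists_isExtension
  rw [blowUp_eq hF]
  refine ⟨Φ, hΦ.isMorphism H, fun p hp => hΦ.apply_of_mem isMorphism_squareMap p ⟨p.1.1, hp⟩ rfl,
    hΦ.isClosedEmbedding H (locallyExtends_generatorMap hF), fun p => ?_⟩
  have h := square_le_of_mem_zariskiClosure (hΦ.mem_closureOver H p).2
  exact h
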